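/- Let $n\ge 2$ and let $\mathfrak g=D_{n+2}=\mathfrak{so}(2n+4,\mathbb C)$ be realized as the Lie algebra of complex $(2n+4)\times(2n+4)$ matrices that are antisymmetric with respect to the antidiagonal. For $1\le i,j\le 2n+4$ write $Y_{i,j}=y_{i,j}=E_{i,j}-E_{2n+5-j,\,2n+5-i}\in\mathfrak g$ for the standard generators. The Cartan subalgebra $\mathfrak h$ consists of the diagonal matrices in $\mathfrak g$, the positive root spaces are those of strictly upper triangular matrices, and a weight $[\chi_1,\chi_2|\chi_3,\ldots,\chi_{n+2}]$ takes the value $\sum_{i=1}^{n+2}\chi_i H_{ii}$ on $H\in\mathfrak h$. Let $\mathfrak p\subset\mathfrak g$ be the parabolic subalgebra given by $\Sigma=\{\alpha_2\}$, i.e. the block upper triangular matrices in $\mathfrak g$ for block sizes $2,2n,2$, whose Levi factor is $\mathfrak{gl}(2,\mathbb C)\oplus\mathfrak{so}(2n,\mathbb C)$. For a $\mathfrak p$-dominant integral weight $\chi$ let $\mathbb V_\chi$ be the finite-dimensional irreducible $\mathfrak p$-module with highest weight $\chi$ and highest weight vector $v_\chi$, and let $M_{\mathfrak p}(\chi)=\mathcal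 U(\mathfrak g)\otimes_{\mathcal U(\mathfrak p)}\mathbb V_\chi$ be the generalized Verma module. Let $\delta=[n+1,n|n-1,\ldots,1,0]$ be half the sum of the positive roots, and let $\nu,\xi$ be the weights $$\nu+\delta=\tfrac12[1,-3\,|\,2n-1,\ldots,5,3,-1],\qquad \xi+\delta=\tfrac12[-1,-3\,|\,2n-1,\ldots,5,3,1].$$ For $i=1,2$ put $$D_i^-=y_{n+2,i}-\sum_{j=3}^{n+1}y_{j,i}\,Y_{n+2,j}\in\mathcal U(\mathfrak g).$$ Then the vector $$v_{\mathrm{ext}}=(D_1^-+D_2^-Y_{21})\otimes v_\nu\in M_{\mathfrak p}(\nu)$$ is an extremal vector of weight $\xi$: it is nonzero, has weight $\xi$, and is annihilated by all positive root spaces of $\mathfrak g$. There is a nonzero homomorphism of $\mathfrak g$-modules $\varphi:M_{\mathfrak p}(\xi)\to M_{\mathfrak p}(\nu)$ with $\varphi(1\otimes v_\xi)=v_{\mathrm{ext}}$, i.e. $\varphi(u\otimes v_\xi)=u\,(D_1^-+D_2^-Y_{21})\otimes v_\nu$ for all $u\in\mathcal U(\mathfrak g)$, and every homomorphism $M_{\mathfrak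 p}(\xi)\to M_{\mathfrak p}(\nu)$ is a scalar multiple of $\varphi$. -/

import Mathlib

namespace OrthogonalVerma

open scoped TensorProduct

attribute [local instance 100] LieRing.ofAssociativeRing

/-! ### The Lie algebra `so(2n+4, ℂ)` of type `D_{n+2}` -/

/-- The Gram matrix of the bilinear form `β(x, y) = ∑ⱼ xⱼ y_{2n+5-j}`: ones on the antidiagonal. -/
def antidiag (n : ℕ) : Matrix (Fin (2 * n + 4)) (Fin (2 * n + 4)) ℂ :=
  Matrix.of fun a b => if b = a.rev then 1 else 0

/-- `D_{n+2} = so(2n+4, ℂ)`, the matrices that are antisymmetric with respect to the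
antidiagonal. -/
abbrev so (n : ℕ) : LieSubalgebra ℂ (Matrix (Fin (2 * n + 4)) (Fin (2 * n + 4)) ℂ) :=
  skewAdjointMatricesLieSubalgebra (antidiag n)

theorem mem_so_iff (n : ℕ) (A : Matrix (Fin (2 * n + 4)) (Fin (2 * n + 4)) ℂ) :
    A ∈ so n ↔ ∀ a b, A b.rev a.rev = -A a b := by
  have h1 : ∀ a b, (A.transpose * antidiag n) a b = A b.rev a := by
    intro a b
    rw [Matrix.mul_apply, Finset.sum_eq_single b.rev]
    · simp [antidiag]
    · intro c _ hc
      have : b ≠ c.rev := fun h => hc (by rw [h, Fin.rev_rev])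
      simp [antidiag, this]
    · simp
  have h2 : ∀ a b, (antidiag n * -A) a b = -A a.rev b := by
    intro a b
    rw [Matrix.mul_apply, Finset.sum_eq_single a.rev]
    · simp [antidiag]
    · intro c _ hc
      simp [antidiag, hc]
    · simp
  rw [mem_skewAdjointMatricesLieSubalgebra, mem_skewAdjointMatricesSubmodule]
  change A.transpose * antidiag n = antidiag n * -A ↔ _
  constructor
  · intro h a b
    have := congrFun (congrFun h a.rev) b
    rw [h1, h2, Fin.rev_rev] at this
    exact this
  · intro h
    ext a b
    rw [h1, h2]
    have := h a.rev b
    rwa [Fin.rev_rev] at this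

/-- The matrix unit `E_{i,j}`, with rows and columns numbered `1, …, 2n+4`. -/
def unitMat (n i j : ℕ) : Matrix (Fin (2 * n + 4)) (Fin (2 * n + 4)) ℂ :=
  Matrix.of fun a b => if (a : ℕ) + 1 = i ∧ (b : ℕ) + 1 = j then 1 else 0

/-- The generator `E_{i,j} - E_{2n+5-j,2n+5-i}` of `so(2n+4, ℂ)`, with indices `1 ≤ i, j ≤ 2n+4`.
For `i > j` these are the `y_{i,j}` and `Y_{i,j}`, for `i < j` the `x_{i,j}` and `X_{i,j}`, and for
`i = j` the `h_i`. -/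
def gen (n i j : ℕ) : so n :=
  ⟨unitMat n i j - unitMat n (2 * n + 5 - j) (2 * n + 5 - i), by
    rw [mem_so_iff]
    intro a b
    have e1 : ((b.rev : ℕ) + 1 = i ∧ (a.rev : ℕ) + 1 = j) ↔
        ((a : ℕ) + 1 = 2 * n + 5 - j ∧ (b : ℕ) + 1 = 2 * n + 5 - i) := by
      simp only [Fin.val_rev]; omega
    have e2 : ((b.rev : ℕ) + 1 = 2 * n + 5 - j ∧ (a.rev : ℕ) + 1 = 2 * n + 5 - i) ↔
        ((a : ℕ) + 1 = i ∧ (b : ℕ) + 1 = j) := by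
      simp only [Fin.val_rev]; omega
    simp only [unitMat, Matrix.sub_apply, Matrix.of_apply, e1, e2]
    ring⟩

/-- The block (`0`, `1` or `2`) in which a row or column lies, for the block sizes `2, 2n, 2`. -/
def block (n : ℕ) (a : Fin (2 * n + 4)) : ℕ :=
  if (a : ℕ) < 2 then 0 else if (a : ℕ) < 2 * n + 2 then 1 else 2

/-- The parabolic subalgebra `𝔭 = 𝔤₀ ⊕ 𝔤₁ ⊕ 𝔤₂` given by `Σ = {α₂}`: the block upper triangular
matrices, with Levi factor `𝔤₀ ≅ gl(2, ℂ) ⊕ so(2n, ℂ)`. -/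
def parabolic (n : ℕ) : LieSubalgebra ℂ (so n) where
  carrier := {X | ∀ a b, block n b < block n a → X.1 a b = 0}
  zero_mem' := by intro a b _; rfl
  add_mem' := by
    intro X Y hX hY a b h
    change X.1 a b + Y.1 a b = 0
    rw [hX a b h, hY a b h, add_zero]
  smul_mem' := by
    intro c X hX a b h
    change c * X.1 a b = 0
    rw [hX a b h, mul_zero]
  lie_mem' := by
    intro X Y hX hY a b h
    have key : ∀ P Q : so n, (∀ a b, block n b < block n a → P.1 a b = 0) →
        (∀ a b, block n b < block n a → Q.1 a b = 0) → (P.1 * Q.1) a b = 0 := by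
      intro P Q hP hQ
      rw [Matrix.mul_apply]
      refine Finset.sum_eq_zero fun c _ => ?_
      rcases lt_or_ge (block n c) (block n a) with hc | hc
      · rw [hP a c hc, zero_mul]
      · rw [hQ c b (lt_of_lt_of_le h hc), mul_zero]
    change (X.1 * Y.1 - Y.1 * X.1) a b = 0
    rw [Matrix.sub_apply, key X Y hX hY, key Y X hY hX, sub_zero]

/-- `X` lies in the Cartan subalgebra `𝔥` of diagonal matrices. -/
def IsCartan (n : ℕ) (X : so n) : Prop := ∀ a b, a ≠ b → X.1 a b = 0

/-- `X` lies in the sum of the positive root spaces of `𝔤`, the strictly upper triangular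
matrices. -/
def IsPositive (n : ℕ) (X : so n) : Prop := ∀ a b, b ≤ a → X.1 a b = 0

/-! ### Weights -/

/-- The value on `X ∈ 𝔥` of the weight `[χ₁, …, χ_{n+2}]`, that is, of `∑ᵢ χᵢ εᵢ`, where
`εᵢ(X)` is the `i`-th diagonal entry of `X`. -/
noncomputable def evalWeight (n : ℕ) (χ : Fin (n + 2) → ℂ) (X : so n) : ℂ :=
  ∑ i : Fin (n + 2), χ i * X.1 (Fin.castLE (by omega) i) (Fin.castLE (by omega) i)

/-- Half the sum of the positive roots, `δ = [n+1, n, …, 1, 0]`. -/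
noncomputable def delta (n : ℕ) (i : Fin (n + 2)) : ℂ := (n : ℂ) + 1 - (i : ℕ)

/-- The weight `ν` with `ν + δ = ½[1, -3 | 2n-1, …, 5, 3, -1]`. -/
noncomputable def nu (n : ℕ) (i : Fin (n + 2)) : ℂ :=
  (if (i : ℕ) = 0 then 1 / 2
    else if (i : ℕ) = 1 then -3 / 2
    else if (i : ℕ) = n + 1 then -1 / 2
    else (2 * ((n : ℂ) + 1 - (i : ℕ)) + 1) / 2) - delta n i

/-- The weight `ξ` with `ξ + δ = ½[-1, -3 | 2n-1, …, 5, 3, 1]`. -/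
noncomputable def xi (n : ℕ) (i : Fin (n + 2)) : ℂ :=
  (if (i : ℕ) = 0 then -1 / 2
    else if (i : ℕ) = 1 then -3 / 2
    else (2 * ((n : ℂ) + 1 - (i : ℕ)) + 1) / 2) - delta n i

/-- `V` is the finite-dimensional irreducible `𝔭`-module `𝕍_χ` with highest weight `χ`, and `v` is
a highest weight vector of it. (Such a module is determined by `χ` up to isomorphism, and
`𝔤₁ ⊕ 𝔤₂` acts on it by zero.) -/
structure IsHighestWeightModule (n : ℕ) (χ : Fin (n + 2) → ℂ) {V : Type*} [AddCommGroup V]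
    [Module ℂ V] [LieRingModule (parabolic n) V] [LieModule ℂ (parabolic n) V] (v : V) : Prop where
  finiteDimensional : FiniteDimensional ℂ V
  irreducible : LieModule.IsIrreducible ℂ (parabolic n) V
  ne_zero : v ≠ 0
  weight : ∀ X : parabolic n, IsCartan n X.1 → ⁅X, v⁆ = evalWeight n χ X.1 • v
  positive : ∀ X : parabolic n, IsPositive n X.1 → ⁅X, v⁆ = 0

/-! ### Generalized Verma modules -/

/-- The universal enveloping algebra `𝒰(𝔤)`. -/
abbrev U (n : ℕ) : Type := UniversalEnvelopingAlgebra ℂ (so n)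

/-- The inclusion `𝔤 → 𝒰(𝔤)`. -/
noncomputable abbrev inc (n : ℕ) (X : so n) : U n := UniversalEnvelopingAlgebra.ι ℂ X

section Verma

variable (n : ℕ) (V : Type*) [AddCommGroup V] [Module ℂ V] [LieRingModule (parabolic n) V]
  [LieModule ℂ (parabolic n) V]

/-- The relations `uX ⊗ v = u ⊗ Xv`, `X ∈ 𝔭`, that turn `𝒰(𝔤) ⊗_ℂ V` into `𝒰(𝔤) ⊗_{𝒰(𝔭)} V`. -/
noncomputable def balancing : Submodule (U n) (U n ⊗[ℂ] V) :=
  Submodule.span (U n) {t | ∃ (u : U n) (X : parabolic n) (v : V),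
    t = (u * inc n X.1) ⊗ₜ[ℂ] v - u ⊗ₜ[ℂ] ⁅X, v⁆}

/-- The generalized Verma module `M_𝔭 = 𝒰(𝔤) ⊗_{𝒰(𝔭)} V`, as a left `𝒰(𝔤)`-module. -/
abbrev Verma : Type _ := (U n ⊗[ℂ] V) ⧸ balancing n V

variable {V}

/-- The element `u ⊗ v` of `𝒰(𝔤) ⊗_{𝒰(𝔭)} V`. -/
noncomputable def vtmul (u : U n) (v : V) : Verma n V :=
  (balancing n V).mkQ (u ⊗ₜ[ℂ] v)

/-- `m` is an extremal vector of weight `χ`: it is nonzero, of weight `χ`, and annihilated by all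
positive root spaces of `𝔤`. -/
structure IsExtremal (χ : Fin (n + 2) → ℂ) (m : Verma n V) : Prop where
  ne_zero : m ≠ 0
  weight : ∀ X : so n, IsCartan n X → inc n X • m = evalWeight n χ X • m
  positive : ∀ X : so n, IsPositive n X → inc n X • m = 0

end Verma

/-! ### The element `D₁⁻ + D₂⁻ Y₂₁` -/

/-- `Dᵢ⁻ = y_{n+2,i} - y_{n+1,i} Y_{n+2,n+1} - y_{n,i} Y_{n+2,n} - … - y_{3,i} Y_{n+2,3}`,
for `i = 1, 2`. -/
noncomputable def Dminus (n i : ℕ) : U n :=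
  inc n (gen n (n + 2) i) -
    ∑ j ∈ Finset.Icc 3 (n + 1), inc n (gen n j i) * inc n (gen n (n + 2) j)

/-- `D₁⁻ + D₂⁻ Y₂₁`. -/
noncomputable def extremalElement (n : ℕ) : U n :=
  Dminus n 1 + Dminus n 2 * inc n (gen n 2 1)

end OrthogonalVerma

/-! Indices start at 0, `a'` is the mirror index `rev a`, `E_{a,b}` stands for `rootVec a b`, and
`l` for `lastIdx n`. Here `ξ = ν + ε_{n+1} - ε_0`, so a vector of weight `ξ` has degree `-1` for the
grading with block degrees `1, 0, -1`. The degree `-1` vectors of `M_𝔭(ν)` are the sums `∑ E_{a,i} ⊗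
w_{a,i}` with `a` in the middle block and `i < 2` (`exists_lowSum`), with unique coefficients in
`𝕍_ν` (`eq_zero_of_sum_vone_eq_zero`). Everything happens in this finite-dimensional piece.

Uniqueness of the coefficients, the part of the PBW theorem that is needed, is tested in a concrete
module: Clifford algebra ⊗ natural representation ⊗ polynomial functions on a chart of the
Grassmannian of planes, twisted by `det^(-n-2)`. It contains a copy of `𝕍_ν` inside vectors `e ⊗ 1`,
and `E_{a,i}` sends `e ⊗ 1` to `(-n-2) e ⊗ x_{a,i}` up to vectors of the form `e' ⊗ 1`, so the
coefficients can be read off.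

Finite-dimensional `𝔭`-modules are handled without complete reducibility. On the Levi factor both
`ν` and `ξ` are minuscule: no other dominant weight lies below them (`IsMinuscule.weight_eq`). Hence
the submodule of `V × E` generated by a pair of singular vectors is a graph, and `V` maps to every
finite-dimensional `E` with a singular vector of the same weight (`exists_hom`).

Extremality is a computation with simple root vectors (`extVec_positive`). It uses that `𝕍_ν` has
`½` in all coordinates `2, …, n`, so that negative root vectors of `gl(n-1)` kill `v_ν`, and that
the remaining numerical coefficients cancel for this `ν`. The extremal vector is nonzero since its
coefficient at `E_{l,0}` is `v_ν`. It lies in a finite-dimensional `𝔭`-submodule, so `exists_hom`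
and Frobenius reciprocity give `φ`.

Uniqueness of `φ` is a leading coefficient argument: a singular vector of weight `ξ` whose
coefficient at `E_{l,0}` vanishes is zero, because its extreme nonzero coefficient would be a
highest weight vector of `𝕍_ν` and its weight then forces the position `(l, 0)`
(`lowSum_eq_zero_of_isSingular`). -/

namespace OrthogonalVerma

open scoped TensorProduct

attribute [local instance 100] LieRing.ofAssociativeRing

/-! ### Eigenspaces -/

section Eigen

variable {M : Type*} [AddCommGroup M] [Module ℂ M]

/-- The sum of the eigenspaces of `A` with eigenvalue in `Λ`. -/
def eigenSum (A : Module.End ℂ M) (Λ : Set ℂ) : Submodule ℂ M := ⨆ c ∈ Λ, A.eigenspace c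

theorem mem_eigenSum {A : Module.End ℂ M} {Λ : Set ℂ} {c : ℂ} (hc : c ∈ Λ) {x : M}
    (hx : A x = c • x) : x ∈ eigenSum A Λ :=
  (le_iSup₂_of_le (f := fun c (_ : c ∈ Λ) => A.eigenspace c) c hc le_rfl)
    (Module.End.mem_eigenspace_iff.2 hx)

theorem eigenSum_mono {A : Module.End ℂ M} {Λ Λ' : Set ℂ} (h : Λ ⊆ Λ') :
    eigenSum A Λ ≤ eigenSum A Λ' :=
  biSup_mono h

theorem eigenSum_le {A : Module.End ℂ M} {Λ : Set ℂ} {P : Submodule ℂ M}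
    (h : ∀ c ∈ Λ, ∀ x, A x = c • x → x ∈ P) : eigenSum A Λ ≤ P :=
  iSup₂_le fun c hc x hx => h c hc x (Module.End.mem_eigenspace_iff.1 hx)

/-- Independence of eigenspaces. It turns a bound on the eigenvalues occurring in a module into a
statement about a single vector. -/
theorem eq_zero_of_mem_eigenSum {A : Module.End ℂ M} {Λ : Set ℂ} {c : ℂ} (hc : c ∉ Λ) {x : M}
    (hx : x ∈ eigenSum A Λ) (hA : A x = c • x) : x = 0 := by
  have h := (Module.End.eigenspaces_iSupIndep A).disjoint_biSup (x := c) (y := Λ) hc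
  exact (Submodule.disjoint_def.1 h) x (Module.End.mem_eigenspace_iff.2 hA) hx

theorem mem_of_mem_sup_eigenSum {A : Module.End ℂ M} {Λ : Set ℂ} {c : ℂ} (hc : c ∉ Λ)
    {P : Submodule ℂ M} (hP : ∀ x ∈ P, A x = c • x) {x : M}
    (hx : x ∈ P ⊔ eigenSum A Λ) (hA : A x = c • x) : x ∈ P := by
  obtain ⟨p, hp, e, he, rfl⟩ := Submodule.mem_sup.1 hx
  have : e = 0 := by
    refine eq_zero_of_mem_eigenSum hc he ?_
    rw [map_add, hP p hp, smul_add] at hA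
    exact add_left_cancel hA
  rwa [this, add_zero]

/-- An eigenspace of one operator is stable under the operators commuting with it, so one may keep
intersecting. The induction carries stability under all operators, including those not yet
diagonalized. -/
theorem exists_common_eigenvector {ι : Type*} (s : Finset ι) (A : ι → Module.End ℂ M)
    (hA : ∀ i j, Commute (A i) (A j)) (K : Submodule ℂ M) [FiniteDimensional ℂ K] (hK : K ≠ ⊥)
    (hs : ∀ i, ∀ x ∈ K, A i x ∈ K) :
    ∃ x ∈ K, x ≠ 0 ∧ ∃ μ : ι → ℂ, ∀ i ∈ s, A i x = μ i • x := by
  classical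
  suffices h : ∃ E : Submodule ℂ M, E ≤ K ∧ E ≠ ⊥ ∧ (∀ i, ∀ x ∈ E, A i x ∈ E) ∧
      ∃ μ : ι → ℂ, ∀ i ∈ s, ∀ x ∈ E, A i x = μ i • x by
    obtain ⟨E, hEK, hE, -, μ, hμ⟩ := h
    obtain ⟨x, hx, hx0⟩ := (Submodule.ne_bot_iff E).1 hE
    exact ⟨x, hEK hx, hx0, μ, fun i hi => hμ i hi x hx⟩
  induction s using Finset.induction_on with
  | empty => exact ⟨K, le_rfl, hK, hs, 0, by simp⟩
  | insert a s ha ih =>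
    obtain ⟨E, hEK, hE, hinv, μ, hμ⟩ := ih
    have : FiniteDimensional ℂ E := Submodule.finiteDimensional_of_le hEK
    have : Nontrivial E := Submodule.nontrivial_iff_ne_bot.2 hE
    obtain ⟨c, hc⟩ := Module.End.exists_eigenvalue ((A a).restrict (hinv a))
    obtain ⟨⟨x, hxE⟩, hx⟩ := hc.exists_hasEigenvector
    have hxa : A a x = c • x := congrArg Subtype.val hx.apply_eq_smul
    have hx0 : x ≠ 0 := fun h => hx.2 (Subtype.ext h)
    refine ⟨E ⊓ (A a).eigenspace c, inf_le_left.trans hEK, ?_, ?_, Function.update μ a c, ?_⟩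
    · exact (Submodule.ne_bot_iff _).2 ⟨x, ⟨hxE, Module.End.mem_eigenspace_iff.2 hxa⟩, hx0⟩
    · rintro i y ⟨hyE, hy⟩
      refine ⟨hinv i y hyE, Module.End.mem_eigenspace_iff.2 ?_⟩
      have := LinearMap.congr_fun (hA a i) y
      simp only [Module.End.mul_apply] at this
      rw [this, Module.End.mem_eigenspace_iff.1 hy, map_smul]
    · rintro i hi y ⟨hyE, hy⟩
      by_cases hia : i = a
      · subst hia
        simpa using Module.End.mem_eigenspace_iff.1 hy
      · rw [Function.update_of_ne hia]
        exact hμ i ((Finset.mem_insert.1 hi).resolve_left hia) y hyE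

theorem exists_nat_of_sl2 {e f h : Module.End ℂ M} (hef : e * f - f * e = h)
    (hhe : h * e - e * h = 2 • e) (hhf : h * f - f * h = -(2 • f))
    {K : Submodule ℂ M} [FiniteDimensional ℂ K]
    (he : ∀ x ∈ K, e x ∈ K) (hf : ∀ x ∈ K, f x ∈ K) {x : M} (hxK : x ∈ K) (hx : x ≠ 0) {μ : ℂ}
    (hμ : h x = μ • x) (hex : e x = 0) :
    ∃ k : ℕ, μ = k ∧ (k = 0 → f x = 0) := by
  have hh : ∀ x ∈ K, h x ∈ K := by
    intro x hx
    rw [← hef]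
    exact K.sub_mem (he _ (hf _ hx)) (hf _ (he _ hx))
  -- An `IsSl2Triple` has `h ≠ 0`. If `h` vanishes on `K`, then `μ = 0`, and the relation `hf - fh =
  -- -2f` already gives `f x = 0`.
  by_cases hh0 : h.restrict hh = 0
  · have h1 : μ = 0 := by
      have := congrArg Subtype.val (LinearMap.congr_fun hh0 ⟨x, hxK⟩)
      simp only [LinearMap.coe_restrict_apply, LinearMap.zero_apply, ZeroMemClass.coe_zero] at this
      rw [hμ] at this
      exact (smul_eq_zero.1 this).resolve_right hx
    refine ⟨0, by simpa using h1, fun _ => ?_⟩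
    have h2 := LinearMap.congr_fun hhf x
    have h3 : ∀ y ∈ K, h y = 0 := fun y hy => by
      simpa using congrArg Subtype.val (LinearMap.congr_fun hh0 ⟨y, hy⟩)
    simp only [LinearMap.sub_apply, Module.End.mul_apply, h3 _ (hf x hxK), h3 x hxK,
      map_zero, sub_zero, LinearMap.neg_apply, LinearMap.smul_apply] at h2
    have := neg_eq_zero.1 h2.symm
    rw [← Nat.cast_smul_eq_nsmul ℂ] at this
    exact (smul_eq_zero.1 this).resolve_left (by norm_num)
  · have t : IsSl2Triple (h.restrict hh) (e.restrict he) (f.restrict hf) := by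
      refine ⟨hh0, ?_, ?_, ?_⟩
      · ext y
        simpa [Ring.lie_def] using LinearMap.congr_fun hef y
      · ext y
        simpa [Ring.lie_def] using LinearMap.congr_fun hhe y
      · ext y
        simpa [Ring.lie_def] using LinearMap.congr_fun hhf y
    have P : t.HasPrimitiveVectorWith (⟨x, hxK⟩ : K) μ :=
      ⟨fun h => hx (congrArg Subtype.val h), Subtype.ext hμ, Subtype.ext hex⟩
    obtain ⟨k, hk⟩ := P.exists_nat
    refine ⟨k, hk, ?_⟩
    rintro rfl
    have := P.pow_toEnd_f_eq_zero_of_eq_nat hk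
    simpa using congrArg Subtype.val this

end Eigen

/-! ### Cyclic submodules and triangular decompositions -/

section Cyclic

variable {L : Type*} [LieRing L] [LieAlgebra ℂ L] {M : Type*} [AddCommGroup M] [Module ℂ M]
  {I : Type*}

theorem rep_comm (ρ : L →ₗ⁅ℂ⁆ Module.End ℂ M) (X Y : L) (x : M) :
    ρ X (ρ Y x) = ρ Y (ρ X x) + ρ ⁅X, Y⁆ x := by
  rw [LieHom.map_lie, Ring.lie_def]
  simp

/-- The smallest subspace that contains `S` and is stable under all `ρ (g i)`. -/
def stableSpan (ρ : L →ₗ⁅ℂ⁆ Module.End ℂ M) (g : I → L) (S : Submodule ℂ M) : Submodule ℂ M :=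
  sInf {N | S ≤ N ∧ ∀ i, ∀ x ∈ N, ρ (g i) x ∈ N}

variable {ρ : L →ₗ⁅ℂ⁆ Module.End ℂ M} {g : I → L} {S : Submodule ℂ M}

theorem le_stableSpan : S ≤ stableSpan ρ g S := le_sInf fun _ h => h.1

theorem stableSpan_le {N : Submodule ℂ M} (h : S ≤ N) (h' : ∀ i, ∀ x ∈ N, ρ (g i) x ∈ N) :
    stableSpan ρ g S ≤ N := sInf_le ⟨h, h'⟩

theorem apply_mem_stableSpan (i : I) {x : M} (hx : x ∈ stableSpan ρ g S) :
    ρ (g i) x ∈ stableSpan ρ g S := by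
  simp only [stableSpan, Submodule.mem_sInf] at hx ⊢
  exact fun N hN => hN.2 i x (hx N hN)

/-- Replaces the reordering of monomials. It suffices to look at the vectors whose images under all
of `L` remain in the span: since `X (g i) x = (g i) X x + [X, g i] x`, they are stable under every
`g i`, and the triangular decomposition `hg` shows that they contain `S`. -/
theorem stableSpan_stable {B : Submodule ℂ L} (hB : ∀ X ∈ B, ∀ x ∈ S, ρ X x ∈ S)
    (hg : ⊤ ≤ Submodule.span ℂ (Set.range g) ⊔ B) (X : L) {x : M}
    (hx : x ∈ stableSpan ρ g S) : ρ X x ∈ stableSpan ρ g S := by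
  let N : Submodule ℂ M :=
    { carrier := {x | x ∈ stableSpan ρ g S ∧ ∀ X, ρ X x ∈ stableSpan ρ g S}
      zero_mem' := ⟨zero_mem _, fun X => by simp⟩
      add_mem' := fun ha hb => ⟨add_mem ha.1 hb.1, fun X => by
        rw [map_add]; exact add_mem (ha.2 X) (hb.2 X)⟩
      smul_mem' := fun c a ha => ⟨Submodule.smul_mem _ c ha.1, fun X => by
        rw [map_smul]; exact Submodule.smul_mem _ c (ha.2 X)⟩ }
  have h : stableSpan ρ g S ≤ N := by
    refine stableSpan_le (fun x hx => ⟨le_stableSpan hx, fun X => ?_⟩) ?_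
    · obtain ⟨Y, hY, Z, hZ, rfl⟩ := Submodule.mem_sup.1 (hg (Submodule.mem_top (x := X)))
      rw [map_add, LinearMap.add_apply]
      refine add_mem ?_ (le_stableSpan (hB Z hZ x hx))
      induction hY using Submodule.span_induction with
      | mem Y hY =>
        obtain ⟨i, rfl⟩ := hY
        exact apply_mem_stableSpan i (le_stableSpan hx)
      | zero => simp
      | add Y Y' _ _ h h' => rw [map_add, LinearMap.add_apply]; exact add_mem h h'
      | smul c Y _ h => rw [map_smul, LinearMap.smul_apply]; exact Submodule.smul_mem _ c h
    · rintro i x ⟨hx, hx'⟩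
      refine ⟨apply_mem_stableSpan i hx, fun X => ?_⟩
      rw [rep_comm]
      exact add_mem (apply_mem_stableSpan i (hx' X)) (hx' _)
  exact (h hx).2 X

theorem apply_eigenvector {H Y : L} {d c : ℂ} (hY : ⁅H, Y⁆ = d • Y) {x : M}
    (hx : ρ H x = c • x) : ρ H (ρ Y x) = (c + d) • ρ Y x := by
  rw [rep_comm, hY, hx, map_smul, map_smul, LinearMap.smul_apply, add_smul]

theorem apply_mem_eigenSum {H Y : L} {d : ℂ} (hY : ⁅H, Y⁆ = d • Y) {Λ Λ' : Set ℂ}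
    (h : ∀ c ∈ Λ, c + d ∈ Λ') {x : M} (hx : x ∈ eigenSum (ρ H) Λ) :
    ρ Y x ∈ eigenSum (ρ H) Λ' := by
  have : eigenSum (ρ H) Λ ≤ (eigenSum (ρ H) Λ').comap (ρ Y) :=
    eigenSum_le fun c hc x hx => mem_eigenSum (h c hc) (apply_eigenvector hY hx)
  exact this hx

theorem stableSpan_le_eigenSum {H : L} {d : I → ℂ} (hd : ∀ i, ⁅H, g i⁆ = d i • g i) {c₀ : ℂ}
    (hS : ∀ x ∈ S, ρ H x = c₀ • x) {Λ : Set ℂ} (h₀ : c₀ ∈ Λ) (h : ∀ i, ∀ c ∈ Λ, c + d i ∈ Λ) :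
    stableSpan ρ g S ≤ eigenSum (ρ H) Λ :=
  stableSpan_le (fun x hx => mem_eigenSum h₀ (hS x hx)) fun i _ hx =>
    apply_mem_eigenSum (hd i) (h i) hx

/-- Each `g i` moves the eigenvalue `c₀` into `Λ`, and `Λ` is never left again. When `c₀ ∉ Λ`, the
vectors of eigenvalue `c₀` in the span are therefore those of `S`. -/
theorem stableSpan_le_sup_eigenSum {H : L} {d : I → ℂ} (hd : ∀ i, ⁅H, g i⁆ = d i • g i) {c₀ : ℂ}
    (hS : ∀ x ∈ S, ρ H x = c₀ • x) {Λ : Set ℂ} (h₀ : ∀ i, c₀ + d i ∈ Λ)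
    (h : ∀ i, ∀ c ∈ Λ, c + d i ∈ Λ) :
    stableSpan ρ g S ≤ S ⊔ eigenSum (ρ H) Λ := by
  refine stableSpan_le le_sup_left fun i x hx => ?_
  obtain ⟨y, hy, z, hz, rfl⟩ := Submodule.mem_sup.1 hx
  rw [map_add]
  refine add_mem (Submodule.mem_sup_right ?_)
    (Submodule.mem_sup_right (apply_mem_eigenSum (hd i) (h i) hz))
  exact mem_eigenSum (h₀ i) (apply_eigenvector (hd i) (hS y hy))

end Cyclic

/-! ### Tensor products and products of representations -/

section Rep

variable {L : Type*} [LieRing L] [LieAlgebra ℂ L] {M N : Type*} [AddCommGroup M] [Module ℂ M]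
  [AddCommGroup N] [Module ℂ N]

/-- The tensor product of two representations. -/
noncomputable def tensorRep (ρ : L →ₗ⁅ℂ⁆ Module.End ℂ M) (σ : L →ₗ⁅ℂ⁆ Module.End ℂ N) :
    L →ₗ⁅ℂ⁆ Module.End ℂ (M ⊗[ℂ] N) where
  toFun X := (ρ X).rTensor N + (σ X).lTensor M
  map_add' X Y := by
    rw [map_add, map_add, LinearMap.rTensor_add, LinearMap.lTensor_add]; abel
  map_smul' c X := by
    rw [map_smul, map_smul, LinearMap.rTensor_smul, LinearMap.lTensor_smul]; simp
  map_lie' {X Y} := by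
    ext m n
    simp only [LieHom.map_lie, Ring.lie_def, TensorProduct.AlgebraTensorModule.curry_apply,
      LinearMap.restrictScalars_self, TensorProduct.curry_apply, LinearMap.add_apply,
      LinearMap.rTensor_tmul, LinearMap.lTensor_tmul, LinearMap.sub_apply, Module.End.mul_apply,
      map_add, TensorProduct.sub_tmul, TensorProduct.tmul_sub]
    abel

theorem tensorRep_tmul (ρ : L →ₗ⁅ℂ⁆ Module.End ℂ M) (σ : L →ₗ⁅ℂ⁆ Module.End ℂ N) (X : L) (m : M)
    (n : N) : tensorRep ρ σ X (m ⊗ₜ n) = ρ X m ⊗ₜ n + m ⊗ₜ σ X n := rfl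

/-- The direct sum of two representations. -/
def prodRep (ρ : L →ₗ⁅ℂ⁆ Module.End ℂ M) (σ : L →ₗ⁅ℂ⁆ Module.End ℂ N) :
    L →ₗ⁅ℂ⁆ Module.End ℂ (M × N) where
  toFun X := (ρ X).prodMap (σ X)
  map_add' X Y := by ext <;> simp
  map_smul' c X := by ext <;> simp
  map_lie' {X Y} := by ext <;> simp [Ring.lie_def]

/-- The restriction of a representation to a stable subspace. -/
def restrictRep (ρ : L →ₗ⁅ℂ⁆ Module.End ℂ M) (F : Submodule ℂ M)
    (hF : ∀ X, ∀ x ∈ F, ρ X x ∈ F) : L →ₗ⁅ℂ⁆ Module.End ℂ F where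
  toFun X := (ρ X).restrict (hF X)
  map_add' X Y := by ext; simp
  map_smul' c X := by ext; simp
  map_lie' {X Y} := by ext; simp [Ring.lie_def]

end Rep

/-! ### Root vectors -/

section RootVectors

variable {n : ℕ}

theorem so_skew (X : so n) (a b : Fin (2 * n + 4)) : X.1 b.rev a.rev = -X.1 a b :=
  (mem_so_iff n X.1).1 X.2 a b

/-- The element `E_{a,b} - E_{b',a'}` of `so(2n+4, ℂ)`, where `a' = rev a`. -/
def rootVec (a b : Fin (2 * n + 4)) : so n :=
  ⟨Matrix.of fun c d => (if c = a ∧ d = b then 1 else 0) -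
      (if c = b.rev ∧ d = a.rev then 1 else 0), by
    rw [mem_so_iff]
    intro c d
    have e1 : (d.rev = a ∧ c.rev = b) ↔ (c = b.rev ∧ d = a.rev) := by
      rw [Fin.rev_eq_iff, Fin.rev_eq_iff]; tauto
    have e2 : (d.rev = b.rev ∧ c.rev = a.rev) ↔ (c = a ∧ d = b) := by
      rw [Fin.rev_inj, Fin.rev_inj]; tauto
    simp only [Matrix.of_apply, e1, e2]
    ring⟩

theorem rootVec_apply (a b c d : Fin (2 * n + 4)) :
    (rootVec a b).1 c d = (if c = a ∧ d = b then 1 else 0) -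
      (if c = b.rev ∧ d = a.rev then 1 else 0) := rfl

theorem gen_eq_rootVec (a b : Fin (2 * n + 4)) :
    gen n (a + 1) (b + 1) = rootVec a b := by
  apply Subtype.ext
  ext c d
  have e1 : ((c : ℕ) + 1 = a + 1 ∧ (d : ℕ) + 1 = b + 1) ↔ (c = a ∧ d = b) := by
    simp only [Fin.ext_iff]; omega
  have e2 : ((c : ℕ) + 1 = 2 * n + 5 - (b + 1) ∧ (d : ℕ) + 1 = 2 * n + 5 - (a + 1)) ↔
      (c = b.rev ∧ d = a.rev) := by
    simp only [Fin.ext_iff, Fin.val_rev]; omega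
  simp only [gen, unitMat, Matrix.sub_apply, Matrix.of_apply, rootVec_apply, e1, e2]

theorem rootVec_rev (a b : Fin (2 * n + 4)) : rootVec b.rev a.rev = -rootVec a b := by
  apply Subtype.ext
  ext c d
  change (rootVec b.rev a.rev).1 c d = -(rootVec a b).1 c d
  simp only [rootVec_apply, Fin.rev_rev]
  ring

theorem rootVec_self_rev (a : Fin (2 * n + 4)) : rootVec a a.rev = 0 := by
  apply Subtype.ext
  ext c d
  change (rootVec a a.rev).1 c d = 0
  simp only [rootVec_apply, Fin.rev_rev, sub_self]

theorem so_coe_sum {ι : Type*} (s : Finset ι) (f : ι → so n) (c d : Fin (2 * n + 4)) :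
    (∑ i ∈ s, f i).1 c d = ∑ i ∈ s, (f i).1 c d := by
  have : (∑ i ∈ s, f i).1 = ∑ i ∈ s, (f i).1 := map_sum (so n).subtype f s
  rw [this, Matrix.sum_apply]

theorem lie_apply (X Y : so n) (c d : Fin (2 * n + 4)) :
    (⁅X, Y⁆ : so n).1 c d = ∑ r, X.1 c r * Y.1 r d - ∑ r, Y.1 c r * X.1 r d := by
  change (X.1 * Y.1 - Y.1 * X.1) c d = _
  rw [Matrix.sub_apply, Matrix.mul_apply, Matrix.mul_apply]

/-- The part `E_{a,b}` contributes column `a` and row `b` of `X`. Skewness of `X` brings the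
contribution of the mirror part to the same shape. -/
theorem lie_rootVec (X : so n) (a b : Fin (2 * n + 4)) :
    ⁅X, rootVec a b⁆ = ∑ c, X.1 c a • rootVec c b - ∑ d, X.1 b d • rootVec a d := by
  apply Subtype.ext
  ext p q
  have hR : (∑ c, X.1 c a • rootVec c b - ∑ d, X.1 b d • rootVec a d : so n).1 p q =
      ∑ c, X.1 c a * (rootVec c b).1 p q - ∑ d, X.1 b d * (rootVec a d).1 p q := by
    change (∑ c, X.1 c a • rootVec c b : so n).1 p q -
      (∑ d, X.1 b d • rootVec a d : so n).1 p q = _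
    rw [so_coe_sum, so_coe_sum]
    rfl
  rw [hR, lie_apply]
  simp only [rootVec_apply, mul_sub, sub_mul, Finset.sum_sub_distrib, mul_ite, ite_mul, mul_one,
    one_mul, mul_zero, zero_mul, ite_and]
  have e1 : ∀ x : Fin (2 * n + 4), (q = x.rev) ↔ (x = q.rev) := fun x => by
    rw [← Fin.rev_eq_iff, eq_comm]
  have e2 : ∀ x : Fin (2 * n + 4), (p = x.rev) ↔ (x = p.rev) := fun x => by
    rw [← Fin.rev_eq_iff, eq_comm]
  simp only [e1, e2, Finset.sum_ite_eq, Finset.sum_ite_eq', Finset.mem_univ, if_true,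
    Finset.sum_const_zero, Finset.sum_ite_irrel]
  have h1 := so_skew X p b.rev
  have h2 := so_skew X a.rev q
  simp only [Fin.rev_rev] at h1 h2
  rw [h1, h2]
  split_ifs <;> ring

/-- The pairs `(a, b)` and `(b', a')` give the same summand, as both the entry and the root vector
change sign; hence the factor `1/2`. -/
theorem so_eq_sum (X : so n) : X = (1 / 2 : ℂ) • ∑ a, ∑ b, X.1 a b • rootVec a b := by
  apply Subtype.ext
  ext p q
  have : ((1 / 2 : ℂ) • ∑ a, ∑ b, X.1 a b • rootVec a b : so n).1 p q =
      (1 / 2) * ∑ a, ∑ b, X.1 a b * (rootVec a b).1 p q := by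
    change (1 / 2) * (∑ a, ∑ b, X.1 a b • rootVec a b : so n).1 p q = _
    rw [so_coe_sum]
    congr 1
    refine Finset.sum_congr rfl fun a _ => ?_
    rw [so_coe_sum]
    rfl
  rw [this]
  have e1 : ∀ x : Fin (2 * n + 4), (q = x.rev) ↔ (x = q.rev) := fun x => by
    rw [← Fin.rev_eq_iff, eq_comm]
  have e2 : ∀ x : Fin (2 * n + 4), (p = x.rev) ↔ (x = p.rev) := fun x => by
    rw [← Fin.rev_eq_iff, eq_comm]
  simp only [rootVec_apply, mul_sub, Finset.sum_sub_distrib, mul_ite, mul_one, mul_zero, ite_and,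
    e1, e2, Finset.sum_ite_eq, Finset.sum_ite_eq', Finset.mem_univ, if_true,
    Finset.sum_const_zero, Finset.sum_ite_irrel]
  rw [so_skew]
  ring

theorem so_mem_of_forall_rootVec {P : Submodule ℂ (so n)} {X : so n}
    (h : ∀ a b, X.1 a b ≠ 0 → rootVec a b ∈ P) : X ∈ P := by
  rw [so_eq_sum X]
  refine P.smul_mem _ (P.sum_mem fun a _ => P.sum_mem fun b _ => ?_)
  by_cases h0 : X.1 a b = 0
  · rw [h0, zero_smul]; exact P.zero_mem
  · exact P.smul_mem _ (h a b h0)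

theorem lie_rootVec_of_isCartan {H : so n} (hH : IsCartan n H) (a b : Fin (2 * n + 4)) :
    ⁅H, rootVec a b⁆ = (H.1 a a - H.1 b b) • rootVec a b := by
  rw [lie_rootVec, Finset.sum_eq_single a, Finset.sum_eq_single b, sub_smul]
  · intro d _ hd
    rw [hH b d hd.symm, zero_smul]
  · simp
  · intro c _ hc
    rw [hH c a hc, zero_smul]
  · simp

theorem lie_rootVec_rootVec_swap {a b : Fin (2 * n + 4)} (hab' : a ≠ b.rev) :
    ⁅rootVec a b, rootVec b a⁆ = rootVec a a - (rootVec b b : so n) := by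
  have hb : b ≠ a.rev := fun h => hab' (by rw [h, Fin.rev_rev])
  rw [lie_rootVec, Finset.sum_eq_single a, Finset.sum_eq_single b]
  · simp [rootVec_apply, hab', hb]
  · intro d _ hd
    simp [rootVec_apply, hab', hd]
  · simp
  · intro c _ hc
    simp [rootVec_apply, hb, hc]
  · simp

theorem isCartan_rootVec_self (a : Fin (2 * n + 4)) : IsCartan n (rootVec a a) := by
  intro c d hcd
  rw [rootVec_apply, if_neg (fun h => hcd (h.1.trans h.2.symm)),
    if_neg (fun h => hcd (h.1.trans h.2.symm)), sub_self]

theorem IsCartan.sub {H H' : so n} (h : IsCartan n H) (h' : IsCartan n H') :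
    IsCartan n (H - H') := by
  intro a b hab
  change H.1 a b - H'.1 a b = 0
  rw [h a b hab, h' a b hab, sub_zero]

theorem rev_ne_self (a : Fin (2 * n + 4)) : a.rev ≠ a := by
  intro h
  have := congrArg Fin.val h
  rw [Fin.val_rev] at this
  omega

theorem rootVec_self_apply (a c : Fin (2 * n + 4)) :
    (rootVec a a).1 c c = (if c = a then 1 else 0) - (if c = a.rev then 1 else 0) := by
  simp [rootVec_apply]

/-- The diagonal matrix with diagonal entries `e₀, …, e_{n+1}, -e_{n+1}, …, -e₀`. -/
def torus (e : Fin (n + 2) → ℂ) : so n :=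
  ⟨Matrix.diagonal fun a => if h : (a : ℕ) < n + 2 then e ⟨a, h⟩
      else -e ⟨a.rev, by rw [Fin.val_rev]; omega⟩, by
    rw [mem_so_iff]
    intro a b
    by_cases hab : a = b
    · subst hab
      rw [Matrix.diagonal_apply_eq, Matrix.diagonal_apply_eq]
      by_cases h : (a : ℕ) < n + 2
      · have h' : ¬ ((a.rev : ℕ) < n + 2) := by rw [Fin.val_rev]; omega
        rw [dif_neg h', dif_pos h]
        simp only [Fin.rev_rev]
      · have h' : ((a.rev : ℕ) < n + 2) := by rw [Fin.val_rev]; omega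
        rw [dif_pos h', dif_neg h, neg_neg]
    · have hab' : b.rev ≠ a.rev := fun h => hab (Fin.rev_inj.1 h).symm
      rw [Matrix.diagonal_apply_ne _ hab, Matrix.diagonal_apply_ne _ hab', neg_zero]⟩

theorem torus_apply (e : Fin (n + 2) → ℂ) (a : Fin (2 * n + 4)) :
    (torus e).1 a a = if h : (a : ℕ) < n + 2 then e ⟨a, h⟩
      else -e ⟨a.rev, by rw [Fin.val_rev]; omega⟩ :=
  Matrix.diagonal_apply_eq _ _

theorem isCartan_torus (e : Fin (n + 2) → ℂ) : IsCartan n (torus e) :=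
  fun _ _ h => Matrix.diagonal_apply_ne _ h

theorem evalWeight_torus (χ e : Fin (n + 2) → ℂ) :
    evalWeight n χ (torus e) = ∑ i, χ i * e i := by
  refine Finset.sum_congr rfl fun i _ => ?_
  rw [torus_apply, dif_pos (by exact i.2)]
  rfl

theorem IsCartan.eq_torus {H : so n} (hH : IsCartan n H) :
    H = torus fun i => H.1 (Fin.castLE (by omega) i) (Fin.castLE (by omega) i) := by
  apply Subtype.ext
  ext a b
  by_cases hab : a = b
  · subst hab
    rw [torus_apply]
    split_ifs with h
    · rfl
    · have := so_skew H a.rev a.rev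
      rw [Fin.rev_rev] at this
      exact this
  · rw [hH a b hab, isCartan_torus _ a b hab]

theorem torus_eq_sum (e : Fin (n + 2) → ℂ) :
    (torus e : so n) = ∑ i, e i • torus (Pi.single i 1) := by
  apply Subtype.ext
  ext a b
  rw [so_coe_sum]
  by_cases hab : a = b
  · subst hab
    have : ∀ i, (e i • torus (Pi.single i 1) : so n).1 a a =
      e i * (torus (Pi.single i 1)).1 a a := fun i => rfl
    simp only [this, torus_apply]
    split_ifs with h
    · simp [Pi.single_apply]
    · simp [Pi.single_apply]
  · rw [isCartan_torus e a b hab]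
    refine (Finset.sum_eq_zero fun i _ => ?_).symm
    change e i * (torus (Pi.single i 1)).1 a b = 0
    rw [isCartan_torus _ a b hab, mul_zero]

theorem evalWeight_rootVec_self (χ : Fin (n + 2) → ℂ) (i : Fin (n + 2)) :
    evalWeight n χ (rootVec (Fin.castLE (by omega) i) (Fin.castLE (by omega) i)) = χ i := by
  rw [evalWeight, Finset.sum_eq_single i]
  · rw [rootVec_self_apply, if_pos rfl, if_neg (rev_ne_self _).symm, sub_zero, mul_one]
  · intro j _ hj
    rw [rootVec_self_apply, if_neg, if_neg, sub_zero, mul_zero]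
    · intro h
      have := congrArg Fin.val h
      simp only [Fin.val_rev, Fin.val_castLE] at this
      omega
    · intro h
      exact hj (Fin.castLE_injective _ h)
  · simp

theorem evalWeight_sub (χ : Fin (n + 2) → ℂ) (X Y : so n) :
    evalWeight n χ (X - Y) = evalWeight n χ X - evalWeight n χ Y := by
  rw [evalWeight, evalWeight, evalWeight, ← Finset.sum_sub_distrib]
  exact Finset.sum_congr rfl fun i _ => mul_sub _ _ _

theorem evalWeight_neg (χ : Fin (n + 2) → ℂ) (X : so n) :
    evalWeight n χ (-X) = -evalWeight n χ X := by
  rw [evalWeight, evalWeight, ← Finset.sum_neg_distrib]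
  exact Finset.sum_congr rfl fun i _ => mul_neg _ _

/-! ### The parabolic subalgebra -/

theorem block_le_two (a : Fin (2 * n + 4)) : block n a ≤ 2 := by
  unfold block; split_ifs <;> omega

theorem block_rev (a : Fin (2 * n + 4)) : block n a.rev = 2 - block n a := by
  unfold block
  have := a.2
  rw [Fin.val_rev]
  split_ifs <;> omega

theorem block_mono {a b : Fin (2 * n + 4)} (h : a ≤ b) : block n a ≤ block n b := by
  have h : (a : ℕ) ≤ b := h
  unfold block
  split_ifs <;> omega

theorem mem_parabolic {X : so n} :
    X ∈ parabolic n ↔ ∀ a b, block n b < block n a → X.1 a b = 0 := Iff.rfl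

theorem rootVec_mem_parabolic {a b : Fin (2 * n + 4)} (h : block n a ≤ block n b) :
    rootVec a b ∈ parabolic n := by
  intro c d hcd
  rw [rootVec_apply, if_neg, if_neg, sub_zero]
  · rintro ⟨rfl, rfl⟩
    rw [block_rev, block_rev] at hcd
    omega
  · rintro ⟨rfl, rfl⟩
    omega

/-- The root vector `rootVec a b` as an element of the parabolic subalgebra. -/
def parVec (a b : Fin (2 * n + 4)) (h : block n a ≤ block n b) : parabolic n :=
  ⟨rootVec a b, rootVec_mem_parabolic h⟩

theorem IsCartan.mem_parabolic {H : so n} (hH : IsCartan n H) : H ∈ parabolic n := by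
  intro a b h
  exact hH a b (by rintro rfl; omega)

theorem isPositive_rootVec {a b : Fin (2 * n + 4)} (h : a < b) : IsPositive n (rootVec a b) := by
  intro c d hdc
  rw [rootVec_apply, if_neg, if_neg, sub_zero]
  · rintro ⟨rfl, rfl⟩
    rw [Fin.rev_le_rev] at hdc
    exact absurd h (not_lt.2 hdc)
  · rintro ⟨rfl, rfl⟩
    exact absurd h (not_lt.2 hdc)

/-- The pairs `(a, b)` that index the negative root vectors of the Levi factor. -/
abbrev LeviIndex (n : ℕ) : Type :=
  {p : Fin (2 * n + 4) × Fin (2 * n + 4) // block n p.1 = block n p.2 ∧ p.2 < p.1}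

/-- The negative root vectors of the Levi factor. -/
def leviVec (p : LeviIndex n) : parabolic n := parVec p.1.1 p.1.2 p.2.1.le

/-- The Borel subalgebra of upper triangular matrices. -/
def borel (n : ℕ) : Submodule ℂ (parabolic n) where
  carrier := {X | ∀ a b, b < a → X.1.1 a b = 0}
  zero_mem' := fun _ _ _ => rfl
  add_mem' := fun {X Y} hX hY a b h => by
    change X.1.1 a b + Y.1.1 a b = 0
    rw [hX a b h, hY a b h, add_zero]
  smul_mem' := fun c X hX a b h => by
    change c * X.1.1 a b = 0
    rw [hX a b h, mul_zero]

/-- The nilradical of `𝔭` is strictly upper triangular and so belongs to the Borel subalgebra; only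
the negative root vectors of the Levi factor have to be added. -/
theorem top_le_span_leviVec :
    ⊤ ≤ Submodule.span ℂ (Set.range (leviVec (n := n))) ⊔ borel n := by
  intro X _
  have : X.1 ∈ (Submodule.span ℂ (Set.range (leviVec (n := n))) ⊔ borel n).map
      (parabolic n).toSubmodule.subtype := by
    refine so_mem_of_forall_rootVec fun a b hab => ?_
    have hb : block n a ≤ block n b := not_lt.1 fun h => hab (X.2 a b h)
    refine ⟨parVec a b hb, ?_, rfl⟩
    rcases lt_or_ge b a with h | h
    · exact Submodule.mem_sup_left (Submodule.subset_span
        ⟨⟨(a, b), hb.antisymm (block_mono h.le), h⟩, rfl⟩)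
    · refine Submodule.mem_sup_right ?_
      rcases h.lt_or_eq with h | rfl
      · exact fun c d hdc => isPositive_rootVec h c d hdc.le
      · exact fun c d hdc => isCartan_rootVec_self a c d hdc.ne'
  obtain ⟨Y, hY, hYX⟩ := this
  have : Y = X := Subtype.ext hYX
  rwa [← this]

/-- An upper triangular matrix is the sum of a diagonal and a strictly upper triangular one. -/
theorem exists_cartan_add_positive {X : parabolic n} (hX : X ∈ borel n) :
    ∃ H P : parabolic n, IsCartan n H.1 ∧ IsPositive n P.1 ∧ X = H + P := by
  let H : so n := torus fun i => X.1.1 (Fin.castLE (by omega) i) (Fin.castLE (by omega) i)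
  have hH : IsCartan n H := isCartan_torus _
  refine ⟨⟨H, hH.mem_parabolic⟩, X - ⟨H, hH.mem_parabolic⟩, hH, ?_, by abel⟩
  intro a b hba
  change X.1.1 a b - H.1 a b = 0
  rcases hba.lt_or_eq with h | rfl
  · rw [hX a b h, hH a b h.ne', sub_zero]
  · rw [torus_apply]
    split_ifs with h
    · exact sub_self _
    · have := so_skew X.1 b.rev b.rev
      rw [Fin.rev_rev] at this
      rw [this]
      exact sub_self _

end RootVectors

/-! ### Highest weight vectors of the parabolic subalgebra -/

section HighestWeight

variable {n : ℕ}

/-- `u` is a vector of weight `χ` that is annihilated by the positive root spaces in `𝔭`. -/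
structure IsSingular (n : ℕ) (χ : Fin (n + 2) → ℂ) {M : Type*} [AddCommGroup M] [Module ℂ M]
    (ρ : parabolic n →ₗ⁅ℂ⁆ Module.End ℂ M) (u : M) : Prop where
  weight : ∀ X : parabolic n, IsCartan n X.1 → ρ X u = evalWeight n χ X.1 • u
  positive : ∀ X : parabolic n, IsPositive n X.1 → ρ X u = 0

/-! ### Cyclic modules generated by singular vectors, and dominance -/

section

variable {χ : Fin (n + 2) → ℂ} {M : Type*} [AddCommGroup M] [Module ℂ M]
  {ρ : parabolic n →ₗ⁅ℂ⁆ Module.End ℂ M} {u : M}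

/-- The cyclic `𝔭`-submodule generated by a singular vector. -/
def cyclicSpan (ρ : parabolic n →ₗ⁅ℂ⁆ Module.End ℂ M) (u : M) : Submodule ℂ M :=
  stableSpan ρ leviVec (Submodule.span ℂ {u})

theorem self_mem_cyclicSpan : u ∈ cyclicSpan ρ u :=
  le_stableSpan (Submodule.mem_span_singleton_self u)

/-- The line through a singular vector is stable under the Borel subalgebra, so `stableSpan_stable`
applies. -/
theorem IsSingular.apply_mem_cyclicSpan (hu : IsSingular n χ ρ u) (X : parabolic n) {x : M}
    (hx : x ∈ cyclicSpan ρ u) : ρ X x ∈ cyclicSpan ρ u := by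
  refine stableSpan_stable (B := borel n) (fun Y hY y hy => ?_) top_le_span_leviVec X hx
  obtain ⟨c, rfl⟩ := Submodule.mem_span_singleton.1 hy
  obtain ⟨H, P, hH, hP, rfl⟩ := exists_cartan_add_positive hY
  rw [map_smul, map_add, LinearMap.add_apply, hu.weight H hH, hu.positive P hP, add_zero]
  rw [smul_comm]
  exact Submodule.smul_mem _ _ hy

/-- A diagonal matrix as an element of the parabolic subalgebra. -/
def parTorus (e : Fin (n + 2) → ℂ) : parabolic n := ⟨torus e, (isCartan_torus e).mem_parabolic⟩

theorem isCartan_parTorus (e : Fin (n + 2) → ℂ) : IsCartan n (parTorus e).1 := isCartan_torus e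

theorem evalWeight_parTorus (χ e : Fin (n + 2) → ℂ) :
    evalWeight n χ (parTorus e).1 = ∑ i, χ i * e i := evalWeight_torus χ e

theorem lie_leviVec {H : parabolic n} (hH : IsCartan n H.1) (p : LeviIndex n) :
    ⁅H, leviVec p⁆ = (H.1.1 p.1.1 p.1.1 - H.1.1 p.1.2 p.1.2) • leviVec p :=
  Subtype.ext (lie_rootVec_of_isCartan hH _ _)

theorem IsSingular.cyclicSpan_le_eigenSum (hu : IsSingular n χ ρ u) {H : parabolic n}
    (hH : IsCartan n H.1) {Λ : Set ℂ} (h₀ : evalWeight n χ H.1 ∈ Λ)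
    (h : ∀ a b : Fin (2 * n + 4), block n a = block n b → b < a → ∀ c ∈ Λ,
      c + (H.1.1 a a - H.1.1 b b) ∈ Λ) :
    cyclicSpan ρ u ≤ eigenSum (ρ H) Λ := by
  refine stableSpan_le_eigenSum (lie_leviVec hH) (fun x hx => ?_) h₀
    fun p c hc => h _ _ p.2.1 p.2.2 c hc
  obtain ⟨c, rfl⟩ := Submodule.mem_span_singleton.1 hx
  rw [map_smul, hu.weight H hH, smul_comm]

/-- `Λ` may be any set that contains `χ(H)` and is closed under adding values of negative Levi
roots. Different choices of `H` and `Λ` yield the height bound, the comparison of single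
coordinates, and the parity constraint. -/
theorem IsSingular.eigenvalue_mem (hu : IsSingular n χ ρ u) {H : parabolic n}
    (hH : IsCartan n H.1) {Λ : Set ℂ} (h₀ : evalWeight n χ H.1 ∈ Λ)
    (h : ∀ a b : Fin (2 * n + 4), block n a = block n b → b < a → ∀ c ∈ Λ,
      c + (H.1.1 a a - H.1.1 b b) ∈ Λ)
    {x : M} (hx : x ∈ cyclicSpan ρ u) (hx0 : x ≠ 0) {c : ℂ} (hc : ρ H x = c • x) : c ∈ Λ := by
  by_contra h'
  exact hx0 (eq_zero_of_mem_eigenSum h' (hu.cyclicSpan_le_eigenSum hH h₀ h hx) hc)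

/-- The diagonal matrix with entries `2n+3, 2n+1, …, 1, -1, …, -2n-3`. -/
def heightEl (n : ℕ) : parabolic n := parTorus fun i => 2 * (n : ℂ) + 3 - 2 * (i : ℕ)

theorem isCartan_heightEl : IsCartan n (heightEl n).1 :=
  isCartan_torus fun i : Fin (n + 2) => 2 * (n : ℂ) + 3 - 2 * (i : ℕ)

theorem heightEl_apply (a : Fin (2 * n + 4)) :
    (heightEl n).1.1 a a = 2 * (n : ℂ) + 3 - 2 * (a : ℕ) := by
  refine (torus_apply (fun i : Fin (n + 2) => 2 * (n : ℂ) + 3 - 2 * (i : ℕ)) a).trans ?_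
  split_ifs with h
  · rfl
  · have : ((a.rev : ℕ) : ℂ) = 2 * (n : ℂ) + 3 - (a : ℕ) := by
      have h1 : (a.rev : ℕ) + a = 2 * n + 3 := by rw [Fin.val_rev]; omega
      have h2 : ((a.rev : ℕ) : ℂ) + ((a : ℕ) : ℂ) = 2 * (n : ℂ) + 3 := by exact_mod_cast h1
      linear_combination h2
    simp only [this]
    ring

theorem heightEl_sub (a b : Fin (2 * n + 4)) :
    (heightEl n).1.1 a a - (heightEl n).1.1 b b = -(2 * (((a : ℕ) : ℂ) - ((b : ℕ) : ℂ))) := by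
  rw [heightEl_apply, heightEl_apply]; ring

theorem heightEl_sub_of_lt {a b : Fin (2 * n + 4)} (h : b < a) :
    ∃ k : ℕ, (heightEl n).1.1 a a - (heightEl n).1.1 b b = -((k : ℂ) + 1) := by
  have h : (b : ℕ) < a := h
  refine ⟨2 * (a - b) - 1, ?_⟩
  have h1 : 2 * ((a : ℕ) - b) - 1 + 1 + 2 * b = 2 * (a : ℕ) := by omega
  have h2 : ((2 * ((a : ℕ) - b) - 1 : ℕ) : ℂ) + 1 + 2 * (b : ℕ) = 2 * (a : ℕ) := by
    exact_mod_cast h1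
  rw [heightEl_sub]
  linear_combination h2

theorem IsSingular.height_eigenvalue (hu : IsSingular n χ ρ u)
    {x : M} (hx : x ∈ cyclicSpan ρ u) (hx0 : x ≠ 0) {c : ℂ} (hc : ρ (heightEl n) x = c • x) :
    ∃ k : ℕ, c = evalWeight n χ (heightEl n).1 - k := by
  refine hu.eigenvalue_mem (Λ := {c | ∃ k : ℕ, c = evalWeight n χ (heightEl n).1 - k})
    isCartan_heightEl ⟨0, by simp⟩ ?_ hx hx0 hc
  rintro a b - hba _ ⟨k, rfl⟩
  obtain ⟨l, hl⟩ := heightEl_sub_of_lt hba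
  exact ⟨k + l + 1, by rw [hl]; push_cast; ring⟩

/-- A vector of the cyclic module whose height is that of the generator is a multiple of it. -/
theorem IsSingular.mem_span_of_height (hu : IsSingular n χ ρ u)
    {x : M} (hx : x ∈ cyclicSpan ρ u)
    (hc : ρ (heightEl n) x = evalWeight n χ (heightEl n).1 • x) : x ∈ Submodule.span ℂ {u} := by
  have h0 : ∀ y ∈ Submodule.span ℂ {u}, ρ (heightEl n) y =
      evalWeight n χ (heightEl n).1 • y := by
    intro y hy
    obtain ⟨c, rfl⟩ := Submodule.mem_span_singleton.1 hy
    rw [map_smul, hu.weight _ isCartan_heightEl, smul_comm]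
  refine mem_of_mem_sup_eigenSum
    (Λ := {c | ∃ k : ℕ, c = evalWeight n χ (heightEl n).1 - (k + 1)}) ?_ h0
    (stableSpan_le_sup_eigenSum (lie_leviVec isCartan_heightEl) h0 ?_ ?_ hx) hc
  · rintro ⟨k, hk⟩
    have : ((k : ℂ) + 1) = 0 := by linear_combination hk
    exact Nat.cast_add_one_ne_zero k this
  · intro p
    obtain ⟨l, hl⟩ := heightEl_sub_of_lt p.2.2
    exact ⟨l, by rw [hl]; ring⟩
  · rintro p _ ⟨k, rfl⟩
    obtain ⟨l, hl⟩ := heightEl_sub_of_lt p.2.2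
    exact ⟨k + l + 1, by rw [hl]; push_cast; ring⟩

/-- A nonzero `𝔭`-stable subspace of a finite-dimensional cyclic module contains a singular
vector. -/
theorem IsSingular.exists_isSingular (hu : IsSingular n χ ρ u) {K : Submodule ℂ M}
    [FiniteDimensional ℂ K] (hK : K ≠ ⊥) (hKu : K ≤ cyclicSpan ρ u)
    (hKs : ∀ X, ∀ x ∈ K, ρ X x ∈ K) :
    ∃ x ∈ K, x ≠ 0 ∧ ∃ μ, (∀ X : parabolic n, IsCartan n X.1 → ρ X x = evalWeight n μ X.1 • x) ∧
      ∀ a b : Fin (2 * n + 4), ∀ h : block n a ≤ block n b, a < b → ρ (parVec a b h) x = 0 := by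
  classical
  -- `P k`: some eigenvector in `K` lies `k` below the generator in height. The least such `k` gives
  -- the top layer of `K`.
  let P : ℕ → Prop := fun k => ∃ x ∈ K, x ≠ 0 ∧
    ρ (heightEl n) x = (evalWeight n χ (heightEl n).1 - k) • x
  have hP : ∃ k, P k := by
    obtain ⟨x, hx, hx0, μ, hμ⟩ := exists_common_eigenvector {()} (fun _ => ρ (heightEl n))
      (fun _ _ => Commute.refl _) K hK fun _ => hKs _
    have hμ := hμ () (Finset.mem_singleton_self _)
    obtain ⟨k, hk⟩ := hu.height_eigenvalue (hKu hx) hx0 hμ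
    exact ⟨k, x, hx, hx0, by rw [hμ, hk]⟩
  obtain ⟨x₀, hx₀, hx₀0, hk⟩ := Nat.find_spec hP
  set k := Nat.find hP with hkdef
  have hcomm : ∀ H H' : parabolic n, IsCartan n H.1 → IsCartan n H'.1 → ⁅H, H'⁆ = 0 := by
    intro H H' hH hH'
    apply Subtype.ext
    apply Subtype.ext
    change H.1.1 * H'.1.1 - H'.1.1 * H.1.1 = 0
    have : ∀ H : parabolic n, IsCartan n H.1 → H.1.1 = Matrix.diagonal fun a => H.1.1 a a := by
      intro H hH
      ext a b
      by_cases hab : a = b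
      · subst hab; rw [Matrix.diagonal_apply_eq]
      · rw [Matrix.diagonal_apply_ne _ hab, hH a b hab]
    rw [this H hH, this H' hH', Matrix.diagonal_mul_diagonal, Matrix.diagonal_mul_diagonal,
      sub_eq_zero]
    congr 1
    ext a
    exact mul_comm _ _
  -- The torus preserves the top layer because it commutes with the height element, so it has a
  -- common eigenvector there.
  let K' : Submodule ℂ M := K ⊓ (ρ (heightEl n)).eigenspace (evalWeight n χ (heightEl n).1 - k)
  have : FiniteDimensional ℂ K' := Submodule.finiteDimensional_of_le inf_le_left
  have hK' : K' ≠ ⊥ := (Submodule.ne_bot_iff _).2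
    ⟨x₀, ⟨hx₀, Module.End.mem_eigenspace_iff.2 hk⟩, hx₀0⟩
  obtain ⟨x, ⟨hxK, hxh⟩, hx0, μ, hμ⟩ := exists_common_eigenvector Finset.univ
    (fun i : Fin (n + 2) => ρ (parTorus (Pi.single i 1)))
    (fun i j => by
      rw [commute_iff_lie_eq, ← LieHom.map_lie, hcomm _ _ (isCartan_torus _) (isCartan_torus _),
        map_zero])
    K' hK' (by
      rintro i y ⟨hyK, hy⟩
      refine ⟨hKs _ _ hyK, Module.End.mem_eigenspace_iff.2 ?_⟩
      rw [rep_comm, hcomm _ _ isCartan_heightEl (isCartan_torus _),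
        Module.End.mem_eigenspace_iff.1 hy, map_zero, map_smul, LinearMap.zero_apply, add_zero])
  replace hxh := Module.End.mem_eigenspace_iff.1 hxh
  refine ⟨x, hxK, hx0, μ, fun X hX => ?_, fun a b hblock hab => ?_⟩
  · have hXsum : X = ∑ i : Fin (n + 2),
        X.1.1 (Fin.castLE (by omega) i) (Fin.castLE (by omega) i) • parTorus (Pi.single i 1) := by
      apply Subtype.ext
      have := hX.eq_torus
      rw [torus_eq_sum] at this
      exact this.trans (map_sum (parabolic n).subtype (fun i : Fin (n + 2) =>
        X.1.1 (Fin.castLE (by omega) i) (Fin.castLE (by omega) i) • parTorus (Pi.single i 1)) _).symm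
    have h1 : ρ X x = ∑ i : Fin (n + 2),
        X.1.1 (Fin.castLE (by omega) i) (Fin.castLE (by omega) i) •
          ρ (parTorus (Pi.single i 1)) x := by
      conv_lhs => rw [hXsum]
      rw [map_sum, LinearMap.sum_apply]
      exact Finset.sum_congr rfl fun i _ => by rw [map_smul, LinearMap.smul_apply]
    rw [h1, evalWeight, Finset.sum_smul]
    refine Finset.sum_congr rfl fun i _ => ?_
    rw [hμ i (Finset.mem_univ i), smul_smul, mul_comm]
  -- A nonzero image under a positive root vector would have larger height than the top layer,
  -- against the minimality of `k`.
  · by_contra hne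
    have hbr : ⁅heightEl n, parVec a b hblock⁆ =
        ((heightEl n).1.1 a a - (heightEl n).1.1 b b) • parVec a b hblock :=
      Subtype.ext (lie_rootVec_of_isCartan isCartan_heightEl _ _)
    have h1 := apply_eigenvector hbr hxh
    obtain ⟨l, hl⟩ := heightEl_sub_of_lt hab
    obtain ⟨m, hm⟩ := hu.height_eigenvalue (hKu (hKs _ _ hxK)) hne h1
    have hml : ((m + l + 1 : ℕ) : ℂ) = k := by push_cast; linear_combination hm + hl
    have hml : m + l + 1 = k := by exact_mod_cast hml
    have hPm : P m := ⟨_, hKs _ _ hxK, hne, by rw [h1, hm]⟩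
    have := Nat.find_min' hP hPm
    omega

/-- Dominance of the weight of a vector annihilated by a positive root vector. -/
theorem exists_nat_of_parVec {K : Submodule ℂ M} [FiniteDimensional ℂ K]
    (hKs : ∀ X, ∀ x ∈ K, ρ X x ∈ K) {x : M} (hxK : x ∈ K) (hx0 : x ≠ 0) {μ : Fin (n + 2) → ℂ}
    (hμ : ∀ X : parabolic n, IsCartan n X.1 → ρ X x = evalWeight n μ X.1 • x)
    {a b : Fin (2 * n + 4)} (hab : a ≠ b) (hab' : a ≠ b.rev) (hblock : block n a = block n b)
    (hx : ρ (parVec a b hblock.le) x = 0) :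
    ∃ k : ℕ, evalWeight n μ (rootVec a a - rootVec b b) = k ∧
      (k = 0 → ρ (parVec b a hblock.ge) x = 0) := by
  have hC : IsCartan n (rootVec a a - rootVec b b : so n) :=
    (isCartan_rootVec_self a).sub (isCartan_rootVec_self b)
  have hba' : b ≠ a.rev := fun h => hab' (by rw [h, Fin.rev_rev])
  have hrr : a.rev ≠ b.rev := fun h => hab (Fin.rev_inj.1 h)
  have happ : ∀ c : Fin (2 * n + 4), (rootVec a a - rootVec b b : so n).1 c c =
      (rootVec a a).1 c c - (rootVec b b).1 c c := fun _ => rfl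
  have h1 : (rootVec a a - rootVec b b : so n).1 a a = 1 := by
    rw [happ, rootVec_self_apply, rootVec_self_apply, if_pos rfl, if_neg (rev_ne_self a).symm,
      if_neg hab, if_neg hab']
    norm_num
  have h2 : (rootVec a a - rootVec b b : so n).1 b b = -1 := by
    rw [happ, rootVec_self_apply, rootVec_self_apply, if_pos rfl, if_neg (rev_ne_self b).symm,
      if_neg hab.symm, if_neg hba']
    norm_num
  let H : parabolic n := ⟨rootVec a a - rootVec b b, hC.mem_parabolic⟩
  have e1 : ⁅parVec a b hblock.le, parVec b a hblock.ge⁆ = H :=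
    Subtype.ext (lie_rootVec_rootVec_swap hab')
  have e2 : ⁅H, parVec a b hblock.le⁆ = 2 • parVec a b hblock.le := by
    apply Subtype.ext
    refine (lie_rootVec_of_isCartan hC a b).trans ?_
    rw [h1, h2, sub_neg_eq_add, one_add_one_eq_two, ofNat_smul_eq_nsmul]
    rfl
  have e3 : ⁅H, parVec b a hblock.ge⁆ = -(2 • parVec b a hblock.ge) := by
    apply Subtype.ext
    refine (lie_rootVec_of_isCartan hC b a).trans ?_
    rw [h1, h2, show (-1 : ℂ) - 1 = -2 by norm_num, neg_smul, ofNat_smul_eq_nsmul]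
    rfl
  refine exists_nat_of_sl2 (e := ρ (parVec a b hblock.le)) (f := ρ (parVec b a hblock.ge))
    (h := ρ H) ?_ ?_ ?_ (hKs _) (hKs _) hxK hx0 (hμ H hC) hx
  · rw [← Ring.lie_def, ← LieHom.map_lie, e1]
  · rw [← Ring.lie_def, ← LieHom.map_lie, e2, map_nsmul]
  · rw [← Ring.lie_def, ← LieHom.map_lie, e3, map_neg, map_nsmul]

/-- The diagonal entries of a diagonal matrix with integer entries `e₀, …, e_{n+1}` in its upper
half. -/
def torusEntry (n : ℕ) (e : ℕ → ℤ) (a : ℕ) : ℤ := if a < n + 2 then e a else -e (2 * n + 3 - a)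

theorem parTorus_apply (e : ℕ → ℤ) (a : Fin (2 * n + 4)) :
    (parTorus fun i : Fin (n + 2) => (e i : ℂ)).1.1 a a = (torusEntry n e a : ℂ) := by
  refine (torus_apply (fun i : Fin (n + 2) => (e i : ℂ)) a).trans ?_
  unfold torusEntry
  split_ifs with h
  · rfl
  · have : (a.rev : ℕ) = 2 * n + 3 - a := by rw [Fin.val_rev]; omega
    rw [Int.cast_neg, ← this]

theorem evalWeight_rootVec_of_lt (χ : Fin (n + 2) → ℂ) (a : Fin (2 * n + 4))
    (h : (a : ℕ) < n + 2) : evalWeight n χ (rootVec a a) = χ ⟨a, h⟩ :=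
  evalWeight_rootVec_self χ ⟨a, h⟩

/-- The restriction to the Levi factor `gl(2) ⊕ so(2n)` of the weight is minuscule, of the form
`[c + ε, c | ½, …, ½, ±½]` with `ε = 0` or `1`. -/
structure IsMinuscule (n : ℕ) (χ : Fin (n + 2) → ℂ) : Prop where
  gl : ∃ k : ℕ, k ≤ 1 ∧ χ 0 - χ 1 = k
  half : ∀ i : Fin (n + 2), 2 ≤ (i : ℕ) → (i : ℕ) ≤ n → χ i = 1 / 2
  last : χ (Fin.last (n + 1)) = 1 / 2 ∨ χ (Fin.last (n + 1)) = -1 / 2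

/-- The weight `μ - χ` is a sum of negative Levi roots; it is tested on the integral cocharacter
`e`. The sets `S` that get used are the nonpositive integers, `{0}` and the even integers. -/
theorem IsSingular.torus_eigenvalue (hu : IsSingular n χ ρ u) {x : M} (hx : x ∈ cyclicSpan ρ u)
    (hx0 : x ≠ 0) {μ : Fin (n + 2) → ℂ}
    (hμ : ∀ X : parabolic n, IsCartan n X.1 → ρ X x = evalWeight n μ X.1 • x)
    (e : ℕ → ℤ) (S : Set ℤ) (h0 : 0 ∈ S)
    (hS : ∀ a b : Fin (2 * n + 4), block n a = block n b → b < a → ∀ s ∈ S,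
      s + (torusEntry n e a - torusEntry n e b) ∈ S) :
    ∃ s ∈ S, ∑ i, μ i * (e i : ℂ) = ∑ i, χ i * (e i : ℂ) + s := by
  have hC : IsCartan n (parTorus fun i : Fin (n + 2) => (e i : ℂ)).1 := isCartan_parTorus _
  have h1 := hμ _ hC
  rw [evalWeight_parTorus] at h1
  refine hu.eigenvalue_mem hC
    (Λ := {c : ℂ | ∃ s ∈ S, c = ∑ i, χ i * (e i : ℂ) + s}) ?_ ?_ hx hx0 h1
  · rw [evalWeight_parTorus]
    exact ⟨0, h0, by rw [Int.cast_zero, add_zero]⟩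
  · rintro a b hab hba _ ⟨s, hs, rfl⟩
    refine ⟨_, hS a b hab hba s hs, ?_⟩
    rw [parTorus_apply, parTorus_apply]
    push_cast
    ring

theorem torusEntry_zero_le {a b : Fin (2 * n + 4)} (hab : block n a = block n b) (hba : b < a) :
    torusEntry n (fun i => if i = 0 then 1 else 0) a -
      torusEntry n (fun i => if i = 0 then 1 else 0) b ≤ 0 := by
  have hba : (b : ℕ) < a := hba
  have := a.2
  simp only [torusEntry]
  unfold block at hab
  split_ifs at * <;> omega

theorem torusEntry_two_le {a b : Fin (2 * n + 4)} (hab : block n a = block n b) (hba : b < a) :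
    torusEntry n (fun i => if i = 2 then 1 else 0) a -
      torusEntry n (fun i => if i = 2 then 1 else 0) b ≤ 0 := by
  have hba : (b : ℕ) < a := hba
  have := a.2
  simp only [torusEntry]
  unfold block at hab
  split_ifs at * <;> omega

theorem torusEntry_gl {a b : Fin (2 * n + 4)} (hab : block n a = block n b) :
    torusEntry n (fun i => if i ≤ 1 then 1 else 0) a =
      torusEntry n (fun i => if i ≤ 1 then 1 else 0) b := by
  have := a.2
  have := b.2
  simp only [torusEntry]
  unfold block at hab
  split_ifs at * <;> omega

/-- Roots `±ε_i ± ε_j` of the orthogonal factor have even coordinate sum. This invariant separates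
the two half-spin weights, which differ only in the sign of the last coordinate. -/
theorem even_torusEntry_sub {a b : Fin (2 * n + 4)} (hab : block n a = block n b) :
    Even (torusEntry n (fun i => if 2 ≤ i then 1 else 0) a -
      torusEntry n (fun i => if 2 ≤ i then 1 else 0) b) := by
  have := a.2
  have := b.2
  rw [Int.even_iff]
  simp only [torusEntry]
  unfold block at hab
  split_ifs at * <;> omega

set_option maxHeartbeats 1000000 in
-- The weight `μ` is dominant for the Levi factor and differs from `χ` by a sum of negative Levi
-- roots. Below a minuscule weight this leaves only `χ` itself. Finite-dimensionality of `K` enters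
-- through dominance.
theorem IsMinuscule.weight_eq (hn : 2 ≤ n) (hχ : IsMinuscule n χ) (hu : IsSingular n χ ρ u)
    {K : Submodule ℂ M} [FiniteDimensional ℂ K] (hKs : ∀ X, ∀ x ∈ K, ρ X x ∈ K)
    {x : M} (hxK : x ∈ K) (hx : x ∈ cyclicSpan ρ u) (hx0 : x ≠ 0) {μ : Fin (n + 2) → ℂ}
    (hμ : ∀ X : parabolic n, IsCartan n X.1 → ρ X x = evalWeight n μ X.1 • x)
    (hpos : ∀ a b : Fin (2 * n + 4), ∀ h : block n a ≤ block n b, a < b →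
      ρ (parVec a b h) x = 0) : μ = χ := by
  have dom : ∀ i j : Fin (n + 2), i < j →
      block n (Fin.castLE (by omega) i) = block n (Fin.castLE (by omega) j) →
      ∃ k : ℕ, μ i - μ j = k := by
    intro i j hij hb
    have hij' : (i : ℕ) < j := hij
    obtain ⟨k, hk, -⟩ := exists_nat_of_parVec hKs hxK hx0 hμ
      (a := Fin.castLE (by omega) i) (b := Fin.castLE (by omega) j)
      (fun h => hij.ne (Fin.castLE_injective _ h))
      (fun h => by
        have := congrArg Fin.val h
        rw [Fin.val_rev, Fin.val_castLE, Fin.val_castLE] at this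
        omega) hb (hpos _ _ _ hij)
    refine ⟨k, ?_⟩
    rw [← hk, evalWeight_sub, evalWeight_rootVec_self, evalWeight_rootVec_self]
  have sum0 : ∀ χ : Fin (n + 2) → ℂ,
      ∑ i : Fin (n + 2), χ i * ((if (i : ℕ) = 0 then 1 else 0 : ℤ) : ℂ) = χ 0 := by
    intro χ
    rw [Finset.sum_eq_single 0]
    · simp
    · intro i _ hi
      rw [if_neg (fun h : (i : ℕ) = 0 => hi (Fin.ext h))]
      simp
    · simp
  have sum2 : ∀ χ : Fin (n + 2) → ℂ,
      ∑ i : Fin (n + 2), χ i * ((if (i : ℕ) = 2 then 1 else 0 : ℤ) : ℂ) = χ ⟨2, by omega⟩ := by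
    intro χ
    rw [Finset.sum_eq_single ⟨2, by omega⟩]
    · simp
    · intro i _ hi
      rw [if_neg (fun h => hi (Fin.ext h))]
      simp
    · simp
  -- On `gl(2)` the sum of the coordinates is preserved and the first one changes by `s ≤ 0`. With
  -- `l = χ 0 - χ 1 ≤ 1` the dominance condition reads `l + 2s = k ≥ 0`, which forces `s = 0`.
  have h0 : μ 0 = χ 0 ∧ μ 1 = χ 1 := by
    obtain ⟨s, hs, h1⟩ := hu.torus_eigenvalue hx hx0 hμ (fun i => if i = 0 then 1 else 0)
      {s | s ≤ 0} (le_refl (0 : ℤ)) fun a b hab hba s (hs : s ≤ 0) =>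
        show s + _ ≤ 0 by linarith [torusEntry_zero_le hab hba]
    obtain ⟨t, ht, h2⟩ := hu.torus_eigenvalue hx hx0 hμ (fun i => if i ≤ 1 then 1 else 0)
      {s | s = 0} rfl fun a b hab hba s (hs : s = 0) =>
        show s + _ = 0 by rw [hs, torusEntry_gl hab, sub_self, add_zero]
    have sum1 : ∀ χ : Fin (n + 2) → ℂ,
        ∑ i : Fin (n + 2), χ i * ((if (i : ℕ) ≤ 1 then 1 else 0 : ℤ) : ℂ) = χ 0 + χ 1 := by
      intro χ
      rw [Fin.sum_univ_succ, Fin.sum_univ_succ, Finset.sum_eq_zero]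
      · simp
      · intro i _
        rw [if_neg (by simp only [Fin.val_succ]; omega)]
        simp
    have ht : t = 0 := ht
    have hs : s ≤ 0 := hs
    rw [sum1, sum1, ht, Int.cast_zero, add_zero] at h2
    rw [sum0, sum0] at h1
    obtain ⟨k, hk⟩ := dom 0 1 (by simp) (by
      unfold block; simp)
    obtain ⟨l, hl1, hl⟩ := hχ.gl
    have h3 : ((l : ℤ) + 2 * s : ℂ) = (k : ℤ) := by
      push_cast
      linear_combination (-1) * hl + hk - 2 * h1 + h2
    have h3 : (l : ℤ) + 2 * s = k := by exact_mod_cast h3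
    have hs0 : s = 0 := by omega
    rw [hs0, Int.cast_zero, add_zero] at h1
    exact ⟨h1, by linear_combination h2 - h1⟩
  -- From coordinate 2 on the weight starts at most at `1/2` and does not increase, so the defect
  -- `p` at position `j` bounds all earlier defects `q`.
  have hmid : ∀ j : ℕ, ∀ hj : j < n + 2, 2 ≤ j → ∃ p : ℕ, μ ⟨j, hj⟩ = 1 / 2 - p ∧
      ∀ i : ℕ, ∀ hi : i ≤ j, 2 ≤ i → ∃ q : ℕ, q ≤ p ∧ μ ⟨i, by omega⟩ = 1 / 2 - q := by
    intro j hj hj2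
    induction j, hj2 using Nat.le_induction with
    | base =>
      obtain ⟨s, hs, h1⟩ := hu.torus_eigenvalue hx hx0 hμ (fun i => if i = 2 then 1 else 0)
        {s | s ≤ 0} (le_refl (0 : ℤ)) fun a b hab hba s (hs : s ≤ 0) =>
          show s + _ ≤ 0 by linarith [torusEntry_two_le hab hba]
      have hs : s ≤ 0 := hs
      rw [sum2, sum2, hχ.half _ le_rfl hn] at h1
      have h2 : μ ⟨2, hj⟩ = 1 / 2 - (s.natAbs : ℕ) := by
        rw [h1, sub_eq_add_neg]
        congr 1
        have : -(s.natAbs : ℤ) = s := by omega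
        exact_mod_cast this.symm
      refine ⟨s.natAbs, h2, fun i hi hi2 => ⟨s.natAbs, le_rfl, ?_⟩⟩
      obtain rfl : i = 2 := by omega
      exact h2
    | succ j hj2 ih =>
      obtain ⟨p, hp, hq⟩ := ih (by omega)
      obtain ⟨k, hk⟩ := dom ⟨j, by omega⟩ ⟨j + 1, hj⟩ (by simp [Fin.lt_def]) (by
        unfold block
        simp only [Fin.val_castLE]
        split_ifs <;> omega)
      have h2 : μ ⟨j + 1, hj⟩ = 1 / 2 - ((p + k : ℕ) : ℂ) := by
        push_cast
        linear_combination hp - hk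
      refine ⟨p + k, h2, fun i hi hi2 => ?_⟩
      rcases Nat.lt_or_ge j i with h | h
      · obtain rfl : i = j + 1 := by omega
        exact ⟨p + k, le_rfl, h2⟩
      · obtain ⟨q, hqp, hq⟩ := hq i h hi2
        exact ⟨q, by omega, hq⟩
  obtain ⟨p, hp, hq⟩ := hmid n (by omega) hn
  obtain ⟨k, hk⟩ := dom ⟨n, by omega⟩ (Fin.last (n + 1)) (by simp [Fin.lt_def]) (by
    unfold block
    simp only [Fin.val_castLE, Fin.val_last]
    split_ifs <;> omega)
  -- Index `n + 2` is the mirror of `n + 1`, so the root vector at `(n, n + 2)` belongs to the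
  -- simple root `ε_n + ε_{n+1}`.
  have hlast : (rootVec ⟨n + 2, by omega⟩ ⟨n + 2, by omega⟩ : so n) =
      -rootVec (Fin.castLE (by omega) (Fin.last (n + 1)))
        (Fin.castLE (by omega) (Fin.last (n + 1))) := by
    rw [← rootVec_rev]
    congr 1 <;>
    · apply Fin.ext
      simp only [Fin.val_rev, Fin.val_castLE, Fin.val_last]
      omega
  obtain ⟨l, hl, -⟩ := exists_nat_of_parVec hKs hxK hx0 hμ
    (a := ⟨n, by omega⟩) (b := ⟨n + 2, by omega⟩) (by simp [Fin.ext_iff])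
    (by simp only [ne_eq, Fin.ext_iff, Fin.val_rev]; omega)
    (by unfold block; simp only; split_ifs <;> omega) (hpos _ _ _ (by simp [Fin.lt_def]))
  rw [evalWeight_sub, hlast, evalWeight_neg, evalWeight_rootVec_self,
    evalWeight_rootVec_of_lt _ _ (by simp)] at hl
  -- Dominance for `ε_n - ε_{n+1}` and `ε_n + ε_{n+1}` gives `2 μ_n = k + l`; since `μ_n = 1/2 - p`,
  -- this is `2p + k + l = 1`.
  have hp0 : p = 0 := by
    have : ((2 * p + k + l : ℕ) : ℂ) = (1 : ℕ) := by
      push_cast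
      linear_combination 2 * hp - hk - hl
    have : 2 * p + k + l = 1 := by exact_mod_cast this
    omega
  have hhalf : ∀ i : Fin (n + 2), 2 ≤ (i : ℕ) → (i : ℕ) ≤ n → μ i = χ i := by
    intro i h2 hi
    obtain ⟨q, hq0, hq⟩ := hq i hi h2
    obtain rfl : q = 0 := by omega
    rw [hχ.half i h2 hi]
    simpa using hq
  obtain ⟨s, ⟨t, hst⟩, h1⟩ := hu.torus_eigenvalue hx hx0 hμ (fun i => if 2 ≤ i then 1 else 0)
    {s | Even s} (by simp) fun a b hab _ s (hs : Even s) =>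
      show Even (s + _) from hs.add (even_torusEntry_sub hab)
  have h2 : μ (Fin.last (n + 1)) - χ (Fin.last (n + 1)) = s := by
    have : ∑ i : Fin (n + 2), (μ i - χ i) * ((if 2 ≤ (i : ℕ) then 1 else 0 : ℤ) : ℂ) = s := by
      simp only [sub_mul, Finset.sum_sub_distrib]
      rw [h1]
      ring
    rw [Finset.sum_eq_single (Fin.last (n + 1))] at this
    · rw [if_pos (by simp; omega)] at this
      simpa using this
    · intro i _ hi
      have hi' : (i : ℕ) < n + 1 := Fin.val_lt_last hi
      split_ifs with h2
      · rw [hhalf i h2 (by omega), sub_self, zero_mul]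
      · simp
    · simp
  -- Now `k + l = 1`, so the last coordinate is `±1/2`; evenness of `s` excludes the sign opposite
  -- to that of `χ`.
  have h3 : μ (Fin.last (n + 1)) = χ (Fin.last (n + 1)) := by
    have hkl : μ ⟨n, by omega⟩ = 1 / 2 := by rw [hp, hp0]; simp
    have h4 : ((k + l : ℕ) : ℂ) = (1 : ℕ) := by
      push_cast
      linear_combination 2 * hkl - hk - hl
    have h4 : k + l = 1 := by exact_mod_cast h4
    have h5 : (s : ℂ) = (1 / 2 - χ (Fin.last (n + 1))) - k := by
      linear_combination -h2 - hk + hkl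
    have h6 : s = 0 := by
      rcases hχ.last with h | h
      · rw [h] at h5
        have : (s : ℂ) = ((-k : ℤ) : ℂ) := by rw [h5]; push_cast; ring
        have : s = -k := by exact_mod_cast this
        omega
      · rw [h] at h5
        have : (s : ℂ) = ((1 - k : ℤ) : ℂ) := by rw [h5]; push_cast; ring
        have : s = 1 - k := by exact_mod_cast this
        omega
    rw [h6, Int.cast_zero] at h2
    exact sub_eq_zero.1 h2
  ext i
  rcases Nat.lt_or_ge i 2 with h | h
  · rcases (by omega : (i : ℕ) = 0 ∨ (i : ℕ) = 1) with h | h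
    · rw [show i = 0 from Fin.ext h]; exact h0.1
    · rw [show i = 1 from Fin.ext (by rw [h]; simp)]; exact h0.2
  · rcases Nat.lt_or_ge n i with h' | h'
    · rw [show i = Fin.last (n + 1) from Fin.ext (by simp; omega)]; exact h3
    · exact hhalf i h h'

end

end HighestWeight

/-! ### Irreducible highest weight modules -/

section Irreducible

variable {n : ℕ} {χ : Fin (n + 2) → ℂ} {V : Type*} [AddCommGroup V] [Module ℂ V]
  [LieRingModule (parabolic n) V] [LieModule ℂ (parabolic n) V] {v : V}

theorem IsHighestWeightModule.isSingular (hv : IsHighestWeightModule n χ v) :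
    IsSingular n χ (LieModule.toEnd ℂ (parabolic n) V) v :=
  ⟨hv.weight, hv.positive⟩

theorem IsHighestWeightModule.eq_top (hv : IsHighestWeightModule n χ v) {P : Submodule ℂ V}
    (hP : ∀ X : parabolic n, ∀ x ∈ P, ⁅X, x⁆ ∈ P) {x : V} (hx : x ∈ P) (hx0 : x ≠ 0) : P = ⊤ := by
  have := hv.irreducible
  let N : LieSubmodule ℂ (parabolic n) V := { P with lie_mem := fun {X x} hx => hP X x hx }
  rcases eq_bot_or_eq_top N with h | h
  · exact absurd ((LieSubmodule.mem_bot x).1 (h ▸ (show x ∈ N from hx))) hx0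
  · ext y
    exact ⟨fun _ => trivial, fun _ => (h.symm ▸ LieSubmodule.mem_top y : y ∈ N)⟩

theorem IsHighestWeightModule.cyclicSpan_eq_top (hv : IsHighestWeightModule n χ v)
    {μ : Fin (n + 2) → ℂ} {x : V} (hx0 : x ≠ 0)
    (hx : IsSingular n μ (LieModule.toEnd ℂ (parabolic n) V) x) :
    cyclicSpan (LieModule.toEnd ℂ (parabolic n) V) x = ⊤ :=
  hv.eq_top (fun X _ hy => hx.apply_mem_cyclicSpan X hy) self_mem_cyclicSpan hx0

/-- A singular vector of an irreducible highest weight module is a multiple of the highest weight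
vector. -/
theorem IsHighestWeightModule.mem_span_of_isSingular (hv : IsHighestWeightModule n χ v)
    {μ : Fin (n + 2) → ℂ} {x : V}
    (hx : IsSingular n μ (LieModule.toEnd ℂ (parabolic n) V) x) :
    x ∈ Submodule.span ℂ {v} := by
  by_cases hx0 : x = 0
  · rw [hx0]; exact zero_mem _
  have h1 : v ∈ cyclicSpan (LieModule.toEnd ℂ (parabolic n) V) x := by
    -- Each of `v` and `x` lies in the module generated by the other, so neither height exceeds the
    -- other.
    rw [hv.cyclicSpan_eq_top hx0 hx]; trivial
  have h2 : x ∈ cyclicSpan (LieModule.toEnd ℂ (parabolic n) V) v := by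
    rw [hv.cyclicSpan_eq_top hv.ne_zero hv.isSingular]; trivial
  have h3 := hx.weight (heightEl n) isCartan_heightEl
  have h4 := hv.isSingular.weight (heightEl n) isCartan_heightEl
  obtain ⟨k, hk⟩ := hx.height_eigenvalue h1 hv.ne_zero h4
  obtain ⟨l, hl⟩ := hv.isSingular.height_eigenvalue h2 hx0 h3
  have hkl : ((k + l : ℕ) : ℂ) = (0 : ℕ) := by
    push_cast
    linear_combination hk + hl
  have hkl : k + l = 0 := by exact_mod_cast hkl
  have hl0 : l = 0 := by omega
  refine hv.isSingular.mem_span_of_height h2 ?_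
  rw [h3, hl, hl0, Nat.cast_zero, sub_zero]

/-- The nilradical of `𝔭` acts by zero on an irreducible module. -/
theorem IsHighestWeightModule.lie_eq_zero (hv : IsHighestWeightModule n χ v) {X : parabolic n}
    (hX : ∀ a b, block n a = block n b → X.1.1 a b = 0) (x : V) : ⁅X, x⁆ = 0 := by
  -- The vectors killed by the nilradical form a submodule because the nilradical is an ideal of
  -- `𝔭`, and `v` is one of them.
  let P : Submodule ℂ V :=
    { carrier := {x | ∀ X : parabolic n, (∀ a b, block n a = block n b → X.1.1 a b = 0) →
        ⁅X, x⁆ = 0}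
      zero_mem' := fun X _ => lie_zero X
      add_mem' := fun ha hb X hX => by rw [lie_add, ha X hX, hb X hX, add_zero]
      smul_mem' := fun c a ha X hX => by rw [lie_smul, ha X hX, smul_zero] }
  have hP : P = ⊤ := by
    refine hv.eq_top (P := P) (fun Y y hy X hX => ?_) (x := v) (fun X hX => ?_) hv.ne_zero
    · rw [leibniz_lie, hy X hX, lie_zero, add_zero]
      refine hy _ fun a b hab => ?_
      refine (lie_apply X.1 Y.1 a b).trans ?_
      rw [Finset.sum_eq_zero, Finset.sum_eq_zero, sub_zero]
      · intro c _
        rcases lt_trichotomy (block n c) (block n a) with h | h | h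
        · rw [Y.2 a c h, zero_mul]
        · rw [hX c b (h.trans hab), mul_zero]
        · rw [X.2 c b (hab ▸ h), mul_zero]
      · intro c _
        rcases lt_trichotomy (block n c) (block n a) with h | h | h
        · rw [X.2 a c h, zero_mul]
        · rw [hX a c h.symm, zero_mul]
        · rw [Y.2 c b (hab ▸ h), mul_zero]
    · refine hv.positive X fun a b hba => ?_
      rcases (block_mono hba).lt_or_eq with h | h
      · exact X.2 a b h
      · exact hX a b h.symm
  have : x ∈ P := hP ▸ Submodule.mem_top
  exact this X hX

/-- An irreducible `𝔭`-module with minuscule highest weight `χ` maps to every finite-dimensional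
`𝔭`-module with a singular vector of weight `χ`. -/
theorem IsHighestWeightModule.exists_hom (hn : 2 ≤ n) (hv : IsHighestWeightModule n χ v)
    (hχ : IsMinuscule n χ) {E : Type*} [AddCommGroup E] [Module ℂ E] [FiniteDimensional ℂ E]
    (ρ : parabolic n →ₗ⁅ℂ⁆ Module.End ℂ E) {u : E} (hu : IsSingular n χ ρ u) :
    ∃ ψ : V →ₗ[ℂ] E, (∀ X x, ψ ⁅X, x⁆ = ρ X (ψ x)) ∧ ψ v = u := by
  have := hv.finiteDimensional
  let σ := prodRep (LieModule.toEnd ℂ (parabolic n) V) ρ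
  have hvu : IsSingular n χ σ (v, u) :=
    ⟨fun X hX => Prod.ext (hv.weight X hX) (hu.weight X hX),
      fun X hX => Prod.ext (hv.positive X hX) (hu.positive X hX)⟩
  -- Goursat's argument: `Q` will be the graph of the map sought, and `K` is the obstruction, the
  -- part of `Q` lying over `0`.
  let Q := cyclicSpan σ (v, u)
  have hQ : ∀ X, ∀ x ∈ Q, σ X x ∈ Q := fun X x hx => hvu.apply_mem_cyclicSpan X hx
  let K : Submodule ℂ (V × E) := Q ⊓ LinearMap.ker (LinearMap.fst ℂ V E)
  have hKs : ∀ X, ∀ x ∈ K, σ X x ∈ K := by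
    rintro X x ⟨hxQ, hx⟩
    refine ⟨hQ X x hxQ, ?_⟩
    have hx : x.1 = 0 := hx
    change ⁅X, x.1⁆ = 0
    rw [hx, lie_zero]
  -- A singular vector in `K` would have weight `χ`, hence be a multiple of the generator `(v, u)`;
  -- but the first component of a nonzero multiple does not vanish.
  have hK : K = ⊥ := by
    by_contra hK
    obtain ⟨x, hx, hx0, μ, hμ, hpos⟩ := hvu.exists_isSingular hK inf_le_left hKs
    have hμχ := hχ.weight_eq hn hvu hKs hx hx.1 hx0 hμ hpos
    have hh := hμ _ isCartan_heightEl
    rw [hμχ] at hh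
    obtain ⟨c, rfl⟩ := Submodule.mem_span_singleton.1 (hvu.mem_span_of_height hx.1 hh)
    have h1 : c • v = 0 := hx.2
    rw [(smul_eq_zero.1 h1).resolve_right hv.ne_zero, zero_smul] at hx0
    exact hx0 rfl
  let p : Q →ₗ[ℂ] V := LinearMap.fst ℂ V E ∘ₗ Q.subtype
  have hp : Function.Bijective p := by
    constructor
    · refine (injective_iff_map_eq_zero p).2 fun x hx => ?_
      have : x.1 ∈ K := ⟨x.2, hx⟩
      rw [hK] at this
      exact Subtype.ext ((Submodule.mem_bot ℂ).1 this)
    · refine LinearMap.range_eq_top.1 (hv.eq_top ?_ (x := v) ?_ hv.ne_zero)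
      · rintro X _ ⟨x, rfl⟩
        exact ⟨⟨σ X x.1, hQ X x.1 x.2⟩, rfl⟩
      · exact ⟨⟨(v, u), self_mem_cyclicSpan⟩, rfl⟩
  let e : Q ≃ₗ[ℂ] V := LinearEquiv.ofBijective p hp
  have he : ∀ x : Q, e x = x.1.1 := fun _ => rfl
  refine ⟨LinearMap.snd ℂ V E ∘ₗ Q.subtype ∘ₗ e.symm.toLinearMap, fun X x => ?_, ?_⟩
  · obtain ⟨y, rfl⟩ := e.surjective x
    have : ⁅X, e y⁆ = e ⟨σ X y.1, hQ X y.1 y.2⟩ := rfl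
    simp only [LinearMap.comp_apply, LinearEquiv.coe_coe]
    rw [this, e.symm_apply_apply, e.symm_apply_apply]
    rfl
  · have : v = e ⟨(v, u), self_mem_cyclicSpan⟩ := rfl
    simp only [LinearMap.comp_apply, LinearEquiv.coe_coe]
    rw [this, e.symm_apply_apply]
    rfl

/-! ### The weights `ν` and `ξ` are minuscule on the Levi factor -/

theorem nu_isMinuscule (hn : 2 ≤ n) : IsMinuscule n (nu n) where
  gl := ⟨1, le_rfl, by
    simp [nu, delta]
    ring⟩
  half := fun i h2 hi => by
    simp only [nu, delta]
    rw [if_neg (by omega), if_neg (by omega), if_neg (by omega)]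
    ring
  last := Or.inr (by
    simp only [nu, delta, Fin.val_last]
    rw [if_neg (by omega), if_neg (by omega), if_pos trivial]
    push_cast
    ring)

theorem xi_isMinuscule (hn : 2 ≤ n) : IsMinuscule n (xi n) where
  gl := ⟨0, zero_le_one, by
    simp [xi, delta]
    ring⟩
  half := fun i h2 hi => by
    simp only [xi, delta]
    rw [if_neg (by omega), if_neg (by omega)]
    ring
  last := Or.inl (by
    simp only [xi, delta, Fin.val_last]
    rw [if_neg (by omega), if_neg (by omega)]
    push_cast
    ring)

end Irreducible

/-! ### The spin representation -/

section Clifford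

variable (n : ℕ)

/-- The quadratic form `x ↦ ½ β(x, x)`. -/
noncomputable def cliffordForm : QuadraticForm ℂ (Fin (2 * n + 4) → ℂ) :=
  LinearMap.BilinMap.toQuadraticMap ((1 / 2 : ℂ) • Matrix.toBilin' (antidiag n))

/-- The Clifford algebra of `cliffordForm`. -/
abbrev Cliff : Type := CliffordAlgebra (cliffordForm n)

variable {n}

/-- The standard generators of the Clifford algebra. -/
noncomputable def cliff (a : Fin (2 * n + 4)) : Cliff n :=
  CliffordAlgebra.ι (cliffordForm n) (Pi.single a 1)

theorem cliff_anticomm (a b : Fin (2 * n + 4)) :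
    cliff a * cliff b + cliff b * cliff a = algebraMap ℂ (Cliff n) (if b = a.rev then 1 else 0) := by
  rw [cliff, cliff, CliffordAlgebra.ι_mul_ι_add_swap]
  congr 1
  refine (LinearMap.BilinMap.polar_toQuadraticMap _ _).trans ?_
  have : (a = b.rev) ↔ (b = a.rev) := by rw [← Fin.rev_eq_iff, eq_comm]
  simp only [LinearMap.smul_apply, Matrix.toBilin'_single, antidiag, Matrix.of_apply, this]
  split_ifs <;> norm_num

theorem cliff_mul_cliff (a b : Fin (2 * n + 4)) :
    cliff a * cliff b = (if b = a.rev then (1 : ℂ) else 0) • (1 : Cliff n) - cliff b * cliff a := by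
  rw [← Algebra.algebraMap_eq_smul_one, ← cliff_anticomm, add_sub_cancel_right]

theorem cliff_mul_self (a : Fin (2 * n + 4)) : cliff a * cliff a = 0 := by
  have h := cliff_anticomm a a
  rw [if_neg (rev_ne_self a).symm, map_zero, ← two_smul ℂ] at h
  exact (smul_eq_zero.1 h).resolve_left two_ne_zero

/-- `F l` is spanned by the ordered products of generators from `l`. Moving `cliff a` to its place
by the anticommutation relations shows that `F l` is stable under left multiplication by the
generators in `l`; for the full list it is everything. -/
instance : FiniteDimensional ℂ (Cliff n) := by
  let F : List (Fin (2 * n + 4)) → Submodule ℂ (Cliff n) := fun l =>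
    (l.map fun a => Submodule.span ℂ {1, cliff a}).prod
  have hFG : ∀ l, (F l).FG := by
    intro l
    induction l with
    | nil => 
      have : F [] = Submodule.span ℂ {1} := Submodule.one_eq_span
      rw [this]
      exact Submodule.fg_span_singleton 1
    | cons a l ih =>
      have : F (a :: l) = Submodule.span ℂ {1, cliff a} * F l := by simp [F]
      rw [this]
      exact (Submodule.fg_span (by simp)).mul ih
  have hcons : ∀ a l, F (a :: l) = Submodule.span ℂ {1, cliff a} * F l := fun a l => by simp [F]
  have hone : ∀ l x b, x ∈ F l → x ∈ F (b :: l) := by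
    intro l x b hx
    rw [hcons, ← one_mul x]
    exact Submodule.mul_mem_mul (Submodule.subset_span (by simp)) hx
  have hself : ∀ l x b, x ∈ F l → cliff b * x ∈ F (b :: l) := by
    intro l x b hx
    rw [hcons]
    exact Submodule.mul_mem_mul (Submodule.subset_span (by simp)) hx
  have hmul : ∀ l, ∀ a ∈ l, ∀ x ∈ F l, cliff a * x ∈ F l := by
    intro l
    induction l with
    | nil => simp
    | cons b l ih =>
      intro a ha x hx
      rw [hcons] at hx
      refine Submodule.mul_induction_on hx ?_ fun x y hx hy => ?_
      · intro m hm y hy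
        obtain ⟨r, s, rfl⟩ := Submodule.mem_span_pair.1 hm
        rw [add_mul, smul_mul_assoc, smul_mul_assoc, one_mul, mul_add, mul_smul_comm,
          mul_smul_comm, ← mul_assoc]
        by_cases hab : a = b
        · subst hab
          rw [cliff_mul_self, zero_mul, smul_zero, add_zero]
          exact Submodule.smul_mem _ _ (hself l y a hy)
        · have ha : a ∈ l := (List.mem_cons.1 ha).resolve_left hab
          refine add_mem (Submodule.smul_mem _ _ (hone _ _ _ (ih a ha y hy)))
            (Submodule.smul_mem _ _ ?_)
          rw [cliff_mul_cliff, sub_mul, smul_mul_assoc, one_mul, mul_assoc]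
          exact sub_mem (Submodule.smul_mem _ _ (hone _ _ _ hy)) (hself _ _ _ (ih a ha y hy))
      · rw [mul_add]; exact add_mem hx hy
  have hl1 : ∀ l, (1 : Cliff n) ∈ F l := by
    intro l
    induction l with
    | nil => exact Submodule.one_le.1 le_rfl
    | cons b l ih => exact hone _ _ _ ih
  let l := List.finRange (2 * n + 4)
  have htop : F l = ⊤ := by
    refine Submodule.eq_top_iff'.2 fun x => ?_
    induction x using CliffordAlgebra.left_induction with
    | algebraMap r =>
      rw [Algebra.algebraMap_eq_smul_one]
      exact Submodule.smul_mem _ _ (hl1 l)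
    | add x y hx hy => exact add_mem hx hy
    | ι_mul x m hx =>
      rw [pi_eq_sum_univ' m, map_sum, Finset.sum_mul]
      refine sum_mem fun a _ => ?_
      rw [map_smul, smul_mul_assoc]
      exact Submodule.smul_mem _ _ (hmul l a (List.mem_finRange a) x hx)
  exact ⟨htop ▸ hFG l⟩

/-- The element `½ ∑ X_{a,b} c_a c_{b'}` of the Clifford algebra. -/
noncomputable def spinEl (X : so n) : Cliff n :=
  (1 / 2 : ℂ) • ∑ a, ∑ b, X.1 a b • (cliff a * cliff b.rev)

theorem spinEl_add (X Y : so n) : spinEl (X + Y) = spinEl X + spinEl Y := by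
  have : ∀ a b, (X + Y).1 a b = X.1 a b + Y.1 a b := fun _ _ => rfl
  simp only [spinEl, this, add_smul, Finset.sum_add_distrib, smul_add]

theorem spinEl_smul (c : ℂ) (X : so n) : spinEl (c • X) = c • spinEl X := by
  have : ∀ a b, (c • X).1 a b = c * X.1 a b := fun _ _ => rfl
  simp only [spinEl, this, mul_smul, ← Finset.smul_sum]
  rw [smul_comm]

/-- Bracketing with `spinEl X` acts on generators as the matrix `X`. The two factors of `c_a c_{b'}`
contribute equally by skewness, which absorbs the `1/2`. -/
theorem spinEl_comm_cliff (X : so n) (d : Fin (2 * n + 4)) :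
    spinEl X * cliff d - cliff d * spinEl X = ∑ a, X.1 a d • cliff a := by
  have key : ∀ a b : Fin (2 * n + 4), cliff a * cliff b.rev * cliff d -
      cliff d * (cliff a * cliff b.rev) =
      (if b = d then (1 : ℂ) else 0) • cliff a - (if a = d.rev then (1 : ℂ) else 0) • cliff b.rev := by
    intro a b
    rw [mul_assoc, cliff_mul_cliff b.rev d, ← mul_assoc (cliff d), cliff_mul_cliff d a, Fin.rev_rev,
      mul_sub, mul_smul_comm, mul_one, sub_mul, smul_mul_assoc, one_mul, ← mul_assoc]
    simp only [eq_comm (a := d) (b := b)]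
    abel
  rw [spinEl, smul_mul_assoc, mul_smul_comm, ← smul_sub, Finset.sum_mul, Finset.mul_sum,
    ← Finset.sum_sub_distrib]
  have h1 : ∀ a : Fin (2 * n + 4), ((∑ b, X.1 a b • (cliff a * cliff b.rev)) * cliff d -
      cliff d * ∑ b, X.1 a b • (cliff a * cliff b.rev) : Cliff n) =
      ∑ b, (X.1 a b • ((if b = d then (1 : ℂ) else 0) • cliff a) -
        X.1 a b • ((if a = d.rev then (1 : ℂ) else 0) • cliff b.rev)) := by
    intro a
    rw [Finset.sum_mul, Finset.mul_sum, ← Finset.sum_sub_distrib]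
    refine Finset.sum_congr rfl fun b _ => ?_
    rw [smul_mul_assoc, mul_smul_comm, ← smul_sub, key, smul_sub]
  simp only [h1, Finset.sum_sub_distrib]
  have h2 : ∀ a : Fin (2 * n + 4), (∑ b, X.1 a b • ((if b = d then (1 : ℂ) else 0) • cliff a) :
      Cliff n) = X.1 a d • cliff a := by
    intro a
    rw [Finset.sum_eq_single d]
    · rw [if_pos rfl, one_smul]
    · intro b _ hb
      rw [if_neg hb, zero_smul, smul_zero]
    · simp
  have h3 : (∑ a, ∑ b, X.1 a b • ((if a = d.rev then (1 : ℂ) else 0) • cliff b.rev) : Cliff n) =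
      -∑ a, X.1 a d • cliff a := by
    rw [Finset.sum_eq_single d.rev]
    · rw [← Finset.sum_neg_distrib]
      refine Fintype.sum_equiv Fin.revPerm _ _ fun b => ?_
      have := so_skew X b.rev d
      rw [Fin.rev_rev] at this
      rw [if_pos rfl, one_smul, this, neg_smul, Fin.revPerm_apply]
    · intro a _ ha
      refine Finset.sum_eq_zero fun b _ => ?_
      rw [if_neg ha, zero_smul, smul_zero]
    · simp
  rw [h3]
  simp only [h2]
  rw [sub_neg_eq_add, ← two_smul ℂ, smul_smul]
  norm_num

/-- The bracket with `spinEl X` is a derivation, so it acts by `X` on both factors of each quadratic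
term of `spinEl Y`; the resulting coefficients are those of `XY - YX`. -/
theorem spinEl_lie (X Y : so n) : spinEl ⁅X, Y⁆ = spinEl X * spinEl Y - spinEl Y * spinEl X := by
  have key : ∀ a b : Fin (2 * n + 4), spinEl X * (cliff a * cliff b.rev) -
      cliff a * cliff b.rev * spinEl X =
      ∑ e, X.1 e a • (cliff e * cliff b.rev) - ∑ e, X.1 b e • (cliff a * cliff e.rev) := by
    intro a b
    have h1 : (∑ e, X.1 e b.rev • cliff e : Cliff n) = -∑ e, X.1 b e • cliff e.rev := by
      rw [← Finset.sum_neg_distrib]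
      refine Fintype.sum_equiv Fin.revPerm _ _ fun e => ?_
      have := so_skew X b e.rev
      rw [Fin.rev_rev] at this
      rw [this, Fin.revPerm_apply, Fin.rev_rev, neg_smul]
    have h2 : spinEl X * (cliff a * cliff b.rev) - cliff a * cliff b.rev * spinEl X =
        (spinEl X * cliff a - cliff a * spinEl X) * cliff b.rev +
        cliff a * (spinEl X * cliff b.rev - cliff b.rev * spinEl X) := by noncomm_ring
    rw [h2, spinEl_comm_cliff, spinEl_comm_cliff, h1, Finset.sum_mul, mul_neg, Finset.mul_sum,
      sub_eq_add_neg]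
    simp only [smul_mul_assoc, mul_smul_comm]
  have h3 : spinEl X * spinEl Y - spinEl Y * spinEl X = (1 / 2 : ℂ) • ∑ a, ∑ b, Y.1 a b •
      (∑ e, X.1 e a • (cliff e * cliff b.rev) - ∑ e, X.1 b e • (cliff a * cliff e.rev)) := by
    conv_lhs => rw [spinEl.eq_def Y]
    rw [smul_mul_assoc, mul_smul_comm, ← smul_sub, Finset.sum_mul, Finset.mul_sum,
      ← Finset.sum_sub_distrib]
    congr 1
    refine Finset.sum_congr rfl fun a _ => ?_
    rw [Finset.sum_mul, Finset.mul_sum, ← Finset.sum_sub_distrib]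
    refine Finset.sum_congr rfl fun b _ => ?_
    rw [smul_mul_assoc, mul_smul_comm, ← smul_sub, key]
  rw [h3, spinEl]
  congr 1
  simp only [lie_apply, sub_smul, smul_sub, Finset.sum_sub_distrib, Finset.sum_smul,
    Finset.smul_sum, smul_smul]
  congr 1
  · calc _ = ∑ a, ∑ r, ∑ b, (X.1 a r * Y.1 r b) • (cliff a * cliff b.rev) :=
          Finset.sum_congr rfl fun a _ => Finset.sum_comm
      _ = ∑ r, ∑ a, ∑ b, (X.1 a r * Y.1 r b) • (cliff a * cliff b.rev) := Finset.sum_comm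
      _ = ∑ r, ∑ b, ∑ a, (X.1 a r * Y.1 r b) • (cliff a * cliff b.rev) :=
          Finset.sum_congr rfl fun r _ => Finset.sum_comm
      _ = _ := by simp only [mul_comm]
  · exact Finset.sum_congr rfl fun a _ => Finset.sum_comm

/-- The action of `so(2n+4, ℂ)` on the Clifford algebra by left multiplication. -/
noncomputable def spinRep (n : ℕ) : so n →ₗ⁅ℂ⁆ Module.End ℂ (Cliff n) where
  toFun X := LinearMap.mulLeft ℂ (spinEl X)
  map_add' X Y := by ext; simp [spinEl_add, add_mul]
  map_smul' c X := by ext; simp [spinEl_smul]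
  map_lie' {X Y} := by ext; simp [spinEl_lie, Ring.lie_def, sub_mul, mul_assoc]

theorem spinRep_apply (X : so n) (s : Cliff n) : spinRep n X s = spinEl X * s := rfl

/-- The index set of a maximal isotropic subspace: all `a` in the upper half but the last one, and
the first `a` in the lower half. -/
def isoIndex (n : ℕ) (a : Fin (2 * n + 4)) : Prop := (a : ℕ) ≤ n ∨ (a : ℕ) = n + 2

theorem isoIndex_rev (a : Fin (2 * n + 4)) : isoIndex n a.rev ↔ ¬ isoIndex n a := by
  unfold isoIndex
  rw [Fin.val_rev]
  have := a.2
  omega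

/-- Starting from `1`, multiply by the isotropic generators one after another, skipping a factor
whenever the product would vanish. These generators anticommute, so relations already obtained
persist. -/
theorem exists_pure_spinor (n : ℕ) :
    ∃ s : Cliff n, s ≠ 0 ∧ ∀ a, isoIndex n a → cliff a * s = 0 := by
  classical
  suffices h : ∀ S : Finset (Fin (2 * n + 4)), (∀ a ∈ S, isoIndex n a) →
      ∃ s : Cliff n, s ≠ 0 ∧ ∀ a ∈ S, cliff a * s = 0 by
    obtain ⟨s, hs, h⟩ := h (Finset.univ.filter (isoIndex n)) (by simp)
    exact ⟨s, hs, fun a ha => h a (by simpa using ha)⟩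
  intro S
  induction S using Finset.induction_on with
  | empty =>
    intro _
    have : Invertible (2 : ℂ) := invertibleOfNonzero two_ne_zero
    exact ⟨1, one_ne_zero, by simp⟩
  | insert b S hb ih =>
    intro hS
    obtain ⟨s, hs, h⟩ := ih fun a ha => hS a (Finset.mem_insert_of_mem ha)
    by_cases hbs : cliff b * s = 0
    · refine ⟨s, hs, fun a ha => ?_⟩
      rcases Finset.mem_insert.1 ha with rfl | ha
      · exact hbs
      · exact h a ha
    · refine ⟨cliff b * s, hbs, fun a ha => ?_⟩
      rcases Finset.mem_insert.1 ha with rfl | ha'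
      · rw [← mul_assoc, cliff_mul_self, zero_mul]
      · have : b ≠ a.rev := by
          rintro rfl
          exact (isoIndex_rev a).1 (hS _ (Finset.mem_insert_self _ _)) (hS _ ha)
        rw [← mul_assoc, cliff_mul_cliff, if_neg this, zero_smul, zero_sub, neg_mul, mul_assoc,
          h a ha', mul_zero, neg_zero]

/-- The weight `[½, …, ½, -½]`. -/
noncomputable def spinWeight (n : ℕ) (i : Fin (n + 2)) : ℂ :=
  if (i : ℕ) = n + 1 then -1 / 2 else 1 / 2

/-- For diagonal `H` only the products `c_a c_{a'}` occur. They fix `s` when `a` is an isotropic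
index and kill it otherwise. -/
theorem spinEl_mul_of_isCartan {s : Cliff n} (hs : ∀ a, isoIndex n a → cliff a * s = 0) {H : so n}
    (hH : IsCartan n H) : spinEl H * s = evalWeight n (spinWeight n) H • s := by
  classical
  have h1 : spinEl H * s = ((1 / 2 : ℂ) * ∑ a, if isoIndex n a then H.1 a a else 0) • s := by
    rw [spinEl, smul_mul_assoc, mul_smul, Finset.sum_smul, Finset.sum_mul]
    congr 1
    refine Finset.sum_congr rfl fun a _ => ?_
    rw [Finset.sum_eq_single a]
    · split_ifs with ha
      · rw [smul_mul_assoc, cliff_mul_cliff, if_pos rfl, one_smul, sub_mul, one_mul, mul_assoc,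
          hs a ha, mul_zero, sub_zero]
      · rw [smul_mul_assoc, mul_assoc, hs _ ((isoIndex_rev a).2 ha), mul_zero, smul_zero, zero_smul]
    · intro b _ hb
      rw [hH a b hb.symm, zero_smul]
    · simp
  rw [h1]
  congr 1
  have h2 : ∑ a : Fin (2 * n + 4), (if isoIndex n a then H.1 a a else 0) =
      ∑ i : Fin (n + 2), (if (i : ℕ) = n + 1 then (-1 : ℂ) else 1) *
        H.1 (Fin.castLE (by omega) i) (Fin.castLE (by omega) i) := by
    have e : ∀ f : Fin (2 * n + 4) → ℂ, ∑ a, f a = ∑ i : Fin (n + 2),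
        (f (Fin.castLE (by omega) i) + f (Fin.castLE (by omega) i).rev) := by
      intro f
      rw [Finset.sum_add_distrib]
      have hN : 2 * n + 4 = (n + 2) + (n + 2) := by omega
      rw [← Fintype.sum_equiv (finCongr hN.symm) (fun i => f (Fin.cast hN.symm i)) f
        (fun _ => rfl), Fin.sum_univ_add]
      congr 1
      refine Fintype.sum_equiv Fin.revPerm _ _ fun i => ?_
      congr 1
      apply Fin.ext
      simp only [Fin.val_cast, Fin.val_natAdd, Fin.revPerm_apply, Fin.val_rev, Fin.val_castLE]
      omega
    rw [e]
    refine Finset.sum_congr rfl fun i _ => ?_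
    rw [so_skew]
    simp only [isoIndex_rev]
    by_cases hi : (i : ℕ) = n + 1
    · have h : ¬ isoIndex n (Fin.castLE (by omega) i) := by
        unfold isoIndex
        rw [Fin.val_castLE]
        omega
      rw [if_neg h, if_pos h, if_pos hi, zero_add, neg_one_mul]
    · have h : isoIndex n (Fin.castLE (by omega) i) := by
        unfold isoIndex
        have := i.2
        rw [Fin.val_castLE]
        omega
      rw [if_pos h, if_neg (not_not.2 h), if_neg hi, add_zero, one_mul]
  rw [h2, evalWeight, Finset.mul_sum]
  refine Finset.sum_congr rfl fun i _ => ?_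
  rw [spinWeight]
  split_ifs <;> ring

theorem spinEl_mul_of_isPositive {s : Cliff n} (hs : ∀ a, isoIndex n a → cliff a * s = 0)
    {X : so n} (hX : IsPositive n X) : spinEl X * s = 0 := by
  rw [spinEl, smul_mul_assoc, Finset.sum_mul, Finset.sum_eq_zero, smul_zero]
  intro a _
  rw [Finset.sum_mul]
  refine Finset.sum_eq_zero fun b _ => ?_
  rw [smul_mul_assoc]
  rcases le_or_gt b a with hba | hab
  · rw [hX a b hba, zero_smul]
  by_cases hb : isoIndex n b
  · by_cases ha : isoIndex n a
    · rw [cliff_mul_cliff, if_neg (fun h => hab.ne' (Fin.rev_inj.1 h)), zero_smul, zero_sub,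
        neg_mul, mul_assoc, hs a ha, mul_zero, neg_zero, smul_zero]
    -- The only pair `a < b` with `b` isotropic and `a` not is `(n + 1, n + 2)`. There `b = a'`, and
    -- the corresponding entry of a skew matrix is zero.
    · have hab : (a : ℕ) < b := hab
      have hbr : b.rev = a := by
        apply Fin.ext
        rw [Fin.val_rev]
        unfold isoIndex at ha hb
        omega
      have h1 := so_skew X a b
      rw [hbr, ← hbr, Fin.rev_rev] at h1
      have h2 : X.1 b.rev b = 0 := self_eq_neg.1 h1
      rw [← hbr, h2, zero_smul]
  · rw [mul_assoc, hs _ ((isoIndex_rev b).2 hb), mul_zero, smul_zero]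

end Clifford

/-! ### Functions on a chart of the Grassmannian of planes -/

section Chart

variable {n : ℕ}

/-- The inclusion of the first two indices. -/
def topIdx (n : ℕ) (i : Fin 2) : Fin (2 * n + 4) := Fin.castLE (by omega) i

/-- The polynomial functions on the space of matrices with `2n+4` rows and two columns. -/
abbrev ChartRing (n : ℕ) : Type := MvPolynomial (Fin (2 * n + 4) × Fin 2) ℂ

/-- The generic matrix whose upper two rows form the identity matrix. -/
noncomputable def chartMat (n : ℕ) : Matrix (Fin (2 * n + 4)) (Fin 2) (ChartRing n) :=
  Matrix.of fun a i => if (a : ℕ) < 2 then (if (a : ℕ) = i then 1 else 0) else MvPolynomial.X (a, i)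

/-- The transpose of `X`, as a matrix with polynomial entries. -/
noncomputable def constMat (X : so n) : Matrix (Fin (2 * n + 4)) (Fin (2 * n + 4)) (ChartRing n) :=
  X.1.transpose.map MvPolynomial.C

/-- The first two rows of the transpose of `X`. -/
noncomputable def constTop (X : so n) : Matrix (Fin 2) (Fin (2 * n + 4)) (ChartRing n) :=
  (constMat X).submatrix (topIdx n) id

/-- The values on the coordinates of the vector field induced by `X`. -/
noncomputable def chartField (X : so n) : Matrix (Fin (2 * n + 4)) (Fin 2) (ChartRing n) :=
  constMat X * chartMat n - chartMat n * (constTop X * chartMat n)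

/-- The vector field induced by `X`. -/
noncomputable def chartDer (X : so n) : Derivation ℂ (ChartRing n) (ChartRing n) :=
  MvPolynomial.mkDerivation ℂ fun p => chartField X p.1 p.2

/-- The logarithmic derivative of the determinant of the upper two rows. -/
noncomputable def chartTrace (X : so n) : ChartRing n := (constTop X * chartMat n).trace

theorem val_topIdx_lt (i : Fin 2) : (topIdx n i : ℕ) < 2 := i.2

theorem chartMat_topIdx (j i : Fin 2) : chartMat n (topIdx n j) i = if j = i then 1 else 0 := by
  simp only [chartMat, Matrix.of_apply, if_pos (val_topIdx_lt j), Fin.ext_iff]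
  rfl

theorem chartMat_of_not_lt {a : Fin (2 * n + 4)} (ha : ¬ (a : ℕ) < 2) (i : Fin 2) :
    chartMat n a i = MvPolynomial.X (a, i) := by
  simp only [chartMat, Matrix.of_apply, if_neg ha]

theorem chartMat_top (A : Matrix (Fin 2) (Fin 2) (ChartRing n)) (j i : Fin 2) :
    (chartMat n * A) (topIdx n j) i = A j i := by
  rw [Matrix.mul_apply, Finset.sum_eq_single j]
  · rw [chartMat_topIdx, if_pos rfl, one_mul]
  · intro k _ hk
    rw [chartMat_topIdx, if_neg hk.symm, zero_mul]
  · simp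

/-- For the upper two rows both sides vanish: the subtracted term of `chartField` is exactly what
keeps the upper block equal to the identity. -/
theorem chartDer_chartMat (X : so n) : (chartMat n).map (chartDer X) = chartField X := by
  ext1 a i
  rw [Matrix.map_apply]
  by_cases ha : (a : ℕ) < 2
  · have h1 : chartDer X (chartMat n a i) = 0 := by
      simp only [chartMat, Matrix.of_apply, if_pos ha]
      split_ifs
      · exact (chartDer X).map_one_eq_zero
      · exact map_zero _
    have h2 : a = topIdx n ⟨a, ha⟩ := rfl
    rw [h1, chartField, Matrix.sub_apply]
    conv_rhs => rw [h2]
    rw [chartMat_top]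
    exact (sub_self _).symm
  · simp only [chartMat, Matrix.of_apply, if_neg ha, chartDer, MvPolynomial.mkDerivation_X]

theorem map_der_mul {l m k : Type*} [Fintype m] (D : Derivation ℂ (ChartRing n) (ChartRing n))
    (A : Matrix l m (ChartRing n)) (B : Matrix m k (ChartRing n)) :
    (A * B).map D = A.map D * B + A * B.map D := by
  ext1 a b
  simp only [Matrix.map_apply, Matrix.add_apply, Matrix.mul_apply, map_sum, Derivation.leibniz,
    smul_eq_mul, ← Finset.sum_add_distrib]
  exact Finset.sum_congr rfl fun c _ => by ring

theorem map_der_constMat (D : Derivation ℂ (ChartRing n) (ChartRing n)) (X : so n) :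
    (constMat X).map D = 0 := by
  ext1 a b
  exact MvPolynomial.derivation_C D _

theorem map_der_constTop (D : Derivation ℂ (ChartRing n) (ChartRing n)) (X : so n) :
    (constTop X).map D = 0 := by
  ext1 a b
  exact MvPolynomial.derivation_C D _

theorem map_der_sub {l k : Type*} (D : Derivation ℂ (ChartRing n) (ChartRing n))
    (A B : Matrix l k (ChartRing n)) : (A - B).map D = A.map D - B.map D := by
  ext1 a b
  exact map_sub D _ _

/-- Transposition reverses products, and so does the passage from matrices to linear vector fields.
The two reversals cancel, which makes `chartDer` a homomorphism. -/
theorem constMat_lie (X Y : so n) :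
    constMat ⁅X, Y⁆ = constMat Y * constMat X - constMat X * constMat Y := by
  have h : (⁅X, Y⁆ : so n).1 = X.1 * Y.1 - Y.1 * X.1 := rfl
  rw [constMat, h, Matrix.transpose_sub, Matrix.transpose_mul, Matrix.transpose_mul,
    Matrix.map_sub _ (map_sub _), Matrix.map_mul, Matrix.map_mul]
  rfl

theorem constTop_lie (X Y : so n) :
    constTop ⁅X, Y⁆ = constTop Y * constMat X - constTop X * constMat Y := by
  rw [constTop, constMat_lie]
  rfl

theorem map_der_chartField (X Y : so n) : (chartField Y).map (chartDer X) =
    constMat Y * chartField X - chartField X * (constTop Y * chartMat n) -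
      chartMat n * (constTop Y * chartField X) := by
  rw [chartField, map_der_sub, map_der_mul, map_der_mul, map_der_mul, map_der_constMat,
    map_der_constTop, chartDer_chartMat, Matrix.zero_mul, Matrix.zero_mul, zero_add, zero_add]
  exact (sub_sub _ _ _).symm

theorem chartField_lie (X Y : so n) : chartField ⁅X, Y⁆ =
    (chartField Y).map (chartDer X) - (chartField X).map (chartDer Y) := by
  rw [map_der_chartField, map_der_chartField, chartField, constMat_lie, constTop_lie]
  simp only [chartField, Matrix.mul_sub, Matrix.sub_mul, Matrix.mul_assoc]
  abel

/-- The cocycle identity that permits the twist by a power of the determinant. The terms quadratic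
in the generic matrix cancel by cyclicity of the trace. -/
theorem chartTrace_lie (X Y : so n) : chartTrace ⁅X, Y⁆ =
    chartDer X (chartTrace Y) - chartDer Y (chartTrace X) := by
  have h : ∀ X Y : so n, chartDer X (chartTrace Y) = (constTop Y * chartField X).trace := by
    intro X Y
    have : chartDer X (chartTrace Y) = ((constTop Y * chartMat n).map (chartDer X)).trace :=
      map_sum (chartDer X) _ _
    rw [this, map_der_mul, map_der_constTop, Matrix.zero_mul, zero_add, chartDer_chartMat]
  rw [h, h, chartTrace, constTop_lie]
  simp only [chartField, Matrix.mul_sub, Matrix.sub_mul, Matrix.trace_sub]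
  have hc : (constTop Y * (chartMat n * (constTop X * chartMat n))).trace =
      (constTop X * (chartMat n * (constTop Y * chartMat n))).trace := by
    rw [← Matrix.mul_assoc, Matrix.trace_mul_comm, Matrix.mul_assoc]
  rw [hc, Matrix.mul_assoc, Matrix.mul_assoc]
  ring

theorem constMat_add (X Y : so n) : constMat (X + Y) = constMat X + constMat Y := by
  ext1 a b
  exact map_add MvPolynomial.C _ _

theorem constMat_smul (c : ℂ) (X : so n) : constMat (c • X) = c • constMat X := by
  ext1 a b
  exact (map_mul MvPolynomial.C c _).trans (MvPolynomial.smul_eq_C_mul _ c).symm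

theorem constTop_add (X Y : so n) : constTop (X + Y) = constTop X + constTop Y := by
  rw [constTop, constMat_add]; rfl

theorem constTop_smul (c : ℂ) (X : so n) : constTop (c • X) = c • constTop X := by
  rw [constTop, constMat_smul]; rfl

theorem chartField_add (X Y : so n) : chartField (X + Y) = chartField X + chartField Y := by
  simp only [chartField, constMat_add, constTop_add, Matrix.add_mul, Matrix.mul_add]
  abel

theorem chartField_smul (c : ℂ) (X : so n) : chartField (c • X) = c • chartField X := by
  simp only [chartField, constMat_smul, constTop_smul, Matrix.smul_mul, Matrix.mul_smul, smul_sub]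

theorem chartTrace_add (X Y : so n) : chartTrace (X + Y) = chartTrace X + chartTrace Y := by
  simp only [chartTrace, constTop_add, Matrix.add_mul, Matrix.trace_add]

theorem chartTrace_smul (c : ℂ) (X : so n) : chartTrace (c • X) = c • chartTrace X := by
  simp only [chartTrace, constTop_smul, Matrix.smul_mul, Matrix.trace_smul]

theorem chartDer_add (X Y : so n) : chartDer (X + Y) = chartDer X + chartDer Y := by
  refine MvPolynomial.derivation_ext fun p => ?_
  simp [chartDer, chartField_add]

theorem chartDer_smul (c : ℂ) (X : so n) : chartDer (c • X) = c • chartDer X := by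
  refine MvPolynomial.derivation_ext fun p => ?_
  simp [chartDer, chartField_smul]

theorem chartDer_lie (X Y : so n) : chartDer ⁅X, Y⁆ = ⁅chartDer X, chartDer Y⁆ := by
  refine MvPolynomial.derivation_ext fun p => ?_
  rw [Derivation.commutator_apply]
  have h : ∀ X : so n, chartDer X (MvPolynomial.X p) = chartField X p.1 p.2 := fun X =>
    MvPolynomial.mkDerivation_X _ _ _
  rw [h, h, h, chartField_lie]
  rfl

/-- The action of `so(2n+4, ℂ)` on the functions on the chart by vector fields, twisted by the
`l`-th power of the determinant. -/
noncomputable def chartRep (n : ℕ) (l : ℂ) : so n →ₗ⁅ℂ⁆ Module.End ℂ (ChartRing n) where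
  toFun X := (chartDer X).toLinearMap + l • LinearMap.mulLeft ℂ (chartTrace X)
  map_add' X Y := by
    refine LinearMap.ext fun f => ?_
    change chartDer (X + Y) f + l • (chartTrace (X + Y) * f) =
      chartDer X f + l • (chartTrace X * f) + (chartDer Y f + l • (chartTrace Y * f))
    rw [chartDer_add, chartTrace_add, Derivation.add_apply, add_mul, smul_add]
    abel
  map_smul' c X := by
    refine LinearMap.ext fun f => ?_
    change chartDer (c • X) f + l • (chartTrace (c • X) * f) =
      c • (chartDer X f + l • (chartTrace X * f))
    rw [chartDer_smul, chartTrace_smul, Derivation.smul_apply, smul_mul_assoc, smul_add, smul_comm]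
  map_lie' {X Y} := by
    refine LinearMap.ext fun f => ?_
    change chartDer ⁅X, Y⁆ f + l • (chartTrace ⁅X, Y⁆ * f) =
      chartDer X (chartDer Y f + l • (chartTrace Y * f)) +
          l • (chartTrace X * (chartDer Y f + l • (chartTrace Y * f))) -
        (chartDer Y (chartDer X f + l • (chartTrace X * f)) +
          l • (chartTrace Y * (chartDer X f + l • (chartTrace X * f))))
    rw [chartDer_lie, chartTrace_lie, Derivation.commutator_apply]
    simp only [map_add, Derivation.leibniz, smul_eq_mul, MvPolynomial.smul_eq_C_mul,
      MvPolynomial.derivation_C]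
    ring

theorem chartRep_one (l : ℂ) (X : so n) : chartRep n l X 1 = l • chartTrace X := by
  change chartDer X 1 + l • (chartTrace X * 1) = _
  rw [Derivation.map_one_eq_zero, zero_add, mul_one]

theorem chartTrace_eq (X : so n) : chartTrace X =
    ∑ i : Fin 2, ∑ b, MvPolynomial.C (X.1 b (topIdx n i)) * chartMat n b i := rfl

/-- On `𝔭` the trace is constant, so `𝔭` acts on the function `1` by a character, while the lowering
vector `E_{a,i}` turns `1` into a multiple of the coordinate `x_{a,i}` (`chartTrace_rootVec`). This
contrast is what the chart is for. -/
theorem chartTrace_of_mem_parabolic {X : so n} (hX : X ∈ parabolic n) :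
    chartTrace X = MvPolynomial.C (∑ i : Fin 2, X.1 (topIdx n i) (topIdx n i)) := by
  rw [chartTrace_eq, map_sum]
  refine Finset.sum_congr rfl fun i _ => ?_
  rw [Finset.sum_eq_single (topIdx n i)]
  · rw [chartMat_topIdx, if_pos rfl, mul_one]
  · intro b _ hb
    by_cases hb2 : (b : ℕ) < 2
    · have : chartMat n b i = 0 := by
        simp only [chartMat, Matrix.of_apply, if_pos hb2]
        exact if_neg fun h => hb (Fin.ext h)
      rw [this, mul_zero]
    · have : X.1 b (topIdx n i) = 0 := hX b _ (by
        have := val_topIdx_lt (n := n) i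
        unfold block
        split_ifs <;> omega)
      rw [this, map_zero, zero_mul]
  · simp

theorem chartTrace_rootVec {a : Fin (2 * n + 4)} (ha : block n a = 1) (i : Fin 2) :
    chartTrace (rootVec a (topIdx n i)) = MvPolynomial.X (a, i) := by
  have ha2 : ¬ (a : ℕ) < 2 := by
    intro h
    simp [block, h] at ha
  have ha3 : (a : ℕ) < 2 * n + 2 := by
    by_contra h
    simp [block, ha2, h] at ha
  have key : ∀ (b : Fin (2 * n + 4)) (j : Fin 2), (rootVec a (topIdx n i)).1 b (topIdx n j) =
      if b = a ∧ j = i then 1 else 0 := by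
    intro b j
    rw [rootVec_apply]
    have h1 : ¬ (topIdx n j = a.rev) := by
      intro h
      have := congrArg Fin.val h
      simp only [topIdx, Fin.val_castLE, Fin.val_rev] at this
      omega
    have h2 : topIdx n j = topIdx n i ↔ j = i := by
      simp only [topIdx, Fin.castLE_inj]
    rw [if_neg (fun h : b = (topIdx n i).rev ∧ topIdx n j = a.rev => h1 h.2), sub_zero]
    simp only [h2]
  rw [chartTrace_eq, Finset.sum_eq_single i]
  · rw [Finset.sum_eq_single a]
    · rw [key, if_pos ⟨rfl, rfl⟩, map_one, one_mul, chartMat_of_not_lt ha2]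
    · intro b _ hb
      rw [key, if_neg (fun h => hb h.1), map_zero, zero_mul]
    · simp
  · intro j _ hj
    refine Finset.sum_eq_zero fun b _ => ?_
    rw [key, if_neg (fun h => hj h.2), map_zero, zero_mul]
  · simp

end Chart

/-! ### The universal property of generalized Verma modules -/

section VermaBasic

variable {n : ℕ} {V : Type*} [AddCommGroup V] [Module ℂ V] [LieRingModule (parabolic n) V]

theorem vtmul_add (u : U n) (x y : V) : vtmul n u (x + y) = vtmul n u x + vtmul n u y := by
  rw [vtmul, TensorProduct.tmul_add, map_add]; rfl

theorem smul_vtmul (u u' : U n) (x : V) : u • vtmul n u' x = vtmul n (u * u') x := by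
  rw [vtmul, ← map_smul, TensorProduct.smul_tmul', smul_eq_mul]; rfl

theorem vtmul_smul (u : U n) (c : ℂ) (x : V) : vtmul n u (c • x) = c • vtmul n u x := by
  rw [vtmul, TensorProduct.tmul_smul]; rfl

theorem vtmul_lie (u : U n) (X : parabolic n) (x : V) :
    vtmul n (u * inc n X.1) x = vtmul n u ⁅X, x⁆ :=
  (Submodule.Quotient.eq _).2 (Submodule.subset_span ⟨u, X, x, rfl⟩)

/-- The linear map `x ↦ 1 ⊗ x`. -/
noncomputable def vone (n : ℕ) {V : Type*} [AddCommGroup V] [Module ℂ V]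
    [LieRingModule (parabolic n) V] : V →ₗ[ℂ] Verma n V where
  toFun x := vtmul n 1 x
  map_add' := vtmul_add 1
  map_smul' := vtmul_smul 1

theorem vone_apply (x : V) : vone n x = vtmul n 1 x := rfl

theorem smul_vone (u : U n) (x : V) : u • vone n x = vtmul n u x := by
  rw [vone_apply, smul_vtmul, mul_one]

theorem inc_smul_vone (X : parabolic n) (x : V) : inc n X.1 • vone n x = vone n ⁅X, x⁆ := by
  rw [smul_vone, vone_apply, ← vtmul_lie, one_mul]

/-- The action of `so(2n+4, ℂ)` on a generalized Verma module. -/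
noncomputable def vermaRep (n : ℕ) (V : Type*) [AddCommGroup V] [Module ℂ V]
    [LieRingModule (parabolic n) V] : so n →ₗ⁅ℂ⁆ Module.End ℂ (Verma n V) where
  toFun X := Module.toModuleEnd ℂ (Verma n V) (inc n X)
  map_add' X Y := by rw [inc, map_add, map_add]
  map_smul' c X := by
    refine LinearMap.ext fun m => ?_
    change inc n (c • X) • m = c • inc n X • m
    rw [inc, map_smul, smul_assoc]
  map_lie' {X Y} := by
    refine LinearMap.ext fun m => ?_
    change inc n ⁅X, Y⁆ • m = inc n X • inc n Y • m - inc n Y • inc n X • m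
    rw [inc, LieHom.map_lie, Ring.lie_def, sub_smul, mul_smul, mul_smul]

theorem vermaRep_apply (X : so n) (m : Verma n V) : vermaRep n V X m = inc n X • m := rfl

theorem inc_smul_inc_smul (X Y : so n) (m : Verma n V) :
    inc n X • inc n Y • m = inc n Y • inc n X • m + inc n ⁅X, Y⁆ • m :=
  rep_comm (vermaRep n V) X Y m

theorem verma_induction {P : Verma n V → Prop} (h : ∀ u x, P (vtmul n u x))
    (hadd : ∀ a b, P a → P b → P (a + b)) (m : Verma n V) : P m := by
  obtain ⟨t, rfl⟩ := Submodule.mkQ_surjective _ m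
  induction t using TensorProduct.induction_on with
  | zero =>
    have := h 0 (0 : V)
    rwa [vtmul, TensorProduct.tmul_zero] at this
  | tmul u x => exact h u x
  | add a b ha hb => rw [map_add]; exact hadd _ _ ha hb

/-- Frobenius reciprocity for the induced module. -/
theorem exists_vermaLift {T : Type*} [AddCommGroup T] [Module ℂ T] [Module (U n) T]
    [IsScalarTower ℂ (U n) T] (ψ : V →ₗ[ℂ] T)
    (h : ∀ (X : parabolic n) (x : V), ψ ⁅X, x⁆ = inc n X.1 • ψ x) :
    ∃ Φ : Verma n V →ₗ[U n] T, ∀ u x, Φ (vtmul n u x) = u • ψ x := by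
  let f : U n ⊗[ℂ] V →ₗ[U n] T :=
    TensorProduct.AlgebraTensorModule.lift (LinearMap.toSpanSingleton (U n) (V →ₗ[ℂ] T) ψ)
  have hf : ∀ u x, f (u ⊗ₜ x) = u • ψ x := fun _ _ => rfl
  refine ⟨(balancing n V).liftQ f ?_, fun u x => hf u x⟩
  rw [balancing, Submodule.span_le]
  rintro _ ⟨u, X, x, rfl⟩
  change f _ = 0
  rw [map_sub, hf, hf, h, mul_smul, sub_self]

end VermaBasic

/-! ### A module that detects the part of degree `-1` -/

section Detect

variable (n : ℕ)

/-- The natural representation. -/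
noncomputable def natRep : so n →ₗ⁅ℂ⁆ Module.End ℂ (Fin (2 * n + 4) → ℂ) where
  toFun X := Matrix.mulVecLin X.1
  map_add' X Y := Matrix.mulVecLin_add X.1 Y.1
  map_smul' c X := LinearMap.ext fun x => Matrix.smul_mulVec c X.1 x
  map_lie' {X Y} := by
    have h : (⁅X, Y⁆ : so n).1 = X.1 * Y.1 - Y.1 * X.1 := rfl
    refine LinearMap.ext fun x => ?_
    change Matrix.mulVec (⁅X, Y⁆ : so n).1 x =
      Matrix.mulVec X.1 (Matrix.mulVec Y.1 x) - Matrix.mulVec Y.1 (Matrix.mulVec X.1 x)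
    rw [h, Matrix.sub_mulVec, Matrix.mulVec_mulVec, Matrix.mulVec_mulVec]

/-- The tensor product of the Clifford algebra with the natural representation. -/
abbrev SpinNat : Type := Cliff n ⊗[ℂ] (Fin (2 * n + 4) → ℂ)

/-- The representation on `SpinNat n ⊗ ChartRing n`, with the twist by the power `-n-2` of the
determinant. -/
noncomputable def detectRep : so n →ₗ⁅ℂ⁆ Module.End ℂ (SpinNat n ⊗[ℂ] ChartRing n) :=
  tensorRep (tensorRep (spinRep n) (natRep n)) (chartRep n (-(n : ℂ) - 2))

variable {n}

theorem detectRep_tmul_one (X : so n) (e : SpinNat n) :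
    detectRep n X (e ⊗ₜ 1) = (tensorRep (spinRep n) (natRep n) X e) ⊗ₜ 1 +
      e ⊗ₜ ((-(n : ℂ) - 2) • chartTrace X) := by
  rw [detectRep, tensorRep_tmul, chartRep_one]

theorem detectRep_tmul_one_of_mem_parabolic {X : so n} (hX : X ∈ parabolic n) (e : SpinNat n) :
    detectRep n X (e ⊗ₜ 1) = (tensorRep (spinRep n) (natRep n) X e +
      ((-(n : ℂ) - 2) * ∑ i : Fin 2, X.1 (topIdx n i) (topIdx n i)) • e) ⊗ₜ 1 := by
  rw [detectRep_tmul_one, chartTrace_of_mem_parabolic hX, ← MvPolynomial.algebraMap_eq,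
    Algebra.algebraMap_eq_smul_one, smul_smul, TensorProduct.tmul_smul, TensorProduct.add_tmul,
    TensorProduct.smul_tmul']

/-- `ν` is the sum of the spin weight, the weight `ε_0` of the natural representation, and `-n-2`
times the determinant character, one summand for each tensor factor of `detectRep`. -/
theorem evalWeight_nu (hn : 2 ≤ n) (X : so n) : evalWeight n (nu n) X =
    evalWeight n (spinWeight n) X + X.1 0 0 +
      (-(n : ℂ) - 2) * ∑ i : Fin 2, X.1 (topIdx n i) (topIdx n i) := by
  have h : ∀ i, nu n i = spinWeight n i + (if i = 0 then 1 else 0) +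
      (-(n : ℂ) - 2) * ((if i = 0 then 1 else 0) + (if i = 1 then 1 else 0)) := by
    intro i
    have h0 : i = 0 ↔ (i : ℕ) = 0 := by rw [Fin.ext_iff]; rfl
    have h1 : i = 1 ↔ (i : ℕ) = 1 := by rw [Fin.ext_iff, Fin.val_one]
    simp only [h0, h1, nu, spinWeight, delta]
    by_cases hi0 : (i : ℕ) = 0
    · rw [hi0, if_pos rfl, if_neg (by omega), if_pos rfl, if_neg zero_ne_one]
      push_cast
      ring
    by_cases hi1 : (i : ℕ) = 1
    · rw [hi1, if_neg one_ne_zero, if_pos rfl, if_neg (by omega), if_neg one_ne_zero, if_pos rfl]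
      push_cast
      ring
    rw [if_neg hi0, if_neg hi1, if_neg hi0, if_neg hi1]
    split_ifs with h
    · rw [h]
      push_cast
      ring
    · ring
  have hs : ∀ (j : Fin (n + 2)), ∑ i : Fin (n + 2), (if i = j then (1 : ℂ) else 0) *
      X.1 (Fin.castLE (by omega) i) (Fin.castLE (by omega) i) =
      X.1 (Fin.castLE (by omega) j) (Fin.castLE (by omega) j) := by
    intro j
    simp
  simp only [evalWeight, h, add_mul, mul_assoc, mul_add, Finset.sum_add_distrib,
    ← Finset.mul_sum, hs, Fin.sum_univ_two]
  rfl

/-- The vectors `e ⊗ 1` form a finite-dimensional `𝔭`-stable space in which (pure spinor) ⊗ `e₀` ⊗ 1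
is singular of weight `ν`. Minusculeness supplies the map from `V`, irreducibility its injectivity.
-/
theorem exists_detecting_hom (hn : 2 ≤ n) {V : Type*} [AddCommGroup V] [Module ℂ V]
    [LieRingModule (parabolic n) V] [LieModule ℂ (parabolic n) V] {v : V}
    (hv : IsHighestWeightModule n (nu n) v) :
    ∃ ψ : V →ₗ[ℂ] SpinNat n ⊗[ℂ] ChartRing n,
      (∀ (X : parabolic n) x, ψ ⁅X, x⁆ = detectRep n X.1 (ψ x)) ∧ Function.Injective ψ ∧
      ∀ x, ∃ e : SpinNat n, ψ x = e ⊗ₜ 1 := by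
  obtain ⟨s, hs0, hs⟩ := exists_pure_spinor n
  let j : SpinNat n →ₗ[ℂ] SpinNat n ⊗[ℂ] ChartRing n := (TensorProduct.mk ℂ _ _).flip 1
  have hj : ∀ e, j e = e ⊗ₜ 1 := fun _ => rfl
  let F := LinearMap.range j
  let ρ := (detectRep n).comp (parabolic n).incl
  have hF : ∀ X, ∀ x ∈ F, ρ X x ∈ F := by
    rintro X _ ⟨e, rfl⟩
    exact ⟨_, (detectRep_tmul_one_of_mem_parabolic X.2 e).symm⟩
  let e₀ : Fin (2 * n + 4) → ℂ := Pi.single 0 1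
  let u : SpinNat n := s ⊗ₜ e₀
  have hu : IsSingular n (nu n) (M := F) (restrictRep ρ F hF) (⟨j u, u, rfl⟩ : F) := by
    constructor
    · intro X hX
      refine Subtype.ext ?_
      refine (detectRep_tmul_one_of_mem_parabolic X.2 u).trans ?_
      have h1 : natRep n X.1 e₀ = X.1.1 0 0 • e₀ := by
        change Matrix.mulVec X.1.1 (Pi.single 0 1) = _
        rw [Matrix.mulVec_single_one]
        ext a
        by_cases ha : a = 0
        · subst ha; simp [e₀]
        · simp [e₀, ha, hX a 0 ha]
      have h2 : tensorRep (spinRep n) (natRep n) X.1 u =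
          (evalWeight n (spinWeight n) X.1 + X.1.1 0 0) • u := by
        rw [tensorRep_tmul, spinRep_apply, spinEl_mul_of_isCartan hs hX, h1,
          TensorProduct.tmul_smul, ← TensorProduct.smul_tmul', ← add_smul]
      rw [h2, ← add_smul, ← evalWeight_nu hn]
      rfl
    · intro X hX
      refine Subtype.ext ?_
      refine (detectRep_tmul_one_of_mem_parabolic X.2 u).trans ?_
      have h1 : natRep n X.1 e₀ = 0 := by
        change Matrix.mulVec X.1.1 (Pi.single 0 1) = _
        rw [Matrix.mulVec_single_one]
        ext a
        exact hX a 0 (Fin.zero_le a)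
      have h2 : tensorRep (spinRep n) (natRep n) X.1 u = 0 := by
        rw [tensorRep_tmul, spinRep_apply, spinEl_mul_of_isPositive hs hX, h1,
          TensorProduct.zero_tmul, TensorProduct.tmul_zero, add_zero]
      rw [h2, Finset.sum_eq_zero (fun i _ => hX _ _ le_rfl), mul_zero, zero_smul, add_zero,
        TensorProduct.zero_tmul]
      rfl
  obtain ⟨ψ, hψ, hψv⟩ := hv.exists_hom hn (nu_isMinuscule hn) _ hu
  have hjinj : Function.Injective j := by
    let ev : SpinNat n ⊗[ℂ] ChartRing n →ₗ[ℂ] SpinNat n :=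
      (TensorProduct.rid ℂ (SpinNat n)).toLinearMap ∘ₗ
        (MvPolynomial.lcoeff ℂ 0).lTensor (SpinNat n)
    refine Function.LeftInverse.injective (g := ev) fun e => ?_
    simp [ev, hj]
  have hu0 : u ≠ 0 := by
    intro h
    let ev : SpinNat n →ₗ[ℂ] Cliff n := (TensorProduct.rid ℂ (Cliff n)).toLinearMap ∘ₗ
        (LinearMap.proj (0 : Fin (2 * n + 4))).lTensor (Cliff n)
    have : ev u = s := by simp [ev, u, e₀]
    rw [h, map_zero] at this
    exact hs0 this.symm
  refine ⟨F.subtype ∘ₗ ψ, fun X x => congrArg Subtype.val (hψ X x), ?_, fun x => ?_⟩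
  · refine (injective_iff_map_eq_zero _).2 fun x hx => ?_
    by_contra hx0
    have hx' : ψ x = 0 := Subtype.ext hx
    have := hv.eq_top (P := LinearMap.ker ψ) (fun X y hy => by
      rw [LinearMap.mem_ker] at hy ⊢
      rw [hψ, hy, map_zero]) (x := x) hx' hx0
    have hv0 : v ∈ LinearMap.ker ψ := this ▸ Submodule.mem_top
    rw [LinearMap.mem_ker, hψv] at hv0
    have h3 : j u = 0 := congrArg Subtype.val hv0
    exact hu0 (hjinj (h3.trans (map_zero j).symm))
  · obtain ⟨e, he⟩ := (ψ x).2
    exact ⟨e, he.symm⟩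

/-- The indices of the middle block. -/
def midIdx (n : ℕ) : Finset (Fin (2 * n + 4)) := Finset.univ.filter fun a => block n a = 1

theorem mem_midIdx {a : Fin (2 * n + 4)} : a ∈ midIdx n ↔ block n a = 1 := by
  simp [midIdx]

/-- The root vectors `y_{a,i}`, for `a` in the middle block, are linearly independent over the
inducing module. -/
theorem eq_zero_of_sum_vone_eq_zero (hn : 2 ≤ n) {V : Type*} [AddCommGroup V] [Module ℂ V]
    [LieRingModule (parabolic n) V] [LieModule ℂ (parabolic n) V] {v : V}
    (hv : IsHighestWeightModule n (nu n) v) (w : Fin (2 * n + 4) → Fin 2 → V)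
    (hw : ∑ a ∈ midIdx n, ∑ i, inc n (rootVec a (topIdx n i)) • vone n (w a i) = 0)
    {a : Fin (2 * n + 4)} (ha : a ∈ midIdx n) (i : Fin 2) : w a i = 0 := by
  obtain ⟨ψ, hψ, hψinj, hψe⟩ := exists_detecting_hom hn hv
  choose e he using hψe
  let f := UniversalEnvelopingAlgebra.lift ℂ (detectRep n)
  let _ : Module (U n) (SpinNat n ⊗[ℂ] ChartRing n) := Module.compHom _ f.toRingHom
  have hsmul : ∀ (u : U n) (t : SpinNat n ⊗[ℂ] ChartRing n), u • t = f u t := fun _ _ => rfl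
  have hinc : ∀ (X : so n) (t : SpinNat n ⊗[ℂ] ChartRing n), inc n X • t = detectRep n X t := by
    intro X t
    rw [hsmul, UniversalEnvelopingAlgebra.lift_ι_apply]
  have : IsScalarTower ℂ (U n) (SpinNat n ⊗[ℂ] ChartRing n) :=
    ⟨fun c u t => by rw [hsmul, map_smul]; rfl⟩
  obtain ⟨Φ, hΦ⟩ := exists_vermaLift ψ (fun X x => by rw [hψ, hinc])
  have h1 := congrArg Φ hw
  simp only [map_sum, map_zero, smul_vone, hΦ, hinc, he, detectRep_tmul_one] at h1
  -- The spin and natural actions only produce vectors `e' ⊗ 1`. Extracting the coefficient of the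
  -- variable `x_{a,i}` thus leaves `-n-2` times the image of `w a i`, and `-n-2` is not zero.
  let ev : SpinNat n ⊗[ℂ] ChartRing n →ₗ[ℂ] SpinNat n :=
    (TensorProduct.rid ℂ (SpinNat n)).toLinearMap ∘ₗ
      (MvPolynomial.lcoeff ℂ (Finsupp.single (a, i) 1)).lTensor (SpinNat n)
  have hev : ∀ x f, ev (x ⊗ₜ f) = MvPolynomial.coeff (Finsupp.single (a, i) 1) f • x := by
    intro x f
    simp [ev]
  have h2 := congrArg ev h1
  rw [map_sum, Finset.sum_eq_single a, map_sum, Finset.sum_eq_single i, map_zero, map_add, hev,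
    hev, chartTrace_rootVec (mem_midIdx.1 ha)] at h2
  · have h3 : MvPolynomial.coeff (Finsupp.single (a, i) 1) (1 : ChartRing n) = 0 := by
      rw [MvPolynomial.coeff_one, if_neg]
      exact fun h => Finsupp.single_ne_zero.2 one_ne_zero h.symm
    rw [h3, zero_smul, zero_add, MvPolynomial.coeff_smul, MvPolynomial.coeff_X, if_pos rfl,
      smul_eq_mul, mul_one] at h2
    have h4 : -(n : ℂ) - 2 ≠ 0 := by
      intro h
      have : ((n + 2 : ℕ) : ℂ) = 0 := by push_cast; linear_combination -h
      exact absurd (Nat.cast_eq_zero.1 this) (by omega)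
    have h5 := (smul_eq_zero.1 h2).resolve_left h4
    apply hψinj
    rw [he, h5, map_zero, TensorProduct.zero_tmul]
  · intro k _ hk
    rw [map_add, hev, hev, chartTrace_rootVec (mem_midIdx.1 ha), MvPolynomial.coeff_one,
      MvPolynomial.coeff_smul, MvPolynomial.coeff_X, if_neg, if_neg]
    · simp
    · intro h
      have := Finsupp.single_left_injective one_ne_zero h
      exact hk (Prod.ext_iff.1 this).2
    · exact fun h => Finsupp.single_ne_zero.2 one_ne_zero h.symm
  · simp
  · intro b hb hba
    rw [map_sum]
    refine Finset.sum_eq_zero fun k _ => ?_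
    rw [map_add, hev, hev, chartTrace_rootVec (mem_midIdx.1 hb), MvPolynomial.coeff_one,
      MvPolynomial.coeff_smul, MvPolynomial.coeff_X, if_neg, if_neg]
    · simp
    · intro h
      have := Finsupp.single_left_injective one_ne_zero h
      exact hba (Prod.ext_iff.1 this).1
    · exact fun h => Finsupp.single_ne_zero.2 one_ne_zero h.symm
  · exact fun h => absurd ha h

end Detect

/-! ### The part of degree `-1` of a generalized Verma module -/

section Degree

variable {n : ℕ}

/-- The diagonal matrix with entries `1` in the first, `0` in the second and `-1` in the third
block. -/
def degEl (n : ℕ) : parabolic n := parTorus fun i => if (i : ℕ) ≤ 1 then 1 else 0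

theorem isCartan_degEl : IsCartan n (degEl n).1 :=
  isCartan_torus fun i : Fin (n + 2) => if (i : ℕ) ≤ 1 then 1 else 0

theorem degEl_apply (a : Fin (2 * n + 4)) : (degEl n).1.1 a a = 1 - (block n a : ℂ) := by
  refine (torus_apply (fun i : Fin (n + 2) => if (i : ℕ) ≤ 1 then 1 else 0) a).trans ?_
  have := a.2
  have h3 : (a.rev : ℕ) = 2 * n + 3 - a := by rw [Fin.val_rev]; omega
  simp only [block, h3]
  split_ifs
  all_goals first
    | (exfalso; omega)
    | norm_num

theorem lie_degEl_rootVec (a b : Fin (2 * n + 4)) :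
    ⁅(degEl n).1, rootVec a b⁆ = ((block n b : ℂ) - block n a) • rootVec a b := by
  rw [lie_rootVec_of_isCartan isCartan_degEl, degEl_apply, degEl_apply]
  congr 1
  ring

variable {χ : Fin (n + 2) → ℂ} {V : Type*} [AddCommGroup V] [Module ℂ V]
  [LieRingModule (parabolic n) V] [LieModule ℂ (parabolic n) V] {v : V}

/-- `degEl` is central in the Levi factor, so its brackets with `𝔭` lie in the nilradical and act by
zero. Its eigenspace through `v` is then a submodule. -/
theorem IsHighestWeightModule.lie_degEl (hv : IsHighestWeightModule n χ v) (x : V) :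
    ⁅degEl n, x⁆ = evalWeight n χ (degEl n).1 • x := by
  let P : Submodule ℂ V :=
    (LieModule.toEnd ℂ (parabolic n) V (degEl n)).eigenspace (evalWeight n χ (degEl n).1)
  have hP : ∀ y, y ∈ P ↔ ⁅degEl n, y⁆ = evalWeight n χ (degEl n).1 • y := fun y =>
    Module.End.mem_eigenspace_iff
  have : P = ⊤ := by
    refine hv.eq_top (fun X y hy => ?_) ((hP v).2 (hv.weight _ isCartan_degEl)) hv.ne_zero
    rw [hP] at hy ⊢
    rw [leibniz_lie, hy, lie_smul, hv.lie_eq_zero (X := ⁅degEl n, X⁆), zero_add]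
    intro a b hab
    change (⁅(degEl n).1, X.1⁆ : so n).1 a b = 0
    rw [lie_apply, Finset.sum_eq_single a, Finset.sum_eq_single b, degEl_apply, degEl_apply, hab]
    · ring
    · intro c _ hc
      rw [isCartan_degEl c b hc, mul_zero]
    · simp
    · intro c _ hc
      rw [isCartan_degEl a c hc.symm, zero_mul]
    · simp
  exact (hP x).1 (this ▸ Submodule.mem_top)

variable (n V) in
/-- The linear map `w ↦ ∑ y_{a,i} ⊗ w_{a,i}`, where `a` runs through the middle block. -/
noncomputable def lowSum : (Fin (2 * n + 4) → Fin 2 → V) →ₗ[ℂ] Verma n V :=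
  ∑ a ∈ midIdx n, ∑ i, vermaRep n V (rootVec a (topIdx n i)) ∘ₗ vone n ∘ₗ
    LinearMap.proj i ∘ₗ LinearMap.proj a

omit [LieModule ℂ (parabolic n) V] in
theorem lowSum_apply (w : Fin (2 * n + 4) → Fin 2 → V) : lowSum n V w =
    ∑ a ∈ midIdx n, ∑ i, inc n (rootVec a (topIdx n i)) • vone n (w a i) := by
  simp only [lowSum, LinearMap.sum_apply]
  rfl

omit [LieModule ℂ (parabolic n) V] in
theorem lowSum_single {a : Fin (2 * n + 4)} (ha : block n a = 1) (i : Fin 2) (x : V) :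
    lowSum n V (Pi.single a (Pi.single i x)) =
      inc n (rootVec a (topIdx n i)) • vone n x := by
  rw [lowSum_apply, Finset.sum_eq_single a, Finset.sum_eq_single i, Pi.single_eq_same,
    Pi.single_eq_same]
  · intro j _ hj
    rw [Pi.single_eq_same, Pi.single_eq_of_ne hj, map_zero, smul_zero]
  · simp
  · intro b _ hb
    simp [Pi.single_eq_of_ne hb]
  · exact fun h => absurd (mem_midIdx.2 ha) h

theorem block_topIdx (i : Fin 2) : block n (topIdx n i) = 0 := if_pos (val_topIdx_lt i)

theorem exists_topIdx {a : Fin (2 * n + 4)} (h : block n a = 0) : ∃ i, a = topIdx n i := by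
  unfold block at h
  have : (a : ℕ) < 2 := by
    by_contra h'
    rw [if_neg h'] at h
    split_ifs at h
  exact ⟨⟨a, this⟩, rfl⟩

theorem IsHighestWeightModule.degEl_smul_vone (hv : IsHighestWeightModule n χ v) (x : V) :
    vermaRep n V (degEl n).1 (vone n x) = evalWeight n χ (degEl n).1 • vone n x := by
  rw [vermaRep_apply, inc_smul_vone, hv.lie_degEl, map_smul]

theorem IsHighestWeightModule.degEl_smul_lowSum (hv : IsHighestWeightModule n χ v)
    (w : Fin (2 * n + 4) → Fin 2 → V) : vermaRep n V (degEl n).1 (lowSum n V w) =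
      (evalWeight n χ (degEl n).1 - 1) • lowSum n V w := by
  rw [lowSum_apply, map_sum, Finset.smul_sum]
  refine Finset.sum_congr rfl fun a ha => ?_
  rw [map_sum, Finset.smul_sum]
  refine Finset.sum_congr rfl fun i _ => ?_
  refine (apply_eigenvector (ρ := vermaRep n V) (lie_degEl_rootVec a (topIdx n i))
    (hv.degEl_smul_vone (w a i))).trans ?_
  rw [block_topIdx, mem_midIdx.1 ha, vermaRep_apply]
  congr 1
  push_cast
  ring

theorem universalEnvelopingAlgebra_mem_subalgebra (A : Subalgebra ℂ (U n))
    (hA : ∀ X, inc n X ∈ A) (u : U n) : u ∈ A := by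
  let f : so n →ₗ⁅ℂ⁆ A :=
    { toFun := fun X => ⟨inc n X, hA X⟩
      map_add' := fun X Y => Subtype.ext (map_add _ X Y)
      map_smul' := fun c X => Subtype.ext (map_smul _ c X)
      map_lie' := fun {X Y} => Subtype.ext (LieHom.map_lie _ X Y) }
  have h : A.val.comp (UniversalEnvelopingAlgebra.lift ℂ f) = AlgHom.id ℂ (U n) := by
    apply UniversalEnvelopingAlgebra.hom_ext
    refine LieHom.ext fun X => ?_
    change ((UniversalEnvelopingAlgebra.lift ℂ f (UniversalEnvelopingAlgebra.ι ℂ X) : A) : U n) = _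
    rw [UniversalEnvelopingAlgebra.lift_ι_apply]
    rfl
  have h2 := DFunLike.congr_fun h u
  change ((UniversalEnvelopingAlgebra.lift ℂ f u : A) : U n) = u at h2
  exact h2 ▸ (UniversalEnvelopingAlgebra.lift ℂ f u).2

theorem smul_mem_of_forall_inc {M : Type*} [AddCommGroup M] [Module ℂ M] [Module (U n) M]
    [IsScalarTower ℂ (U n) M] {N : Submodule ℂ M} (hN : ∀ X, ∀ m ∈ N, inc n X • m ∈ N) (u : U n)
    {m : M} (hm : m ∈ N) : u • m ∈ N := by
  let A : Subalgebra ℂ (U n) :=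
    { carrier := {u | ∀ m ∈ N, u • m ∈ N}
      mul_mem' := fun ha hb m hm => by rw [mul_smul]; exact ha _ (hb m hm)
      add_mem' := fun ha hb m hm => by rw [add_smul]; exact add_mem (ha m hm) (hb m hm)
      algebraMap_mem' := fun c m hm => by
        rw [algebraMap_smul]
        exact N.smul_mem c hm }
  exact universalEnvelopingAlgebra_mem_subalgebra A hN u m hm

/-- The pairs `(a, b)` that index the root vectors of the opposite nilradical. -/
abbrev LowIndex (n : ℕ) : Type :=
  {p : Fin (2 * n + 4) × Fin (2 * n + 4) // block n p.2 < block n p.1}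

variable (n V) in
omit [LieModule ℂ (parabolic n) V] in
-- `1 ⊗ V` is stable under `𝔭`, and `𝔭` together with the opposite nilradical spans the Lie algebra.
-- This is the spanning half of the PBW description.
theorem stableSpan_vone_eq_top : stableSpan (vermaRep n V)
    (fun p : LowIndex n => (rootVec p.1.1 p.1.2 : so n)) (LinearMap.range (vone n)) = ⊤ := by
  rw [eq_top_iff]
  intro m _
  refine verma_induction (fun u x => ?_) (fun a b ha hb => add_mem ha hb) m
  rw [← smul_vone]
  refine smul_mem_of_forall_inc (fun X m hm => ?_) u (le_stableSpan ⟨x, rfl⟩)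
  refine stableSpan_stable (B := (parabolic n).toSubmodule) ?_ ?_ X hm
  · rintro X hX _ ⟨x, rfl⟩
    exact ⟨⁅(⟨X, hX⟩ : parabolic n), x⁆, (inc_smul_vone ⟨X, hX⟩ x).symm⟩
  · intro X _
    refine so_mem_of_forall_rootVec fun a b _ => ?_
    rcases lt_or_ge (block n b) (block n a) with h | h
    · exact Submodule.mem_sup_left (Submodule.subset_span ⟨⟨(a, b), h⟩, rfl⟩)
    · exact Submodule.mem_sup_right (rootVec_mem_parabolic h)

omit [LieModule ℂ (parabolic n) V] in
-- Root vectors leading from the third to the second block are, up to sign, the mirror images of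
-- those from the second to the first.
theorem rootVec_smul_vone_mem {a b : Fin (2 * n + 4)} (h : block n a = block n b + 1) (s : V) :
    vermaRep n V (rootVec a b) (vone n s) ∈ LinearMap.range (lowSum n V) := by
  have := block_le_two a
  by_cases hb : block n b = 0
  · obtain ⟨i, rfl⟩ := exists_topIdx hb
    exact ⟨_, lowSum_single (by omega) i s⟩
  · have hb1 : block n b.rev = 1 := by rw [block_rev]; omega
    have ha0 : block n a.rev = 0 := by rw [block_rev]; omega
    obtain ⟨i, hi⟩ := exists_topIdx ha0
    have h2 : (rootVec a b : so n) = -rootVec b.rev (topIdx n i) := by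
      rw [← hi, rootVec_rev, neg_neg]
    rw [h2, map_neg]
    have h3 : vermaRep n V (rootVec b.rev (topIdx n i)) (vone n s) ∈
        LinearMap.range (lowSum n V) := ⟨_, lowSum_single hb1 i s⟩
    exact Submodule.neg_mem _ h3

/-- The version of `stableSpan_le_sup_eigenSum` with two explicit layers: from `S` one step leads
into `Y` or directly into `Λ`, from `Y` always into `Λ`. -/
theorem stableSpan_le_sup_sup_eigenSum {L M I : Type*} [LieRing L] [LieAlgebra ℂ L]
    [AddCommGroup M] [Module ℂ M] {ρ : L →ₗ⁅ℂ⁆ Module.End ℂ M} {g : I → L} {S Y : Submodule ℂ M}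
    {H : L} {d : I → ℂ} (hd : ∀ i, ⁅H, g i⁆ = d i • g i) {c₀ c₁ : ℂ}
    (hS : ∀ x ∈ S, ρ H x = c₀ • x) (hY : ∀ x ∈ Y, ρ H x = c₁ • x) {Λ : Set ℂ}
    (h₀ : ∀ i, ∀ x ∈ S, ρ (g i) x ∈ Y ∨ c₀ + d i ∈ Λ) (h₁ : ∀ i, c₁ + d i ∈ Λ)
    (h : ∀ i, ∀ c ∈ Λ, c + d i ∈ Λ) :
    stableSpan ρ g S ≤ (S ⊔ Y) ⊔ eigenSum (ρ H) Λ := by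
  refine stableSpan_le (le_sup_left.trans le_sup_left) fun i x hx => ?_
  obtain ⟨y, hy, z, hz, rfl⟩ := Submodule.mem_sup.1 hx
  obtain ⟨s, hs, t, ht, rfl⟩ := Submodule.mem_sup.1 hy
  rw [map_add, map_add]
  refine add_mem (add_mem ?_ ?_) (Submodule.mem_sup_right (apply_mem_eigenSum (hd i) (h i) hz))
  · rcases h₀ i s hs with h | h
    · exact Submodule.mem_sup_left (Submodule.mem_sup_right h)
    · exact Submodule.mem_sup_right (mem_eigenSum h (apply_eigenvector (hd i) (hS s hs)))
  · exact Submodule.mem_sup_right (mem_eigenSum (h₁ i) (apply_eigenvector (hd i) (hY t ht)))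

/-- The elements of degree `-1` are of the form `∑ y_{a,i} ⊗ w_{a,i}`. -/
theorem IsHighestWeightModule.exists_lowSum (hv : IsHighestWeightModule n χ v) {m : Verma n V}
    (hm : vermaRep n V (degEl n).1 m = (evalWeight n χ (degEl n).1 - 1) • m) :
    ∃ w, m = lowSum n V w := by
  set c₀ := evalWeight n χ (degEl n).1 with hc₀
  -- The eigenvalues of degree `-2` and below.
  let Λ : Set ℂ := {c | ∃ k : ℕ, c = c₀ - (k + 2)}
  let Y := LinearMap.range (lowSum n V)
  have hY : ∀ y ∈ Y, vermaRep n V (degEl n).1 y = (c₀ - 1) • y := by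
    rintro _ ⟨w, rfl⟩
    exact hv.degEl_smul_lowSum w
  have h1 : (⊤ : Submodule ℂ (Verma n V)) ≤
      (LinearMap.range (vone n) ⊔ Y) ⊔ eigenSum (vermaRep n V (degEl n).1) Λ := by
    rw [← stableSpan_vone_eq_top n V]
    have hk : ∀ p : LowIndex n, ∃ k : ℕ, block n p.1.1 = block n p.1.2 + (k + 1) := fun p =>
      ⟨block n p.1.1 - block n p.1.2 - 1, by have := p.2; omega⟩
    choose k hk using hk
    have hd : ∀ p : LowIndex n, ((block n p.1.2 : ℂ) - block n p.1.1) = -(k p + 1) := fun p => by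
      rw [hk]; push_cast; ring
    refine stableSpan_le_sup_sup_eigenSum (ρ := vermaRep n V) (H := (degEl n).1)
      (g := fun p : LowIndex n => (rootVec p.1.1 p.1.2 : so n))
      (d := fun p : LowIndex n => (block n p.1.2 : ℂ) - block n p.1.1)
      (fun p : LowIndex n => lie_degEl_rootVec p.1.1 p.1.2) (c₀ := c₀)
      (c₁ := c₀ - 1) ?_ hY ?_ ?_ ?_
    · rintro _ ⟨s, rfl⟩
      exact hv.degEl_smul_vone s
    · rintro p _ ⟨s, rfl⟩
      by_cases hk0 : k p = 0
      · exact Or.inl (rootVec_smul_vone_mem (by rw [hk, hk0]) s)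
      · refine Or.inr ⟨k p - 1, ?_⟩
        rw [hd, Nat.cast_sub (by omega)]
        push_cast
        ring
    · exact fun p => ⟨k p, by rw [hd]; ring⟩
    · rintro p _ ⟨l, rfl⟩
      exact ⟨l + k p + 1, by rw [hd]; push_cast; ring⟩
  -- Degree `0` is now counted among the unwanted eigenvalues, so that only `c₀ - 1` has to be
  -- separated from the rest.
  have h2 : m ∈ Y ⊔ eigenSum (vermaRep n V (degEl n).1) (insert c₀ Λ) := by
    refine (sup_le (sup_le ?_ le_sup_left) ?_ :
      (LinearMap.range (vone n) ⊔ Y) ⊔ eigenSum (vermaRep n V (degEl n).1) Λ ≤ _)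
      (h1 Submodule.mem_top)
    · rintro _ ⟨s, rfl⟩
      exact Submodule.mem_sup_right (mem_eigenSum (Set.mem_insert _ _) (hv.degEl_smul_vone s))
    · exact (eigenSum_mono (Set.subset_insert _ _)).trans le_sup_right
  have h3 : c₀ - 1 ∉ insert c₀ Λ := by
    rintro (h | ⟨k, hk⟩)
    · exact one_ne_zero (sub_eq_self.1 h)
    · have : ((k + 1 : ℕ) : ℂ) = 0 := by push_cast; linear_combination hk
      exact absurd (Nat.cast_eq_zero.1 this) (by omega)
  obtain ⟨w, hw⟩ := mem_of_mem_sup_eigenSum h3 hY h2 hm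
  exact ⟨w, hw.symm⟩

/-- Exchanging summations transposes the action on the root vectors into an action on the
coefficients. -/
theorem sum_matrix_action {V M I J : Type*} [AddCommGroup V] [Module ℂ V] [AddCommGroup M]
    [Module ℂ M] [Fintype J] (T : I → J → V →ₗ[ℂ] M) (s : Finset I) (A : I → I → ℂ) (B : J → J → ℂ)
    (x w : I → J → V) :
    ∑ a ∈ s, ∑ i, (T a i (x a i) + ∑ c ∈ s, T c i (A c a • w a i) - ∑ j, T a j (B i j • w a i)) =
      ∑ a ∈ s, ∑ i, T a i (x a i + ∑ c ∈ s, A a c • w c i - ∑ j, B j i • w a j) := by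
  simp only [map_sub, map_add, map_sum, Finset.sum_add_distrib, Finset.sum_sub_distrib]
  congr 1
  · congr 1
    rw [Finset.sum_congr rfl fun a _ => Finset.sum_comm, Finset.sum_comm]
    exact Finset.sum_congr rfl fun a _ => Finset.sum_comm
  · exact Finset.sum_congr rfl fun a _ => Finset.sum_comm

theorem inc_sum_smul {M : Type*} [AddCommGroup M] [Module ℂ M] [Module (U n) M]
    [IsScalarTower ℂ (U n) M] {ι : Type*} (s : Finset ι) (c : ι → ℂ) (Y : ι → so n) (m : M) :
    UniversalEnvelopingAlgebra.ι ℂ (∑ i ∈ s, c i • Y i) • m = ∑ i ∈ s, c i • inc n (Y i) • m := by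
  rw [map_sum, Finset.sum_smul]
  exact Finset.sum_congr rfl fun i _ => by rw [map_smul, smul_assoc]

omit [LieModule ℂ (parabolic n) V] in
/-- The action of the Levi factor on elements of degree `-1`. -/
theorem inc_smul_lowSum {X : parabolic n} (hX : ∀ a b, block n a ≠ block n b → X.1.1 a b = 0)
    (w : Fin (2 * n + 4) → Fin 2 → V) :
    inc n X.1 • lowSum n V w = lowSum n V fun a i => ⁅X, w a i⁆ +
      ∑ c ∈ midIdx n, X.1.1 a c • w c i - ∑ j, X.1.1 (topIdx n j) (topIdx n i) • w a j := by
  have h1 : ∀ a ∈ midIdx n, ∀ i, inc n X.1 • inc n (rootVec a (topIdx n i)) • vone n (w a i) =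
      inc n (rootVec a (topIdx n i)) • vone n ⁅X, w a i⁆ +
      ∑ c ∈ midIdx n, inc n (rootVec c (topIdx n i)) • vone n (X.1.1 c a • w a i) -
      ∑ j, inc n (rootVec a (topIdx n j)) •
        vone n (X.1.1 (topIdx n i) (topIdx n j) • w a i) := by
    intro a ha i
    have h2 : ⁅X.1, rootVec a (topIdx n i)⁆ =
        ∑ c ∈ midIdx n, X.1.1 c a • rootVec c (topIdx n i) -
        ∑ j, X.1.1 (topIdx n i) (topIdx n j) • rootVec a (topIdx n j) := by
      rw [lie_rootVec]
      congr 1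
      · refine (Finset.sum_subset (Finset.subset_univ _) fun c _ hc => ?_).symm
        rw [hX, zero_smul]
        rw [mem_midIdx] at hc ha
        rwa [ha]
      · symm
        refine Finset.sum_of_injOn (topIdx n) (fun x _ y _ h => Fin.castLE_injective _ h)
          (fun _ _ => Finset.mem_univ _) (fun d _ hd => ?_) fun _ _ => rfl
        rw [hX, zero_smul]
        rw [block_topIdx]
        intro h
        obtain ⟨j, rfl⟩ := exists_topIdx h.symm
        exact hd ⟨j, Finset.mem_coe.2 (Finset.mem_univ _), rfl⟩
    have h3 := fun (m : Verma n V) => congrArg (fun Y : so n => inc n Y • m) h2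
    simp only [inc, map_sub, sub_smul, inc_sum_smul] at h3
    rw [inc_smul_inc_smul, inc_smul_vone, h3, add_sub_assoc]
    simp only [LinearMap.map_smul, smul_comm (_ : U n) (_ : ℂ)]
  rw [lowSum_apply, lowSum_apply, Finset.smul_sum]
  rw [Finset.sum_congr rfl fun a ha => by
    rw [Finset.smul_sum, Finset.sum_congr rfl fun i _ => h1 a ha i]]
  exact sum_matrix_action (fun a i => vermaRep n V (rootVec a (topIdx n i)) ∘ₗ vone n)
    (midIdx n) X.1.1 (fun i j => X.1.1 (topIdx n i) (topIdx n j)) (fun a i => ⁅X, w a i⁆) w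

end Degree

/-! ### The extremal vector -/

section Extremal

variable {n : ℕ}

theorem lie_rootVec_rootVec (a b c d : Fin (2 * n + 4)) :
    ⁅rootVec a b, rootVec c d⁆ = (if b = c then rootVec a d else 0) -
      (if c = a.rev then rootVec b.rev d else 0) - (if d = a then rootVec c b else 0) +
      (if d = b.rev then rootVec c a.rev else (0 : so n)) := by
  have h1 : ∀ x : Fin (2 * n + 4), (d = a ∧ x = b) ↔ (x = b ∧ d = a) := fun x => and_comm
  have h2 : ∀ x : Fin (2 * n + 4), (d = b.rev ∧ x = a.rev) ↔ (x = a.rev ∧ d = b.rev) :=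
    fun x => and_comm
  rw [lie_rootVec]
  simp only [rootVec_apply, h1, h2, sub_smul, ite_smul, one_smul, zero_smul, ite_and,
    Finset.sum_sub_distrib, Finset.sum_ite_eq', Finset.mem_univ, if_true]
  simp only [eq_comm (a := b) (b := c)]
  abel

/-- The commutation relations of the upper left `gl(n+2)`. -/
theorem lie_rootVec_rootVec_gl {a b c d : Fin (2 * n + 4)} (ha : (a : ℕ) < n + 2)
    (hb : (b : ℕ) < n + 2) (hc : (c : ℕ) < n + 2) (hd : (d : ℕ) < n + 2) :
    ⁅rootVec a b, rootVec c d⁆ = (if b = c then rootVec a d else 0) -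
      (if d = a then rootVec c b else (0 : so n)) := by
  have h1 : c ≠ a.rev := fun h => by
    have := congrArg Fin.val h; rw [Fin.val_rev] at this; omega
  have h2 : d ≠ b.rev := fun h => by
    have := congrArg Fin.val h; rw [Fin.val_rev] at this; omega
  rw [lie_rootVec_rootVec, if_neg h1, if_neg h2, sub_zero, add_zero]

/-- The positive root spaces are generated by the simple ones. -/
theorem rootVec_mem_of_simple {P : Submodule ℂ (so n)} (hlie : ∀ X ∈ P, ∀ Y ∈ P, ⁅X, Y⁆ ∈ P)
    (h1 : ∀ a b : Fin (2 * n + 4), (b : ℕ) = a + 1 → (a : ℕ) ≤ n → rootVec a b ∈ P)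
    (h2 : ∀ a b : Fin (2 * n + 4), (a : ℕ) = n → (b : ℕ) = n + 2 → rootVec a b ∈ P)
    {a b : Fin (2 * n + 4)} (hab : a < b) : rootVec a b ∈ P := by
  -- The roots `ε_a - ε_b`, by adding one simple root at a time.
  have c1 : ∀ k : ℕ, ∀ a b : Fin (2 * n + 4), (b : ℕ) = a + 1 + k → (b : ℕ) ≤ n + 1 →
      rootVec a b ∈ P := by
    intro k
    induction k with
    | zero => exact fun a b h hb => h1 a b h (by omega)
    | succ k ih =>
      intro a b h hb
      let c : Fin (2 * n + 4) := ⟨b - 1, by omega⟩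
      have hc : (c : ℕ) = b - 1 := rfl
      have := hlie _ (ih a c (by omega) (by omega)) _ (h1 c b (by omega) (by omega))
      rwa [lie_rootVec_rootVec_gl (by omega) (by omega) (by omega) (by omega), if_pos rfl,
        if_neg (by rintro rfl; omega), sub_zero] at this
  -- Column `n + 2` mirrors `n + 1`: these are the roots `ε_a + ε_{n+1}`, obtained from the last
  -- simple root; for `a = n + 1` the vector is zero.
  have c2 : ∀ a b : Fin (2 * n + 4), (a : ℕ) ≤ n + 1 → (b : ℕ) = n + 2 → rootVec a b ∈ P := by
    intro a b ha hb
    by_cases h : (a : ℕ) = n + 1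
    · have : b = a.rev := Fin.ext (by rw [Fin.val_rev]; omega)
      rw [this, rootVec_self_rev]
      exact P.zero_mem
    by_cases h : (a : ℕ) = n
    · exact h2 a b h hb
    let c : Fin (2 * n + 4) := ⟨n, by omega⟩
    have hc : (c : ℕ) = n := rfl
    have := hlie _ (c1 (n - a - 1) a c (by omega) (by omega)) _ (h2 c b hc hb)
    rwa [lie_rootVec_rootVec, if_pos rfl,
      if_neg (fun h => by have := congrArg Fin.val h; rw [Fin.val_rev] at this; omega),
      if_neg (by rintro rfl; omega),
      if_neg (fun h => by have := congrArg Fin.val h; rw [Fin.val_rev] at this; omega),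
      sub_zero, sub_zero, add_zero] at this
  -- The remaining roots `ε_a + ε_c`, as `(ε_a + ε_{n+1}) + (ε_c - ε_{n+1})`.
  have c3 : ∀ a c : Fin (2 * n + 4), (a : ℕ) ≤ n + 1 → (c : ℕ) ≤ n → rootVec a c.rev ∈ P := by
    intro a c ha hc
    by_cases h : (a : ℕ) = n + 1
    · have := c2 c a.rev (by omega) (by rw [Fin.val_rev]; omega)
      rw [← P.neg_mem_iff, ← rootVec_rev, Fin.rev_rev] at this
      exact this
    by_cases h : a = c
    · rw [h, rootVec_self_rev]
      exact P.zero_mem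
    let d : Fin (2 * n + 4) := ⟨n + 1, by omega⟩
    have hd : (d : ℕ) = n + 1 := rfl
    have e1 := c1 (n - c) c d (by omega) (by omega)
    rw [← P.neg_mem_iff, ← rootVec_rev] at e1
    have := hlie _ (c2 a d.rev (by omega) (by rw [Fin.val_rev]; omega)) _ e1
    rwa [lie_rootVec_rootVec, if_pos rfl,
      if_neg (fun h => by have := congrArg Fin.val h; simp only [Fin.val_rev] at this; omega),
      if_neg (fun h => by have := congrArg Fin.val h; rw [Fin.val_rev] at this; omega),
      if_neg (fun h => by have := congrArg Fin.val h; simp only [Fin.val_rev] at this; omega),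
      sub_zero, sub_zero, add_zero] at this
  have hab : (a : ℕ) < b := hab
  by_cases ha : (a : ℕ) ≤ n + 1
  · by_cases hb : (b : ℕ) ≤ n + 1
    · exact c1 (b - a - 1) a b (by omega) hb
    by_cases hb2 : (b : ℕ) = n + 2
    · exact c2 a b ha hb2
    have := c3 a b.rev ha (by rw [Fin.val_rev]; omega)
    rwa [Fin.rev_rev] at this
  · have hr : (b.rev : ℕ) < a.rev := by rw [Fin.val_rev, Fin.val_rev]; omega
    have := c1 (a.rev - b.rev - 1) b.rev a.rev (by omega) (by rw [Fin.val_rev]; omega)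
    rwa [rootVec_rev, P.neg_mem_iff] at this

theorem mem_of_isPositive {P : Submodule ℂ (so n)} (hlie : ∀ X ∈ P, ∀ Y ∈ P, ⁅X, Y⁆ ∈ P)
    (h1 : ∀ a b : Fin (2 * n + 4), (b : ℕ) = a + 1 → (a : ℕ) ≤ n → rootVec a b ∈ P)
    (h2 : ∀ a b : Fin (2 * n + 4), (a : ℕ) = n → (b : ℕ) = n + 2 → rootVec a b ∈ P)
    {X : so n} (hX : IsPositive n X) : X ∈ P :=
  so_mem_of_forall_rootVec fun a b hab =>
    rootVec_mem_of_simple hlie h1 h2 (not_le.1 fun h => hab (hX a b h))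

/-- The index of the middle block that corresponds to the last coordinate of a weight. -/
def lastIdx (n : ℕ) : Fin (2 * n + 4) := ⟨n + 1, by omega⟩

theorem val_lastIdx : (lastIdx n : ℕ) = n + 1 := rfl

theorem val_topIdx_zero : (topIdx n 0 : ℕ) = 0 := rfl

theorem val_topIdx_one : (topIdx n 1 : ℕ) = 1 := rfl

theorem topIdx_le (i : Fin 2) : (topIdx n i : ℕ) ≤ 1 := Nat.le_of_lt_succ (val_topIdx_lt i)

/-- The indices `2, …, n`. -/
def lowIdx (n : ℕ) : Finset (Fin (2 * n + 4)) :=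
  Finset.univ.filter fun a => 2 ≤ (a : ℕ) ∧ (a : ℕ) ≤ n

theorem mem_lowIdx {a : Fin (2 * n + 4)} : a ∈ lowIdx n ↔ 2 ≤ (a : ℕ) ∧ (a : ℕ) ≤ n := by
  simp [lowIdx]

/-- The difference `ξ - ν` is the weight of the lowering vector `E_{l,0}`, the leading term of the
extremal element. -/
theorem evalWeight_xi (hn : 2 ≤ n) (X : so n) : evalWeight n (xi n) X =
    evalWeight n (nu n) X + (X.1 (lastIdx n) (lastIdx n) - X.1 (topIdx n 0) (topIdx n 0)) := by
  have h : ∀ i, xi n i = nu n i + ((if i = Fin.last (n + 1) then 1 else 0) -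
      (if i = 0 then 1 else 0)) := by
    intro i
    have h0 : i = 0 ↔ (i : ℕ) = 0 := by rw [Fin.ext_iff]; rfl
    have h1 : i = Fin.last (n + 1) ↔ (i : ℕ) = n + 1 := by rw [Fin.ext_iff, Fin.val_last]
    simp only [h0, h1, xi, nu]
    by_cases hi0 : (i : ℕ) = 0
    · rw [if_pos hi0, if_pos hi0, if_neg (by omega), if_pos hi0]
      ring
    rw [if_neg hi0, if_neg hi0, if_neg hi0]
    by_cases hi1 : (i : ℕ) = 1
    · rw [if_pos hi1, if_pos hi1, if_neg (by omega)]
      ring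
    rw [if_neg hi1, if_neg hi1]
    by_cases hi2 : (i : ℕ) = n + 1
    · rw [if_pos hi2, if_pos hi2, hi2]
      push_cast
      ring
    · rw [if_neg hi2, if_neg hi2]
      ring
  have hs : ∀ (j : Fin (n + 2)), ∑ i : Fin (n + 2), (if i = j then (1 : ℂ) else 0) *
      X.1 (Fin.castLE (by omega) i) (Fin.castLE (by omega) i) =
      X.1 (Fin.castLE (by omega) j) (Fin.castLE (by omega) j) := by
    intro j
    simp
  simp only [evalWeight, h, add_mul, sub_mul, Finset.sum_add_distrib, Finset.sum_sub_distrib, hs]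
  rfl

/-! ### The extremal vector in an arbitrary representation -/

variable {M : Type*} [AddCommGroup M] [Module ℂ M] (ρ : so n →ₗ⁅ℂ⁆ Module.End ℂ M)

/-- A vector with the properties of the highest weight vector of `𝕍_ν`. -/
structure IsNuVector (m : M) : Prop where
  weight : ∀ H : so n, IsCartan n H → ρ H m = evalWeight n (nu n) H • m
  positive : ∀ X : so n, IsPositive n X → ρ X m = 0
  levi : ∀ a b : Fin (2 * n + 4), 2 ≤ (b : ℕ) → b < a → (a : ℕ) ≤ n → ρ (rootVec a b) m = 0

/-- The action of `Dᵢ⁻`. -/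
def applyD (i : Fin 2) (x : M) : M :=
  ρ (rootVec (lastIdx n) (topIdx n i)) x -
    ∑ a ∈ lowIdx n, ρ (rootVec a (topIdx n i)) (ρ (rootVec (lastIdx n) a) x)

/-- The action of `D₁⁻ + D₂⁻ Y₂₁`. -/
def extVec (m : M) : M :=
  applyD ρ 0 m + applyD ρ 1 (ρ (rootVec (topIdx n 1) (topIdx n 0)) m)

variable {ρ} {m : M}

/-- All root vectors in `Dᵢ⁻` and `Y₂₁` lie in the upper left `gl(n+2)`, where commutators have no
mirror terms. -/
theorem rep_comm_gl {a b c d : Fin (2 * n + 4)} (ha : (a : ℕ) < n + 2)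
    (hb : (b : ℕ) < n + 2) (hc : (c : ℕ) < n + 2) (hd : (d : ℕ) < n + 2) (x : M) :
    ρ (rootVec a b) (ρ (rootVec c d) x) = ρ (rootVec c d) (ρ (rootVec a b) x) +
      ((if b = c then ρ (rootVec a d) x else 0) - (if d = a then ρ (rootVec c b) x else 0)) := by
  rw [rep_comm, lie_rootVec_rootVec_gl ha hb hc hd, map_sub]
  split_ifs <;> simp

theorem apply_applyD (i : Fin 2) {c : ℂ} {H : so n} (hH : IsCartan n H) {x : M}
    (hx : ρ H x = c • x) : ρ H (applyD ρ i x) =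
      (c + (H.1 (lastIdx n) (lastIdx n) - H.1 (topIdx n i) (topIdx n i))) • applyD ρ i x := by
  rw [applyD, map_sub, map_sum, smul_sub, Finset.smul_sum]
  congr 1
  · exact apply_eigenvector (lie_rootVec_of_isCartan hH _ _) hx
  · refine Finset.sum_congr rfl fun a _ => ?_
    rw [apply_eigenvector (lie_rootVec_of_isCartan hH _ _)
      (apply_eigenvector (lie_rootVec_of_isCartan hH _ _) hx)]
    congr 1
    ring

theorem IsNuVector.extVec_weight (hn : 2 ≤ n) (hm : IsNuVector ρ m) {H : so n} (hH : IsCartan n H) :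
    ρ H (extVec ρ m) = evalWeight n (xi n) H • extVec ρ m := by
  rw [extVec, map_add, apply_applyD 0 hH (hm.weight H hH), apply_applyD 1 hH
    (apply_eigenvector (lie_rootVec_of_isCartan hH _ _) (hm.weight H hH)), smul_add,
    evalWeight_xi hn]
  congr 2
  ring

/-- The action of `Dᵢ⁻` commutes with the simple root vectors of `gl(n)`. -/
theorem rootVec_applyD {a b : Fin (2 * n + 4)} (ha : 2 ≤ (a : ℕ)) (hab : (b : ℕ) = a + 1)
    (hb : (b : ℕ) ≤ n) (i : Fin 2) {x : M} (hx : ρ (rootVec a b) x = 0) :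
    ρ (rootVec a b) (applyD ρ i x) = 0 := by
  have hi := topIdx_le (n := n) i
  have hl := val_lastIdx (n := n)
  -- The index `c = b` contributes through the first factor and `c = a` through the second: the same
  -- vector with opposite signs.
  have key : ∀ c ∈ lowIdx n, ρ (rootVec a b) (ρ (rootVec c (topIdx n i))
      (ρ (rootVec (lastIdx n) c) x)) =
      (if c = b then ρ (rootVec a (topIdx n i)) (ρ (rootVec (lastIdx n) b) x) else 0) -
      (if c = a then ρ (rootVec a (topIdx n i)) (ρ (rootVec (lastIdx n) b) x) else 0) := by
    intro c hc
    rw [mem_lowIdx] at hc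
    rw [rep_comm_gl (by omega) (by omega) (by omega) (by omega),
      rep_comm_gl (c := lastIdx n) (by omega) (by omega) (by omega) (by omega), hx, map_zero,
      zero_add,
      if_neg (c := b = lastIdx n) (by rintro rfl; omega),
      if_neg (c := topIdx n i = a) (by rintro rfl; omega)]
    have hba : b ≠ a := by rintro rfl; omega
    by_cases h1 : c = a
    · subst h1
      simp [hba, hba.symm]
    · by_cases h2 : c = b
      · subst h2
        simp [h1]
      · simp [h1, h2, Ne.symm h2]
  rw [applyD, map_sub, map_sum, Finset.sum_congr rfl key, Finset.sum_sub_distrib,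
    Finset.sum_ite_eq', Finset.sum_ite_eq', if_pos (mem_lowIdx.2 (by omega)),
    if_pos (mem_lowIdx.2 (by omega)), rep_comm_gl (by omega) (by omega) (by omega) (by omega), hx,
    if_neg (by rintro rfl; omega), if_neg (by rintro rfl; omega)]
  simp

/-- The summand `c = a` produces `E_{a,i} (E_{a,a} - E_{l,l}) x = E_{a,i} x`, which cancels the
commutator of `E_{a,l}` with `E_{l,i}`. The hypothesis `hx1` reflects the coordinates `1/2` and
`-1/2` of `ν`. -/
theorem rootVec_last_applyD (hn : 2 ≤ n) {a : Fin (2 * n + 4)} (ha : (a : ℕ) = n) (i : Fin 2)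
    {x : M} (hx : ρ (rootVec a (lastIdx n)) x = 0)
    (hx' : ∀ b : Fin (2 * n + 4), 2 ≤ (b : ℕ) → b < a → ρ (rootVec a b) x = 0)
    (hx1 : ρ (rootVec a a) x - ρ (rootVec (lastIdx n) (lastIdx n)) x = x) :
    ρ (rootVec a (lastIdx n)) (applyD ρ i x) = 0 := by
  have hi := topIdx_le (n := n) i
  have hl := val_lastIdx (n := n)
  have key : ∀ c ∈ lowIdx n, ρ (rootVec a (lastIdx n)) (ρ (rootVec c (topIdx n i))
      (ρ (rootVec (lastIdx n) c) x)) = if c = a then ρ (rootVec a (topIdx n i)) x else 0 := by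
    intro c hc
    rw [mem_lowIdx] at hc
    rw [rep_comm_gl (by omega) (by omega) (by omega) (by omega),
      rep_comm_gl (c := lastIdx n) (by omega) (by omega) (by omega) (by omega), hx, map_zero,
      zero_add,
      if_neg (c := lastIdx n = c) (by rintro rfl; omega),
      if_neg (c := topIdx n i = a) (by rintro rfl; omega), if_pos rfl, sub_zero, add_zero]
    by_cases h1 : c = a
    · subst h1
      rw [if_pos rfl, if_pos rfl, hx1]
    · have h2 : (c : ℕ) ≠ a := fun h => h1 (Fin.ext h)
      rw [if_neg h1, if_neg h1, hx' c hc.1 (Fin.lt_def.2 (by omega)), sub_zero, map_zero]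
  rw [applyD, map_sub, map_sum, Finset.sum_congr rfl key,
    Finset.sum_ite_eq', if_pos (mem_lowIdx.2 (by omega)),
    rep_comm_gl (by omega) (by omega) (by omega) (by omega), hx, if_pos rfl,
    if_neg (by rintro rfl; omega)]
  simp

theorem rootVec_spin_applyD (hn : 2 ≤ n) {a b : Fin (2 * n + 4)} (ha : (a : ℕ) = n)
    (hb : (b : ℕ) = n + 2) (i : Fin 2) {x : M} (hx : ρ (rootVec a b) x = 0) :
    ρ (rootVec a b) (applyD ρ i x) = 0 := by
  have hi := topIdx_le (n := n) i
  have hl := val_lastIdx (n := n)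
  have hbl : b = (lastIdx n).rev := Fin.ext (by rw [Fin.val_rev]; omega)
  -- The one commutator that might survive is a multiple of `E_{l,l'}`, which is zero.
  have hcomm : ∀ c d : Fin (2 * n + 4), (c : ℕ) ≤ n + 1 → (d : ℕ) ≤ n → (d = a → c = lastIdx n) →
      ⁅rootVec a b, rootVec c d⁆ = (0 : so n) := by
    intro c d hc hd hda
    rw [lie_rootVec_rootVec, if_neg (by rintro rfl; omega),
      if_neg (fun h => by have := congrArg Fin.val h; rw [Fin.val_rev] at this; omega),
      if_neg (c := d = b.rev)
        (fun h => by have := congrArg Fin.val h; rw [Fin.val_rev] at this; omega)]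
    by_cases h : d = a
    · rw [if_pos h, hda h, hbl, rootVec_self_rev]
      simp
    · rw [if_neg h]
      simp
  have hcomm' : ∀ c d : Fin (2 * n + 4), (c : ℕ) ≤ n + 1 → (d : ℕ) ≤ n →
      (d = a → c = lastIdx n) → ∀ y : M, ρ (rootVec a b) (ρ (rootVec c d) y) =
        ρ (rootVec c d) (ρ (rootVec a b) y) := by
    intro c d hc hd hda y
    rw [rep_comm, hcomm c d hc hd hda, map_zero, LinearMap.zero_apply, add_zero]
  have hia : topIdx n i ≠ a := by rintro rfl; omega
  rw [applyD, map_sub, map_sum, hcomm' _ _ (by omega) (by omega) (fun h => absurd h hia), hx,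
    map_zero, Finset.sum_eq_zero, sub_zero]
  intro c hc
  rw [mem_lowIdx] at hc
  rw [hcomm' _ _ (by omega) (by omega) (fun h => absurd h hia),
    hcomm' _ _ (by omega) (by omega) (fun _ => rfl), hx, map_zero, map_zero]

/-- `[X₁₂, D₁⁻] = -D₂⁻`, and `X₁₂` commutes with `D₂⁻`. -/
theorem rootVec_top_applyD (hn : 2 ≤ n) (i : Fin 2) {x : M}
    (hx : ρ (rootVec (topIdx n 0) (topIdx n 1)) x = 0 ∨ i = 1) :
    ρ (rootVec (topIdx n 0) (topIdx n 1)) (applyD ρ i x) =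
      if i = 0 then -applyD ρ 1 x
      else applyD ρ i (ρ (rootVec (topIdx n 0) (topIdx n 1)) x) := by
  have h0 := val_topIdx_zero (n := n)
  have h1 := val_topIdx_one (n := n)
  have hi := topIdx_le (n := n) i
  have hl := val_lastIdx (n := n)
  have hi0 : topIdx n i = topIdx n 0 ↔ i = 0 := (Fin.castLE_injective _).eq_iff
  have key : ∀ c ∈ lowIdx n, ρ (rootVec (topIdx n 0) (topIdx n 1)) (ρ (rootVec c (topIdx n i))
      (ρ (rootVec (lastIdx n) c) x)) = ρ (rootVec c (topIdx n i)) (ρ (rootVec (lastIdx n) c)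
        (ρ (rootVec (topIdx n 0) (topIdx n 1)) x)) -
      if i = 0 then ρ (rootVec c (topIdx n 1)) (ρ (rootVec (lastIdx n) c) x) else 0 := by
    intro c hc
    rw [mem_lowIdx] at hc
    rw [rep_comm_gl (by omega) (by omega) (by omega) (by omega),
      rep_comm_gl (c := lastIdx n) (by omega) (by omega) (by omega) (by omega),
      if_neg (c := topIdx n 1 = lastIdx n) (fun h => by rw [h] at h1; omega),
      if_neg (c := c = topIdx n 0) (by rintro rfl; omega),
      if_neg (c := topIdx n 1 = c) (by rintro rfl; omega)]
    simp only [hi0, sub_zero, add_zero, zero_sub]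
    exact (sub_eq_add_neg _ _).symm
  rw [applyD, map_sub, map_sum, Finset.sum_congr rfl key, Finset.sum_sub_distrib,
    rep_comm_gl (c := lastIdx n) (d := topIdx n i) (by omega) (by omega) (by omega) (by omega),
    if_neg (c := topIdx n 1 = lastIdx n) (fun h => by
      have := congrArg Fin.val h; omega)]
  simp only [hi0]
  by_cases h : i = 0
  · subst h
    rw [hx.resolve_right zero_ne_one]
    simp only [if_true, map_zero, Finset.sum_const_zero, applyD]
    abel
  · simp only [if_neg h, Finset.sum_const_zero, applyD]
    abel

theorem rootVec_mid_applyD (hn : 2 ≤ n) {t : Fin (2 * n + 4)} (ht : (t : ℕ) = 2) (i : Fin 2)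
    {x : M} (hx : ρ (rootVec (topIdx n 1) t) x = 0) :
    ρ (rootVec (topIdx n 1) t) (applyD ρ i x) =
      (if i = 1 then ∑ a ∈ lowIdx n, ρ (rootVec a t) (ρ (rootVec (lastIdx n) a) x) -
        ρ (rootVec (lastIdx n) t) x else 0) -
      ρ (rootVec (topIdx n 1) (topIdx n i)) (ρ (rootVec (lastIdx n) t) x) := by
  have h1 := val_topIdx_one (n := n)
  have hi := topIdx_le (n := n) i
  have hl := val_lastIdx (n := n)
  have hi1 : topIdx n i = topIdx n 1 ↔ i = 1 := (Fin.castLE_injective _).eq_iff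
  have key : ∀ c ∈ lowIdx n, ρ (rootVec (topIdx n 1) t) (ρ (rootVec c (topIdx n i))
      (ρ (rootVec (lastIdx n) c) x)) =
      (if t = c then ρ (rootVec (topIdx n 1) (topIdx n i)) (ρ (rootVec (lastIdx n) t) x) else 0) -
      if i = 1 then ρ (rootVec c t) (ρ (rootVec (lastIdx n) c) x) else 0 := by
    intro c hc
    rw [mem_lowIdx] at hc
    rw [rep_comm_gl (by omega) (by omega) (by omega) (by omega),
      rep_comm_gl (c := lastIdx n) (by omega) (by omega) (by omega) (by omega), hx, map_zero,
      if_neg (c := t = lastIdx n) (by rintro rfl; omega),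
      if_neg (c := c = topIdx n 1) (by rintro rfl; omega)]
    simp only [hi1, sub_zero, add_zero, map_zero, zero_add]
    by_cases h : t = c
    · subst h; rfl
    · simp only [if_neg h]
  rw [applyD, map_sub, map_sum, Finset.sum_congr rfl key, Finset.sum_sub_distrib,
    Finset.sum_ite_eq, if_pos (mem_lowIdx.2 (by omega)),
    rep_comm_gl (by omega) (by omega) (by omega) (by omega), hx, map_zero,
    if_neg (c := t = lastIdx n) (by rintro rfl; omega)]
  simp only [hi1]
  by_cases h : i = 1
  · simp only [if_pos h]
    abel
  · simp only [if_neg h, Finset.sum_const_zero]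
    abel

theorem card_lowIdx : (lowIdx n).card = n - 1 := by
  have : (lowIdx n).map Fin.valEmbedding = Finset.Icc 2 n := by
    ext k
    simp only [Finset.mem_map, Fin.valEmbedding_apply, Finset.mem_Icc]
    constructor
    · rintro ⟨a, ha, rfl⟩
      exact mem_lowIdx.1 ha
    · intro hk
      exact ⟨⟨k, by omega⟩, mem_lowIdx.2 hk, rfl⟩
  rw [← Finset.card_map Fin.valEmbedding, this, Nat.card_Icc]
  omega

theorem IsNuVector.weight_rootVec (hm : IsNuVector ρ m) {a : Fin (2 * n + 4)}
    (h : (a : ℕ) < n + 2) : ρ (rootVec a a) m = nu n ⟨a, h⟩ • m := by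
  rw [hm.weight _ (isCartan_rootVec_self a), evalWeight_rootVec_of_lt _ _ h]

theorem nu_mid {i : Fin (n + 2)} (h2 : 2 ≤ (i : ℕ)) (hi : (i : ℕ) ≤ n) : nu n i = 1 / 2 := by
  simp only [nu, delta]
  rw [if_neg (by omega), if_neg (by omega), if_neg (by omega)]
  ring

theorem nu_last (hn : 2 ≤ n) {i : Fin (n + 2)} (hi : (i : ℕ) = n + 1) : nu n i = -1 / 2 := by
  simp only [nu, delta]
  rw [if_neg (by omega), if_neg (by omega), if_pos hi, hi]
  push_cast
  ring

theorem nu_zero {i : ℕ} (hi : i = 0) (h : i < n + 2) : nu n ⟨i, h⟩ = -1 / 2 - n := by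
  simp only [nu, delta]
  rw [if_pos hi, hi]
  push_cast
  ring

theorem nu_one {i : ℕ} (hi : i = 1) (h : i < n + 2) : nu n ⟨i, h⟩ = -3 / 2 - n := by
  simp only [nu, delta]
  rw [if_neg (by omega), if_pos hi, hi]
  push_cast
  ring

/-- The operator `Y₂₁` commutes with all root vectors of `gl(n)`. -/
theorem rep_comm_top {a b : Fin (2 * n + 4)} (ha : 2 ≤ (a : ℕ)) (ha' : (a : ℕ) ≤ n + 1)
    (hb : 2 ≤ (b : ℕ)) (hb' : (b : ℕ) ≤ n + 1) (x : M) :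
    ρ (rootVec a b) (ρ (rootVec (topIdx n 1) (topIdx n 0)) x) =
      ρ (rootVec (topIdx n 1) (topIdx n 0)) (ρ (rootVec a b) x) := by
  have h0 := val_topIdx_zero (n := n)
  have h1 := val_topIdx_one (n := n)
  rw [rep_comm_gl (by omega) (by omega) (by omega) (by omega), if_neg (by rintro rfl; omega),
    if_neg (by rintro rfl; omega), sub_zero, add_zero]

/-- `X₁₂ Y₂₁ m` is `m` times the difference `1` of the first two coordinates of `ν`, so the image
`D₂⁻ m` of the second summand cancels the image `-D₂⁻ m` of the first. -/
theorem IsNuVector.rootVec_zero_one (hn : 2 ≤ n) (hm : IsNuVector ρ m) :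
    ρ (rootVec (topIdx n 0) (topIdx n 1)) (extVec ρ m) = 0 := by
  have h0 := val_topIdx_zero (n := n)
  have h1 := val_topIdx_one (n := n)
  have hx : ρ (rootVec (topIdx n 0) (topIdx n 1)) m = 0 :=
    hm.positive _ (isPositive_rootVec (Fin.lt_def.2 (by omega)))
  have hx1 : ρ (rootVec (topIdx n 0) (topIdx n 1))
      (ρ (rootVec (topIdx n 1) (topIdx n 0)) m) = m := by
    rw [rep_comm_gl (by omega) (by omega) (by omega) (by omega), hx, if_pos rfl, if_pos rfl,
      hm.weight_rootVec (by omega), hm.weight_rootVec (by omega), map_zero, zero_add, ← sub_smul,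
      nu_zero h0, nu_one h1]
    ring_nf
    exact one_smul _ _
  rw [extVec, map_add, rootVec_top_applyD hn 0 (Or.inl hx), rootVec_top_applyD hn 1 (Or.inr rfl), hx1,
    if_pos rfl, if_neg one_ne_zero, neg_add_cancel]

/-- The crossed simple root `α₂`, where the exact value of `ν` matters. Every term is a multiple of
`z = E_{l,t} Y₂₁ m`: `D₁⁻ m` gives `-1`, and `D₂⁻ Y₂₁ m` gives `-1/2 - (n - 2)` from the sum, `-1`,
and `1/2 + n` from the weight of `z`. The total is zero. -/
theorem IsNuVector.rootVec_one_two (hn : 2 ≤ n) (hm : IsNuVector ρ m) {t : Fin (2 * n + 4)}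
    (ht : (t : ℕ) = 2) : ρ (rootVec (topIdx n 1) t) (extVec ρ m) = 0 := by
  have h0 := val_topIdx_zero (n := n)
  have h1 := val_topIdx_one (n := n)
  have hl := val_lastIdx (n := n)
  have hx : ρ (rootVec (topIdx n 1) t) m = 0 :=
    hm.positive _ (isPositive_rootVec (Fin.lt_def.2 (by omega)))
  set y := ρ (rootVec (topIdx n 1) (topIdx n 0)) m with hy
  set z := ρ (rootVec (lastIdx n) t) y with hz
  have hxy : ρ (rootVec (topIdx n 1) t) y = 0 := by
    rw [hy, rep_comm_gl (by omega) (by omega) (by omega) (by omega), hx,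
      if_neg (by rintro rfl; omega), if_neg (fun h => by rw [h] at h0; omega), map_zero, sub_zero,
      add_zero]
  have hz' : ρ (rootVec (topIdx n 1) (topIdx n 0)) (ρ (rootVec (lastIdx n) t) m) = z :=
    (rep_comm_top (by omega) (by omega) (by omega) (by omega) m).symm
  have hqz : ρ (rootVec (topIdx n 1) (topIdx n 1)) z = (-1 / 2 - (n : ℂ)) • z := by
    have hqy : ρ (rootVec (topIdx n 1) (topIdx n 1)) y = (-1 / 2 - (n : ℂ)) • y := by
      rw [hy, rep_comm_gl (by omega) (by omega) (by omega) (by omega), if_pos rfl,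
        if_neg (fun h => by rw [h] at h0; omega), hm.weight_rootVec (by omega), nu_one h1,
        map_smul, ← hy]
      module
    rw [hz, rep_comm_gl (by omega) (by omega) (by omega) (by omega), hqy, map_smul,
      if_neg (fun h => by rw [h] at h1; omega), if_neg (by rintro rfl; omega), sub_zero, add_zero]
  have htz : ρ (rootVec t t) z = (-1 / 2 : ℂ) • z := by
    have hty : ρ (rootVec t t) y = (1 / 2 : ℂ) • y := by
      rw [hy, rep_comm_top (by omega) (by omega) (by omega) (by omega),
        hm.weight_rootVec (by omega), nu_mid (by simp only; omega) (by simp only; omega), map_smul]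
    rw [hz, rep_comm_gl (by omega) (by omega) (by omega) (by omega), hty, map_smul,
      if_neg (by rintro rfl; omega), if_pos rfl, ← hz]
    module
  have hsum : ∑ a ∈ lowIdx n, ρ (rootVec a t) (ρ (rootVec (lastIdx n) a) y) =
      (-1 / 2 - ((n : ℂ) - 2)) • z := by
    -- For `a > t` the vector `E_{a,t}` kills `y`, leaving the commutator `-z`; for `a = t` the
    -- weight of `z` gives `-z/2`.
    have key : ∀ a ∈ lowIdx n, ρ (rootVec a t) (ρ (rootVec (lastIdx n) a) y) =
        -z + if a = t then (1 / 2 : ℂ) • z else 0 := by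
      intro a ha
      rw [mem_lowIdx] at ha
      by_cases h : a = t
      · subst h
        rw [← hz, htz, if_pos rfl]
        module
      · have hta : (t : ℕ) < a := by
          have : (a : ℕ) ≠ t := fun h' => h (Fin.ext h')
          omega
        rw [rep_comm_gl (by omega) (by omega) (by omega) (by omega), hy,
          rep_comm_top (by omega) (by omega) (by omega) (by omega), hm.levi a t (by omega)
          (Fin.lt_def.2 hta) (by omega), map_zero, map_zero, if_neg (by rintro rfl; omega),
          if_pos rfl, if_neg h, ← hy, ← hz]
        abel
    rw [Finset.sum_congr rfl key, Finset.sum_add_distrib, Finset.sum_const, Finset.sum_ite_eq',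
      if_pos (mem_lowIdx.2 (by omega)), card_lowIdx, ← Nat.cast_smul_eq_nsmul ℂ,
      Nat.cast_sub (by omega)]
    push_cast
    module
  rw [extVec, map_add, rootVec_mid_applyD hn ht 0 hx, rootVec_mid_applyD hn ht 1 hxy,
    if_neg zero_ne_one, if_pos rfl, hsum, hz', hqz]
  module

theorem IsNuVector.extVec_positive (hn : 2 ≤ n) (hm : IsNuVector ρ m) {X : so n}
    (hX : IsPositive n X) : ρ X (extVec ρ m) = 0 := by
  have h0 := val_topIdx_zero (n := n)
  have h1 := val_topIdx_one (n := n)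
  have hl := val_lastIdx (n := n)
  let P : Submodule ℂ (so n) := LinearMap.ker
    ((LinearMap.applyₗ (extVec ρ m) : Module.End ℂ M →ₗ[ℂ] M) ∘ₗ (ρ : so n →ₗ[ℂ] Module.End ℂ M))
  have hP : ∀ Y, Y ∈ P ↔ ρ Y (extVec ρ m) = 0 := fun Y => Iff.rfl
  refine (hP X).1 (mem_of_isPositive (fun Y hY Z hZ => ?_) (fun a b hab ha => ?_)
    (fun a b ha hb => ?_) hX)
  · rw [hP] at hY hZ ⊢
    have := rep_comm ρ Y Z (extVec ρ m)
    rw [hY, hZ, map_zero, map_zero, zero_add] at this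
    exact this.symm
  · rw [hP]
    have hx : ρ (rootVec a b) m = 0 := hm.positive _ (isPositive_rootVec (Fin.lt_def.2 (by omega)))
    by_cases ha0 : (a : ℕ) = 0
    · rw [show a = topIdx n 0 from Fin.ext ha0, show b = topIdx n 1 from Fin.ext (by omega)]
      exact hm.rootVec_zero_one hn
    by_cases ha1 : (a : ℕ) = 1
    · rw [show a = topIdx n 1 from Fin.ext ha1]
      exact hm.rootVec_one_two hn (by omega)
    have hy : ρ (rootVec a b) (ρ (rootVec (topIdx n 1) (topIdx n 0)) m) = 0 := by
      rw [rep_comm_top (by omega) (by omega) (by omega) (by omega), hx, map_zero]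
    by_cases han : (a : ℕ) = n
    · have hb : b = lastIdx n := Fin.ext (by omega)
      subst hb
      have hc : ∀ c : Fin (2 * n + 4), 2 ≤ (c : ℕ) → c < a → ρ (rootVec a c) m = 0 :=
        fun c h2 hca => hm.levi a c h2 hca (by omega)
      have hw : ρ (rootVec a a) m - ρ (rootVec (lastIdx n) (lastIdx n)) m = m := by
        rw [hm.weight_rootVec (by omega), hm.weight_rootVec (by omega),
          nu_mid (by simp only; omega) (by simp only; omega), nu_last hn (by simp only; omega)]
        module
      rw [extVec, map_add, rootVec_last_applyD hn han 0 hx hc hw,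
        rootVec_last_applyD hn han 1 hy, add_zero]
      · intro c h2 hca
        have : (c : ℕ) < a := hca
        rw [rep_comm_top (by omega) (by omega) (by omega) (by omega), hc c h2 hca, map_zero]
      · rw [rep_comm_top (by omega) (by omega) (by omega) (by omega),
          rep_comm_top (by omega) (by omega) (by omega) (by omega), ← map_sub, hw]
    · rw [extVec, map_add, rootVec_applyD (by omega) hab (by omega) 0 hx,
        rootVec_applyD (by omega) hab (by omega) 1 hy, add_zero]
  · rw [hP]
    have hx : ρ (rootVec a b) m = 0 := hm.positive _ (isPositive_rootVec (Fin.lt_def.2 (by omega)))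
    have hy : ρ (rootVec a b) (ρ (rootVec (topIdx n 1) (topIdx n 0)) m) = 0 := by
      rw [rep_comm, hx, lie_rootVec_rootVec, if_neg (fun h => by rw [h] at hb; omega),
        if_neg (fun h => by
          have := congrArg Fin.val h; rw [Fin.val_rev] at this; omega),
        if_neg (by rintro rfl; omega), if_neg (fun h => by
          have := congrArg Fin.val h; rw [Fin.val_rev] at this; omega)]
      simp
    rw [extVec, map_add, rootVec_spin_applyD hn ha hb 0 hx, rootVec_spin_applyD hn ha hb 1 hy,
      add_zero]

end Extremal

/-! ### Homomorphisms between the generalized Verma modules -/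

section Hom

variable {n : ℕ} {V : Type*} [AddCommGroup V] [Module ℂ V] [LieRingModule (parabolic n) V]
  [LieModule ℂ (parabolic n) V] {v : V}

theorem IsPositive.mem_parabolic {X : so n} (hX : IsPositive n X) : X ∈ parabolic n :=
  fun a b h => hX a b (le_of_lt (lt_of_not_ge fun h' => absurd (block_mono h') (not_le.2 h)))

theorem isNuVector_vone (hv : IsHighestWeightModule n (nu n) v) :
    IsNuVector (vermaRep n V) (vone n v) where
  weight H hH := by
    rw [vermaRep_apply, inc_smul_vone ⟨H, hH.mem_parabolic⟩, hv.weight _ hH, map_smul]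
  positive X hX := by
    rw [vermaRep_apply, inc_smul_vone ⟨X, hX.mem_parabolic⟩, hv.positive _ hX, map_zero]
  levi a b hb hba ha := by
    have hba : (b : ℕ) < a := hba
    have hblock : block n b = block n a := by
      unfold block
      split_ifs <;> omega
    have := hv.finiteDimensional
    -- The coordinates `2, …, n` of `ν` all equal `1/2`, so the root string through `v` has length
    -- zero and the negative root vector kills `v` as well.
    obtain ⟨k, hk, hk0⟩ := exists_nat_of_parVec (ρ := LieModule.toEnd ℂ (parabolic n) V) (K := ⊤)
      (fun _ _ _ => Submodule.mem_top) (x := v) Submodule.mem_top hv.ne_zero hv.weight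
      (a := b) (b := a) (by rintro rfl; omega)
      (fun h => by have := congrArg Fin.val h; rw [Fin.val_rev] at this; omega) hblock
      (hv.positive _ (isPositive_rootVec (Fin.lt_def.2 hba)))
    rw [evalWeight_sub, evalWeight_rootVec_of_lt _ _ (by omega),
      evalWeight_rootVec_of_lt _ _ (by omega), nu_mid (by simp only; omega) (by simp only; omega),
      nu_mid (by simp only; omega) (by simp only; omega), sub_self] at hk
    have h0 := hk0 (Nat.cast_eq_zero.1 hk.symm)
    have h1 : ⁅parVec a b hblock.ge, v⁆ = 0 := h0
    rw [vermaRep_apply]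
    change inc n (parVec a b hblock.ge).1 • _ = _
    rw [inc_smul_vone, h1, map_zero]

theorem Dminus_eq (i : Fin 2) : Dminus n (i + 1) = inc n (rootVec (lastIdx n) (topIdx n i)) -
    ∑ a ∈ lowIdx n, inc n (rootVec a (topIdx n i)) * inc n (rootVec (lastIdx n) a) := by
  rw [Dminus]
  congr 1
  · exact congrArg _ (gen_eq_rootVec (lastIdx n) (topIdx n i))
  · symm
    refine Finset.sum_nbij (fun a => (a : ℕ) + 1) (fun a ha => ?_) (fun a _ b _ h => ?_)
      (fun k hk => ?_) (fun a _ => ?_)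
    · rw [mem_lowIdx] at ha
      exact Finset.mem_Icc.2 (by omega)
    · exact Fin.ext (Nat.succ_injective h)
    · have hk := Finset.mem_Icc.1 (Finset.mem_coe.1 hk)
      refine ⟨⟨k - 1, by omega⟩, Finset.mem_coe.2 (mem_lowIdx.2 ?_), ?_⟩
      · simp only; omega
      · simp only; omega
    · rw [← gen_eq_rootVec, ← gen_eq_rootVec]
      rfl

omit [LieModule ℂ (parabolic n) V] in
theorem Dminus_smul (i : Fin 2) (m : Verma n V) :
    Dminus n (i + 1) • m = applyD (vermaRep n V) i m := by
  rw [Dminus_eq, sub_smul, Finset.sum_smul]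
  simp only [mul_smul]
  rfl

omit [LieModule ℂ (parabolic n) V] in
theorem vtmul_extremalElement (x : V) :
    vtmul n (extremalElement n) x = extVec (vermaRep n V) (vone n x) := by
  have h : gen n 2 1 = (rootVec (topIdx n 1) (topIdx n 0) : so n) :=
    gen_eq_rootVec (topIdx n 1) (topIdx n 0)
  rw [← smul_vone, extremalElement, add_smul, mul_smul, h, extVec]
  exact congrArg₂ _ (Dminus_smul 0 _) (Dminus_smul 1 _)

/-! ### Leading coefficients and the existence of the homomorphism -/

theorem topIdx_injective : Function.Injective (topIdx n) :=
  fun _ _ h => Fin.castLE_injective _ h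

theorem block_lastIdx (hn : 2 ≤ n) : block n (lastIdx n) = 1 := by
  unfold block
  rw [val_lastIdx, if_neg (by omega), if_pos (by omega)]

theorem block_of_mem_lowIdx {a : Fin (2 * n + 4)} (ha : a ∈ lowIdx n) : block n a = 1 := by
  rw [mem_lowIdx] at ha
  unfold block
  rw [if_neg (by omega), if_pos (by omega)]

theorem extVec_sub_mem {M : Type*} [AddCommGroup M] [Module ℂ M]
    {ρ : so n →ₗ⁅ℂ⁆ Module.End ℂ M} {P : Submodule ℂ M} {m : M}
    (h : ρ (rootVec (lastIdx n) (topIdx n 1))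
      (ρ (rootVec (topIdx n 1) (topIdx n 0)) m) ∈ P)
    (h0 : ∑ a ∈ lowIdx n, ρ (rootVec a (topIdx n 0)) (ρ (rootVec (lastIdx n) a) m) ∈ P)
    (h1 : ∑ a ∈ lowIdx n, ρ (rootVec a (topIdx n 1)) (ρ (rootVec (lastIdx n) a)
      (ρ (rootVec (topIdx n 1) (topIdx n 0)) m)) ∈ P) :
    extVec ρ m - ρ (rootVec (lastIdx n) (topIdx n 0)) m ∈ P := by
  rw [extVec, applyD, applyD, sub_add_eq_add_sub, sub_right_comm, add_sub_cancel_left]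
  exact P.sub_mem (P.sub_mem h h1) h0

omit [LieModule ℂ (parabolic n) V] in
-- The factors `E_{l,a}` and `Y₂₁` lie in `𝔭` and move into `V`. What remains on the left is
-- `E_{l,0}`, exactly once and with coefficient `x`, and root vectors at other positions; `Q`
-- collects the coefficient families vanishing at `(l, 0)`.
theorem exists_extVec_eq_lowSum (hn : 2 ≤ n) (x : V) : ∃ w, extVec (vermaRep n V) (vone n x) =
    lowSum n V w ∧ w (lastIdx n) 0 = x := by
  let Q : Submodule ℂ (Fin (2 * n + 4) → Fin 2 → V) :=
    LinearMap.ker (LinearMap.proj 0 ∘ₗ LinearMap.proj (lastIdx n))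
  have hQ : ∀ (a : Fin (2 * n + 4)) (i : Fin 2) (y : V), block n a = 1 →
      (a ≠ lastIdx n ∨ i ≠ 0) →
      vermaRep n V (rootVec a (topIdx n i)) (vone n y) ∈ Q.map (lowSum n V) := by
    intro a i y ha h
    refine ⟨Pi.single a (Pi.single i y), ?_, lowSum_single ha i y⟩
    change (Pi.single a (Pi.single i y) : Fin (2 * n + 4) → Fin 2 → V) (lastIdx n) 0 = 0
    by_cases h1 : a = lastIdx n
    · subst h1
      rw [Pi.single_eq_same, Pi.single_eq_of_ne (h.resolve_left fun h => h rfl).symm]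
    · rw [Pi.single_eq_of_ne (Ne.symm h1), Pi.zero_apply]
  have hblock : ∀ a : Fin (2 * n + 4), block n a = 1 → block n (lastIdx n) ≤ block n a :=
    fun a ha => by rw [ha, block_lastIdx hn]
  have hs : ∀ (i : Fin 2) (y : V), ∑ a ∈ lowIdx n, vermaRep n V (rootVec a (topIdx n i))
      (vermaRep n V (rootVec (lastIdx n) a) (vone n y)) ∈ Q.map (lowSum n V) := by
    intro i y
    refine Submodule.sum_mem _ fun a ha => ?_
    have h1 : vermaRep n V (rootVec (lastIdx n) a) (vone n y) = vone n ⁅parVec (lastIdx n) a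
        (hblock a (block_of_mem_lowIdx ha)), y⁆ := inc_smul_vone (parVec _ _ _) y
    rw [h1]
    refine hQ _ _ _ (block_of_mem_lowIdx ha) (Or.inl fun h => ?_)
    rw [mem_lowIdx, h, val_lastIdx] at ha
    omega
  have h1 : vermaRep n V (rootVec (topIdx n 1) (topIdx n 0)) (vone n x) =
      vone n ⁅parVec (topIdx n 1) (topIdx n 0) (by rw [block_topIdx, block_topIdx]), x⁆ :=
    inc_smul_vone (parVec _ _ _) x
  have h2 : extVec (vermaRep n V) (vone n x) -
      lowSum n V (Pi.single (lastIdx n) (Pi.single 0 x)) ∈ Q.map (lowSum n V) := by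
    have h3 : lowSum n V (Pi.single (lastIdx n) (Pi.single 0 x)) =
        vermaRep n V (rootVec (lastIdx n) (topIdx n 0)) (vone n x) :=
      lowSum_single (block_lastIdx hn) 0 x
    have p1 := hQ (lastIdx n) 1 ⁅parVec (topIdx n 1) (topIdx n 0)
      (by rw [block_topIdx, block_topIdx]), x⁆ (block_lastIdx hn) (Or.inr one_ne_zero)
    have p2 := hs 1 ⁅parVec (topIdx n 1) (topIdx n 0) (by rw [block_topIdx, block_topIdx]), x⁆
    rw [← h1] at p1 p2
    rw [h3]
    exact extVec_sub_mem p1 (hs 0 x) p2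
  obtain ⟨w, hw, hw'⟩ := h2
  refine ⟨w + Pi.single (lastIdx n) (Pi.single 0 x), ?_, ?_⟩
  · rw [map_add, hw', sub_add_cancel]
  · have hw : w (lastIdx n) 0 = 0 := hw
    rw [Pi.add_apply, Pi.add_apply, hw, Pi.single_eq_same, Pi.single_eq_same, zero_add]

theorem lowSum_eq_zero (hn : 2 ≤ n) (hv : IsHighestWeightModule n (nu n) v)
    {w : Fin (2 * n + 4) → Fin 2 → V} (hw : lowSum n V w = 0) {a : Fin (2 * n + 4)}
    (ha : block n a = 1) (i : Fin 2) : w a i = 0 := by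
  rw [lowSum_apply] at hw
  exact eq_zero_of_sum_vone_eq_zero hn hv w hw (mem_midIdx.2 ha) i

theorem isExtremal_extremalElement (hn : 2 ≤ n) (hv : IsHighestWeightModule n (nu n) v) :
    IsExtremal n (xi n) (vtmul n (extremalElement n) v) := by
  rw [vtmul_extremalElement]
  refine ⟨fun h => ?_, fun X hX => (isNuVector_vone hv).extVec_weight hn hX,
    fun X hX => (isNuVector_vone hv).extVec_positive hn hX⟩
  -- If the vector were zero, then so would be its leading coefficient `v`.
  obtain ⟨w, hw, hw'⟩ := exists_extVec_eq_lowSum hn v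
  rw [h] at hw
  exact hv.ne_zero (hw'.symm.trans (lowSum_eq_zero hn hv hw.symm (block_lastIdx hn) 0))

variable (n V) in
/-- The span of the elements `1 ⊗ x` and `X ⊗ x` with `X` in the Lie algebra. -/
noncomputable def degLeOne : Submodule ℂ (Verma n V) :=
  LinearMap.range (vone n) ⊔
    Submodule.map₂ (vermaRep n V : so n →ₗ[ℂ] Module.End ℂ (Verma n V)) ⊤
      (LinearMap.range (vone n))

omit [LieModule ℂ (parabolic n) V] in
theorem finiteDimensional_degLeOne [FiniteDimensional ℂ V] :
    FiniteDimensional ℂ (degLeOne n V) := by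
  have h1 : (LinearMap.range (vone n : V →ₗ[ℂ] Verma n V)).FG := by
    rw [LinearMap.range_eq_map]
    exact (Module.Finite.fg_top (R := ℂ) (M := V)).map _
  have : FiniteDimensional ℂ (so n) :=
    inferInstanceAs (FiniteDimensional ℂ (so n).toSubmodule)
  have h2 : (⊤ : Submodule ℂ (so n)).FG := Module.Finite.fg_top
  exact Module.Finite.iff_fg.2 (h1.sup (h2.map₂ _ h1))

omit [LieModule ℂ (parabolic n) V] in
theorem vermaRep_vone_mem_degLeOne (Y : so n) (x : V) :
    vermaRep n V Y (vone n x) ∈ degLeOne n V :=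
  Submodule.mem_sup_right (Submodule.apply_mem_map₂ _ Submodule.mem_top ⟨x, rfl⟩)

omit [LieModule ℂ (parabolic n) V] in
-- `X Y ⊗ x = Y ⊗ X x + [X, Y] ⊗ x`. The point is a finite-dimensional `𝔭`-submodule containing the
-- extremal vector, to which `exists_hom` applies.
theorem vermaRep_mem_degLeOne (X : parabolic n) {m : Verma n V} (hm : m ∈ degLeOne n V) :
    vermaRep n V X.1 m ∈ degLeOne n V := by
  have : degLeOne n V ≤ (degLeOne n V).comap (vermaRep n V X.1) := by
    refine sup_le ?_ (Submodule.map₂_le.2 ?_)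
    · rintro _ ⟨x, rfl⟩
      exact vermaRep_vone_mem_degLeOne X.1 x
    · rintro Y - _ ⟨x, rfl⟩
      change vermaRep n V X.1 (vermaRep n V Y (vone n x)) ∈ degLeOne n V
      rw [rep_comm, vermaRep_apply X.1, inc_smul_vone]
      exact Submodule.add_mem _ (vermaRep_vone_mem_degLeOne _ _) (vermaRep_vone_mem_degLeOne _ _)
  exact this hm

omit [LieModule ℂ (parabolic n) V] in
theorem lowSum_mem_degLeOne (w : Fin (2 * n + 4) → Fin 2 → V) : lowSum n V w ∈ degLeOne n V := by
  rw [lowSum_apply]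
  exact Submodule.sum_mem _ fun a _ => Submodule.sum_mem _ fun i _ =>
    vermaRep_vone_mem_degLeOne _ _

/-- `ξ` is minuscule, so `W` maps to the finite-dimensional `𝔭`-module `degLeOne` with the highest
weight vector going to the extremal vector; Frobenius reciprocity extends this map. -/
theorem exists_hom_extVec (hn : 2 ≤ n) (hv : IsHighestWeightModule n (nu n) v)
    {W : Type*} [AddCommGroup W] [Module ℂ W] [LieRingModule (parabolic n) W]
    [LieModule ℂ (parabolic n) W] {w : W} (hw : IsHighestWeightModule n (xi n) w) :
    ∃ φ : Verma n W →ₗ[U n] Verma n V,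
      ∀ u : U n, φ (vtmul n u w) = u • extVec (vermaRep n V) (vone n v) := by
  have := hv.finiteDimensional
  have := finiteDimensional_degLeOne (n := n) (V := V)
  have hm := isNuVector_vone hv
  obtain ⟨e, he, -⟩ := exists_extVec_eq_lowSum hn v
  have hmem : extVec (vermaRep n V) (vone n v) ∈ degLeOne n V := he ▸ lowSum_mem_degLeOne e
  let ρ := (vermaRep n V).comp (parabolic n).incl
  have hF : ∀ X, ∀ x ∈ degLeOne n V, ρ X x ∈ degLeOne n V := fun X x hx =>
    vermaRep_mem_degLeOne X hx
  have hu : IsSingular n (xi n) (restrictRep ρ (degLeOne n V) hF) ⟨_, hmem⟩ :=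
    ⟨fun X hX => Subtype.ext (hm.extVec_weight hn hX),
      fun X hX => Subtype.ext (hm.extVec_positive hn hX)⟩
  obtain ⟨ψ, hψ, hψw⟩ := hw.exists_hom hn (xi_isMinuscule hn) _ hu
  obtain ⟨φ, hφ⟩ := exists_vermaLift ((degLeOne n V).subtype ∘ₗ ψ)
    (fun X x => congrArg Subtype.val (hψ X x))
  refine ⟨φ, fun u => ?_⟩
  rw [hφ, LinearMap.comp_apply, hψw]
  rfl

/-! ### Uniqueness of the extremal vector and of the homomorphism -/

theorem exists_weight (ℓ : so n →ₗ[ℂ] ℂ) :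
    ∃ μ, ∀ H : so n, IsCartan n H → evalWeight n μ H = ℓ H := by
  refine ⟨fun j => ℓ (torus (Pi.single j 1)), fun H hH => ?_⟩
  rw [hH.eq_torus, evalWeight_torus, torus_eq_sum, map_sum]
  exact Finset.sum_congr rfl fun i _ => by rw [map_smul, smul_eq_mul, mul_comm]

/-- A diagonal entry as a linear form. -/
def entryForm (a : Fin (2 * n + 4)) : so n →ₗ[ℂ] ℂ where
  toFun X := X.1 a a
  map_add' _ _ := rfl
  map_smul' _ _ := rfl

theorem exists_shifted_weight (χ : Fin (n + 2) → ℂ) (a b : Fin (2 * n + 4)) :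
    ∃ μ, ∀ H : so n, IsCartan n H → evalWeight n μ H = evalWeight n χ H - H.1 a a + H.1 b b := by
  obtain ⟨μ, hμ⟩ := exists_weight ((∑ i : Fin (n + 2), χ i • entryForm (Fin.castLE (by omega) i)) -
    entryForm a + entryForm b : so n →ₗ[ℂ] ℂ)
  refine ⟨μ, fun H hH => ?_⟩
  rw [hμ H hH, LinearMap.add_apply, LinearMap.sub_apply, LinearMap.sum_apply]
  rfl

/-- By uniqueness of the coefficients, an eigenvector equation in degree `-1` can be read off
coefficient by coefficient. -/
theorem lie_lowSum_coeff (hn : 2 ≤ n) (hv : IsHighestWeightModule n (nu n) v) {X : parabolic n}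
    (hX : ∀ a b, block n a ≠ block n b → X.1.1 a b = 0) {w : Fin (2 * n + 4) → Fin 2 → V} {c : ℂ}
    (h : inc n X.1 • lowSum n V w = c • lowSum n V w) {a : Fin (2 * n + 4)} (ha : block n a = 1)
    (i : Fin 2) : ⁅X, w a i⁆ = c • w a i - ∑ b ∈ midIdx n, X.1.1 a b • w b i +
      ∑ j, X.1.1 (topIdx n j) (topIdx n i) • w a j := by
  rw [inc_smul_lowSum hX, ← map_smul, ← sub_eq_zero, ← map_sub] at h
  have := lowSum_eq_zero hn hv h ha i
  simp only [Pi.sub_apply, Pi.smul_apply] at this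
  rw [← sub_eq_zero, ← this]
  abel

theorem lie_lowSum_coeff_of_isCartan (hn : 2 ≤ n) (hv : IsHighestWeightModule n (nu n) v)
    {H : parabolic n} (hH : IsCartan n H.1) {w : Fin (2 * n + 4) → Fin 2 → V} {c : ℂ}
    (h : inc n H.1 • lowSum n V w = c • lowSum n V w) {a : Fin (2 * n + 4)} (ha : block n a = 1)
    (i : Fin 2) :
    ⁅H, w a i⁆ = (c - H.1.1 a a + H.1.1 (topIdx n i) (topIdx n i)) • w a i := by
  rw [lie_lowSum_coeff hn hv (fun a b hab => hH a b (by rintro rfl; exact hab rfl)) h ha,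
    Finset.sum_eq_single a, Finset.sum_eq_single i, add_smul, sub_smul]
  · intro j _ hj
    rw [hH _ _ (fun h => hj (topIdx_injective h)), zero_smul]
  · simp
  · intro b _ hb
    rw [hH _ _ hb.symm, zero_smul]
  · exact fun h => absurd (mem_midIdx.2 ha) h

/-- A singular vector of degree `-1` whose leading coefficient vanishes is zero. -/
theorem lowSum_eq_zero_of_isSingular (hn : 2 ≤ n) (hv : IsHighestWeightModule n (nu n) v)
    {w : Fin (2 * n + 4) → Fin 2 → V}
    (hH : ∀ H : so n, IsCartan n H →
      inc n H • lowSum n V w = evalWeight n (xi n) H • lowSum n V w)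
    (hP : ∀ X : so n, IsPositive n X → inc n X • lowSum n V w = 0)
    (hw : w (lastIdx n) 0 = 0) : lowSum n V w = 0 := by
  classical
  have hl := val_lastIdx (n := n)
  let s : Finset (Fin (2 * n + 4) × Fin 2) := Finset.univ.filter fun p =>
    block n p.1 = 1 ∧ w p.1 p.2 ≠ 0
  have hs : ∀ p, p ∈ s ↔ block n p.1 = 1 ∧ w p.1 p.2 ≠ 0 := by simp [s]
  rcases s.eq_empty_or_nonempty with h | h
  · rw [lowSum_apply]
    refine Finset.sum_eq_zero fun a ha => Finset.sum_eq_zero fun i _ => ?_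
    have : w a i = 0 := by
      by_contra h'
      have := (hs (a, i)).2 ⟨mem_midIdx.1 ha, h'⟩
      rw [h] at this
      exact absurd this (Finset.notMem_empty _)
    rw [this, map_zero, smul_zero]
  exfalso
  -- The order is chosen so that positive Levi root vectors relate the coefficient at `(a, i)` only
  -- to those at `(d, i)` with `d > a` and `(a, j)` with `j < i`. All of these vanish for a maximal
  -- position, so this coefficient is singular in `V`.
  obtain ⟨⟨a, i⟩, hai, hmax⟩ := s.exists_max_image (fun p => ((p.1 : ℕ) : ℤ) - (p.2 : ℕ)) h
  obtain ⟨ha, hne⟩ := (hs (a, i)).1 hai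
  simp only at ha hne hmax
  have hlevi : ∀ (b c : Fin (2 * n + 4)) (hbc : block n b = block n c), b < c →
      ⁅parVec b c hbc.le, w a i⁆ = 0 := by
    intro b c hbc hlt
    have hpos := isPositive_rootVec hlt
    have hX : ∀ p q, block n p ≠ block n q → (parVec b c hbc.le).1.1 p q = 0 := by
      intro p q hpq
      change (rootVec b c).1 p q = 0
      rw [rootVec_apply, if_neg, if_neg, sub_zero]
      · rintro ⟨rfl, rfl⟩
        rw [block_rev, block_rev, hbc] at hpq
        exact hpq rfl
      · rintro ⟨rfl, rfl⟩
        exact hpq hbc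
    rw [lie_lowSum_coeff hn hv hX (c := 0) ((hP _ hpos).trans (zero_smul _ _).symm) ha,
      Finset.sum_eq_zero, Finset.sum_eq_zero, zero_smul, sub_zero, add_zero]
    · intro j _
      by_cases hj : j < i
      · have : w a j = 0 := by
          by_contra h'
          have h1 := hmax (a, j) ((hs (a, j)).2 ⟨ha, h'⟩)
          have hj : (j : ℕ) < i := hj
          simp only at h1
          omega
        rw [this, smul_zero]
      · rw [show (parVec b c hbc.le).1.1 (topIdx n j) (topIdx n i) = 0 from
          hpos _ _ (Fin.le_def.2 (not_lt.1 hj)), zero_smul]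
    · intro d hd
      by_cases hda : a < d
      · have : w d i = 0 := by
          by_contra h'
          have h1 := hmax (d, i) ((hs (d, i)).2 ⟨mem_midIdx.1 hd, h'⟩)
          have hda : (a : ℕ) < d := hda
          simp only at h1
          omega
        rw [this, smul_zero]
      · rw [show (parVec b c hbc.le).1.1 a d = 0 from hpos _ _ (not_lt.1 hda), zero_smul]
  obtain ⟨μ, hμ⟩ := exists_shifted_weight (xi n) a (topIdx n i)
  have hwt : ∀ H : parabolic n, IsCartan n H.1 → ⁅H, w a i⁆ = evalWeight n μ H.1 • w a i := by
    intro H hHc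
    rw [hμ _ hHc, lie_lowSum_coeff_of_isCartan hn hv hHc (hH _ hHc) ha]
  have hsing : IsSingular n μ (LieModule.toEnd ℂ (parabolic n) V) (w a i) := by
    refine ⟨hwt, fun X hX => ?_⟩
    let K : Submodule ℂ (parabolic n) := LinearMap.ker
      ((LinearMap.applyₗ (w a i) : Module.End ℂ V →ₗ[ℂ] V) ∘ₗ
        (LieModule.toEnd ℂ (parabolic n) V : parabolic n →ₗ[ℂ] Module.End ℂ V))
    have h1 : X.1 ∈ K.map (parabolic n).toSubmodule.subtype := by
      refine so_mem_of_forall_rootVec fun b c hbc => ?_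
      have hlt : b < c := not_le.1 fun h => hbc (hX b c h)
      refine ⟨parVec b c (block_mono hlt.le), ?_, rfl⟩
      by_cases hb : block n b = block n c
      · exact hlevi b c hb hlt
      · refine hv.lie_eq_zero (fun p q hpq => ?_) (w a i)
        change (rootVec b c).1 p q = 0
        rw [rootVec_apply, if_neg, if_neg, sub_zero]
        · rintro ⟨rfl, rfl⟩
          rw [block_rev, block_rev] at hpq
          have := block_le_two b
          have := block_le_two c
          omega
        · rintro ⟨rfl, rfl⟩
          exact hb hpq
    obtain ⟨Y, hY, hYX⟩ := h1
    have : Y = X := Subtype.ext hYX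
    rw [← this]
    exact hY
  obtain ⟨d, hd⟩ := Submodule.mem_span_singleton.1 (hv.mem_span_of_isSingular hsing)
  -- Being a multiple of `v`, the coefficient has weight `ν`; hence `E_{a,i}` has the same weight `ξ
  -- - ν` as `E_{l,0}`. Evaluating on the coordinates `l` and `0` then identifies `(a, i)` with `(l,
  -- 0)`.
  have hnu : ∀ H : so n, IsCartan n H → H.1 (lastIdx n) (lastIdx n) -
      H.1 (topIdx n 0) (topIdx n 0) = H.1 a a - H.1 (topIdx n i) (topIdx n i) := by
    intro H hHc
    have h1 := hwt ⟨H, hHc.mem_parabolic⟩ hHc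
    have h2 : ⁅(⟨H, hHc.mem_parabolic⟩ : parabolic n), w a i⁆ = evalWeight n (nu n) H • w a i := by
      rw [← hd, lie_smul, hv.weight _ hHc, smul_comm]
    have h3 := smul_left_injective ℂ hne (h2.symm.trans h1)
    simp only [hμ H hHc, evalWeight_xi hn] at h3
    linear_combination -h3
  have hi := topIdx_le (n := n) i
  have h0 := val_topIdx_zero (n := n)
  have e1 := hnu _ (isCartan_rootVec_self (lastIdx n))
  have e2 := hnu _ (isCartan_rootVec_self (topIdx n 0))
  have ham : 2 ≤ (a : ℕ) ∧ (a : ℕ) < 2 * n + 2 := by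
    unfold block at ha
    split_ifs at ha <;> omega
  have hne1 : ∀ b c : Fin (2 * n + 4), (b : ℕ) ≠ c → b ≠ c := fun b c h h' => h (by rw [h'])
  rw [rootVec_self_apply, rootVec_self_apply, rootVec_self_apply, rootVec_self_apply, if_pos rfl,
    if_neg (rev_ne_self _).symm, if_neg (hne1 _ _ (by omega)),
    if_neg (hne1 _ _ (by rw [Fin.val_rev]; omega)),
    if_neg (c := topIdx n i = lastIdx n) (hne1 _ _ (by omega)),
    if_neg (c := topIdx n i = (lastIdx n).rev) (hne1 _ _ (by rw [Fin.val_rev]; omega))] at e1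
  rw [rootVec_self_apply, rootVec_self_apply, rootVec_self_apply, rootVec_self_apply, if_pos rfl,
    if_neg (c := topIdx n 0 = (topIdx n 0).rev) (rev_ne_self _).symm,
    if_neg (hne1 _ _ (by omega)),
    if_neg (hne1 _ _ (by rw [Fin.val_rev]; omega)),
    if_neg (c := a = topIdx n 0) (hne1 _ _ (by omega)),
    if_neg (c := a = (topIdx n 0).rev) (hne1 _ _ (by rw [Fin.val_rev]; omega)),
    if_neg (c := topIdx n i = (topIdx n 0).rev) (hne1 _ _ (by rw [Fin.val_rev]; omega))] at e2
  have ha' : a = lastIdx n := by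
    by_contra h'
    rw [if_neg h'] at e1
    split_ifs at e1 <;> norm_num at e1
  have hi' : i = 0 := by
    by_contra h'
    rw [if_neg (fun h => h' (topIdx_injective h))] at e2
    norm_num at e2
  rw [ha', hi'] at hne
  exact hne hw

/-- The extremal vectors of weight `ξ` form a line. -/
theorem exists_eq_smul_extVec (hn : 2 ≤ n) (hv : IsHighestWeightModule n (nu n) v) {m : Verma n V}
    (hH : ∀ H : so n, IsCartan n H → inc n H • m = evalWeight n (xi n) H • m)
    (hP : ∀ X : so n, IsPositive n X → inc n X • m = 0) :
    ∃ c : ℂ, m = c • extVec (vermaRep n V) (vone n v) := by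
  have hdeg : evalWeight n (xi n) (degEl n).1 = evalWeight n (nu n) (degEl n).1 - 1 := by
    rw [evalWeight_xi hn, degEl_apply, degEl_apply, block_lastIdx hn, block_topIdx]
    push_cast
    ring
  obtain ⟨w, rfl⟩ := hv.exists_lowSum (m := m) (by
    rw [vermaRep_apply, hH _ isCartan_degEl, hdeg])
  obtain ⟨e, he, he0⟩ := exists_extVec_eq_lowSum hn v
  have hm := isNuVector_vone hv
  -- The coefficient at `(l, 0)` has weight `ν`, so comparing heights shows it to be a multiple of
  -- `v`; that multiple of the extremal vector is then subtracted.
  have h1 : w (lastIdx n) 0 ∈ Submodule.span ℂ {v} := by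
    refine hv.isSingular.mem_span_of_height ?_ ?_
    · rw [hv.cyclicSpan_eq_top hv.ne_zero hv.isSingular]
      exact Submodule.mem_top
    · refine (lie_lowSum_coeff_of_isCartan hn hv isCartan_heightEl (hH _ isCartan_heightEl)
        (block_lastIdx hn) 0).trans ?_
      rw [evalWeight_xi hn]
      congr 1
      ring
  obtain ⟨c, hc⟩ := Submodule.mem_span_singleton.1 h1
  refine ⟨c, ?_⟩
  have h2 : lowSum n V (w - c • e) = lowSum n V w - c • extVec (vermaRep n V) (vone n v) := by
    rw [map_sub, map_smul, he]
  have h3 : lowSum n V (w - c • e) = 0 := by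
    refine lowSum_eq_zero_of_isSingular hn hv (fun H hHc => ?_) (fun X hX => ?_) ?_
    · rw [h2, smul_sub, hH H hHc, smul_comm, ← vermaRep_apply, hm.extVec_weight hn hHc, smul_sub,
        smul_comm c]
    · rw [h2, smul_sub, hP X hX, smul_comm, ← vermaRep_apply, hm.extVec_positive hn hX, smul_zero,
        sub_zero]
    · rw [Pi.sub_apply, Pi.sub_apply, Pi.smul_apply, Pi.smul_apply, he0, hc, sub_self]
  rw [h2] at h3
  exact sub_eq_zero.1 h3

/-- The image of `1 ⊗ w` is singular of weight `ξ`, hence a multiple `c` of the extremal vector. The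
`x` in `W` for which `f` and `c φ` agree on `1 ⊗ x` form a `𝔭`-submodule containing `w`, which is
all of `W`. -/
theorem exists_eq_smul_hom (hn : 2 ≤ n) (hv : IsHighestWeightModule n (nu n) v)
    {W : Type*} [AddCommGroup W] [Module ℂ W] [LieRingModule (parabolic n) W]
    [LieModule ℂ (parabolic n) W] {w : W} (hw : IsHighestWeightModule n (xi n) w)
    {φ : Verma n W →ₗ[U n] Verma n V} (hφ : φ (vone n w) = extVec (vermaRep n V) (vone n v))
    (f : Verma n W →ₗ[U n] Verma n V) : ∃ c : ℂ, ∀ m, f m = c • φ m := by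
  have hsmul : ∀ (X : parabolic n) (g : Verma n W →ₗ[U n] Verma n V) (x : W),
      g (vone n ⁅X, x⁆) = inc n X.1 • g (vone n x) := by
    intro X g x
    rw [← inc_smul_vone, map_smul]
  obtain ⟨c, hc⟩ := exists_eq_smul_extVec hn hv (m := f (vone n w))
    (fun H hH => by
      rw [← hsmul ⟨H, hH.mem_parabolic⟩, hw.weight _ hH, map_smul]
      exact f.map_smul_of_tower _ _)
    (fun X hX => by
      rw [← hsmul ⟨X, hX.mem_parabolic⟩, hw.positive _ hX, map_zero, map_zero])
  let N : Submodule ℂ W := LinearMap.eqLocus (f.restrictScalars ℂ ∘ₗ vone n)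
    (c • (φ.restrictScalars ℂ ∘ₗ vone n))
  have hN : N = ⊤ := by
    refine hw.eq_top (fun X x hx => ?_) (x := w) ?_ hw.ne_zero
    · have hx : f (vone n x) = c • φ (vone n x) := hx
      change f (vone n ⁅X, x⁆) = c • φ (vone n ⁅X, x⁆)
      rw [hsmul, hsmul, hx, smul_comm]
    · change f (vone n w) = c • φ (vone n w)
      rw [hc, hφ]
  refine ⟨c, fun m => ?_⟩
  refine verma_induction (P := fun m => f m = c • φ m) (fun u x => ?_) (fun a b ha hb => ?_) m
  · have hx : f (vone n x) = c • φ (vone n x) := show x ∈ N from hN ▸ Submodule.mem_top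
    rw [← smul_vone, map_smul, map_smul, hx, smul_comm]
  · rw [map_add, map_add, ha, hb, smul_add]

end Hom

end OrthogonalVerma

open OrthogonalVerma in
theorem mainTheorem6 (n : ℕ) (hn : 2 ≤ n)
    {V : Type*} [AddCommGroup V] [Module ℂ V] [LieRingModule (parabolic n) V]
    [LieModule ℂ (parabolic n) V] (v : V) (hv : IsHighestWeightModule n (nu n) v)
    {W : Type*} [AddCommGroup W] [Module ℂ W] [LieRingModule (parabolic n) W]
    [LieModule ℂ (parabolic n) W] (w : W) (hw : IsHighestWeightModule n (xi n) w) :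
    IsExtremal n (xi n) (vtmul n (extremalElement n) v) ∧
    ∃ φ : Verma n W →ₗ[U n] Verma n V,
      (∀ u : U n, φ (vtmul n u w) = vtmul n (u * extremalElement n) v) ∧
      φ ≠ 0 ∧
      ∀ f : Verma n W →ₗ[U n] Verma n V, ∃ c : ℂ, ∀ m, f m = c • φ m := by
  have hext := isExtremal_extremalElement hn hv
  obtain ⟨φ, hφ⟩ := exists_hom_extVec hn hv hw
  have h1 : φ (vone n w) = extVec (vermaRep n V) (vone n v) := by
    rw [vone_apply, hφ, one_smul]
  refine ⟨hext, φ, fun u => ?_, ?_, exists_eq_smul_hom hn hv hw h1⟩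
  · rw [hφ, ← vtmul_extremalElement, smul_vtmul]
  · rintro rfl
    apply hext.ne_zero
    rw [vtmul_extremalElement, ← h1, LinearMap.zero_apply]
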